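/- Let $d\ge 2$ and $0<\alpha\le\beta$. There are a constant $C>0$ depending only on $d,\alpha,\beta$ and constants $c_k>0$, $k\ge1$, depending only on $d,\alpha,\beta,k$, such that the following holds. Setting. Let $(\Omega,\mathcal F,\mathbb P)$ be a probability space with expectation $\mathbb E$ and let $(\theta_x)_{x\in\mathbb R^d}$ be a group of measurable, measure-preserving transformations of $\Omega$ ($\theta_0=\mathrm{Id}$, $\theta_{x+y}=\theta_x\circ\theta_y$) such that $(\omega,x)\mapsto\theta_x\omega$ is measurable, and which is ergodic: if $F\in\mathcal F$ and $\theta_xF\subset F$ for all $x$, then $\mathbb P(F)\in\{0,1\}$. Let $A\in L^\infty(\Omega)$ be a field of symmetric $d\times d$ matrices with $\xi\cdot A\xi\ge\alpha|\xi|^2$ and $|A\xi|\le\beta|\xi|$ for all $\xi\in\mathbb R^d$, and set $A(x,\omega)=A(\theta_x\omega)$. Let $\mathrm D=(\mathrm D_1,\dots,\mathrm D_d)$, $\mathrm D_if=\lim_{h\downarrow0}h^{-1}(f\circ\theta_{he_i}-f)$ in $L^2(\Omega)$, with domain $\mathcal H(\Omega)\subset L^2(\Omega)$. Let $\mathcal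 L=-\mathrm D\cdot A\mathrm D$ be the non-negative self-adjoint operator on $L^2(\Omega)$ associated with the quadratic form $u\mapsto\mathbb E[\mathrm Du\cdot A\mathrm Du]$ on $\mathcal H(\Omega)$, with spectral resolution $\mathcal L=\int_{\mathbb R^+}\lambda\,G(d\lambda)$. For $\xi\in\mathbb R^d$ let $\mathfrak d_\xi=\mathrm D\cdot A\xi\in\mathcal H(\Omega)'$, that is $\langle\mathfrak d_\xi,\psi\rangle=-\mathbb E[\mathrm D\psi\cdot A\xi]$, and let $e_{\mathfrak d_\xi}(d\lambda)=\langle\mathfrak d_\xi,G(d\lambda)\mathfrak d_\xi\rangle$, that is $e_{\mathfrak d_\xi}(d\lambda)=(1+\lambda)^2\,\mathbb E[w\,G(d\lambda)w]$ with $w=(1+\mathcal L)^{-1}\mathfrak d_\xi\in\mathcal H(\Omega)$. For $\xi\in\mathbb R^d$ let $\phi_\xi$ be the corrector: $\phi_\xi:\mathbb R^d\times\Omega\to\mathbb R$ is measurable, $\phi_\xi(0,\cdot)=0$ almost surely, $\nabla\phi_\xi(x,\omega)=\Phi_\xi(\theta_x\omega)$ with $\Phi_\xi\in L^2(\Omega,\mathbb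 R^d)$ and $\mathbb E[\Phi_\xi]=0$, and almost surely $\phi_\xi(\cdot,\omega)\in H^1_{\rm loc}(\mathbb R^d)$ solves $-\nabla\cdot A(\xi+\nabla\phi_\xi)=0$ in the sense of distributions on $\mathbb R^d$. For $T>0$ let $\phi_{T,\xi}\in\mathcal H(\Omega)$ be the unique weak solution of $T^{-1}\phi_{T,\xi}-\mathrm D\cdot A(\xi+\mathrm D\phi_{T,\xi})=0$, and define $\phi_{T,1,\xi}=\phi_{T,\xi}$ and $\phi_{T,k+1,\xi}=(2^k-1)^{-1}(2^k\phi_{2T,k,\xi}-\phi_{T,k,\xi})$ for $k\ge1$, with $\nabla\phi_{T,k,\xi}=\mathrm D\phi_{T,k,\xi}$. The correctors $\phi'_\xi$, $\phi'_{T,k,\xi}$ are defined in the same way for the transposed coefficients $A^*(=A)$. Let $A_{\rm hom}$ and $A_{T,k}$ be the matrices with $$e_i\cdot A_{\rm hom}e_j=\mathbb E[(e_i+\nabla\phi'_{e_i})\cdot A(e_j+\nabla\phi_{e_j})],\qquad e_i\cdot A_{T,k}e_j=\mathbb E[(e_i+\nabla\phi'_{T,k,e_i})\cdot A(e_j+\nabla\phi_{T,k,e_j})].$$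 Claim. Set $$I_{T,k}(\xi)=\int_{\mathbb R^+}\frac{T^{-2k}}{\lambda\,(T^{-1}+\lambda)^{2k}}\,de_{\mathfrak d_\xi}(\lambda)\in[0,\infty].$$ Then for all $T>0$, all $k\ge1$ and all unit vectors $\xi\in\mathbb R^d$, $$c_k\,I_{T,k}(\xi)\le\mathbb E\big[|\nabla\phi_{T,k,\xi}-\nabla\phi_\xi|^2\big]\le C\,I_{T,k}(\xi),$$ $$c_k\,I_{T,k}(\xi)\le\big|\xi\cdot(A_{T,k}-A_{\rm hom})\xi\big|\le C\,I_{T,k}(\xi),$$ and, for the operator norm, $$c_k\sup_{|\xi|=1}I_{T,k}(\xi)\le|A_{T,k}-A_{\rm hom}|\le C\sup_{|\xi|=1}I_{T,k}(\xi).$$ -/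

import Mathlib

open MeasureTheory Set Filter Topology
open scoped ENNReal

universe u

noncomputable section

namespace StochHom

/-! ### Resolutions of the identity on a real Hilbert space -/

section Spectral

variable {H : Type*} [NormedAddCommGroup H] [InnerProductSpace ℝ H] [CompleteSpace H]

variable (H) in
/-- A resolution of the identity (projection-valued measure) on the Borel sets of `ℝ`: orthogonal
projections, multiplicative, normalized, and countably additive in the strong sense. -/
structure ResolutionOfIdentity where
  /-- The projection attached to a set. -/
  proj : Set ℝ → H →L[ℝ] H
  isStarProjection : ∀ B, MeasurableSet B → IsStarProjection (proj B)
  proj_univ : proj univ = 1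
  proj_inter : ∀ B C, MeasurableSet B → MeasurableSet C → proj (B ∩ C) = proj B * proj C
  hasSum_iUnion : ∀ B : ℕ → Set ℝ, (∀ n, MeasurableSet (B n)) →
    Pairwise (Function.onFun Disjoint B) → ∀ x, HasSum (fun n => proj (B n) x) (proj (⋃ n, B n) x)

namespace ResolutionOfIdentity

theorem proj_empty (G : ResolutionOfIdentity H) (x : H) : G.proj ∅ x = 0 := by
  have h := G.hasSum_iUnion (fun _ => ∅) (fun _ => MeasurableSet.empty)
    (fun _ _ _ => by simp [Function.onFun]) x
  simp only [iUnion_empty] at h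
  have h1 := h.summable
  exact (summable_const_iff _).1 h1

theorem inner_proj_nonneg (G : ResolutionOfIdentity H) {B : Set ℝ} (hB : MeasurableSet B) (x : H) :
    0 ≤ inner ℝ x (G.proj B x) := by
  have h := G.isStarProjection B hB
  have h1 : G.proj B x = G.proj B (G.proj B x) := by
    conv_lhs => rw [← h.isIdempotentElem]
    rfl
  have h2 : ContinuousLinearMap.adjoint (G.proj B) = G.proj B := h.isSelfAdjoint
  rw [h1, ← ContinuousLinearMap.adjoint_inner_left, h2]
  exact real_inner_self_nonneg

/-- The scalar spectral measure `B ↦ ⟨x, G(B) x⟩` of a vector `x`. -/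
def scalarMeasure (G : ResolutionOfIdentity H) (x : H) : Measure ℝ :=
  Measure.ofMeasurable (fun B _ => ENNReal.ofReal (inner ℝ x (G.proj B x)))
    (by simp [G.proj_empty x])
    (by
      intro B hB hd
      have h := (innerSL ℝ x).hasSum (G.hasSum_iUnion B hB hd x)
      simp only [innerSL_apply_apply] at h
      rw [← h.tsum_eq]
      exact ENNReal.ofReal_tsum_of_nonneg (fun n => G.inner_proj_nonneg (hB n) x) h.summable)

/-- The (maximal) domain `{x | ∫ s² d⟨x, G(s) x⟩ < ∞}` of the operator `∫ s G(ds)`. -/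
def integralDomain (G : ResolutionOfIdentity H) : Set H :=
  {x | ∫⁻ s, ENNReal.ofReal (s ^ 2) ∂G.scalarMeasure x < ∞}

/-- The graph of the operator `∫ s G(ds)`: the pairs `(x, y)` with `x` in the domain and
`⟨y, z⟩ = ∫ s d⟨x, G(s) z⟩` for all `z` in the (dense) domain, where the signed measure
`⟨x, G(·) z⟩` is written through the polarization identity. -/
def integralGraph (G : ResolutionOfIdentity H) : Set (H × H) :=
  {p | p.1 ∈ G.integralDomain ∧ ∀ z ∈ G.integralDomain,
    inner ℝ p.2 z =
      ((∫ s, s ∂G.scalarMeasure (p.1 + z)) - ∫ s, s ∂G.scalarMeasure (p.1 - z)) / 4}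

/-- `G` is the spectral resolution of the operator with graph `L`, i.e. `L = ∫ s G(ds)` as an
identity of unbounded operators, domains included. -/
def IsSpectralResolutionOf (G : ResolutionOfIdentity H) (L : Set (H × H)) : Prop :=
  L = G.integralGraph

end ResolutionOfIdentity

end Spectral

/-! ### Random coefficients -/

/-- The Euclidean space `ℝ^d`. -/
abbrev Euc (d : ℕ) : Type := EuclideanSpace ℝ (Fin d)

/-- The action of a `d × d` matrix on a vector of `ℝ^d`. -/
abbrev act {d : ℕ} (M : Matrix (Fin d) (Fin d) ℝ) (v : Euc d) : Euc d :=
  Matrix.toEuclideanCLM (𝕜 := ℝ) M v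

/-- The Euclidean operator norm of a `d × d` matrix. -/
def opNorm {d : ℕ} (M : Matrix (Fin d) (Fin d) ℝ) : ℝ :=
  ‖Matrix.toEuclideanCLM (𝕜 := ℝ) M‖

/-- The set of matrices `M` with `ξ · Mξ ≥ α |ξ|²` and `|Mξ| ≤ β |ξ|` for all `ξ`. -/
def ellipticMatrices (d : ℕ) (α β : ℝ) : Set (Matrix (Fin d) (Fin d) ℝ) :=
  {M | ∀ ξ : Euc d, α * ‖ξ‖ ^ 2 ≤ inner ℝ ξ (act M ξ) ∧ ‖act M ξ‖ ≤ β * ‖ξ‖}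

/-- A measurable, measure-preserving, ergodic translation group `(θ_x)_{x ∈ ℝ^d}`. -/
structure ErgodicTranslationGroup (d : ℕ) {Ω : Type u} [MeasurableSpace Ω] (μ : Measure Ω) where
  /-- The transformation `θ_x`. -/
  shift : Euc d → Ω → Ω
  shift_zero : ∀ ω, shift 0 ω = ω
  shift_add : ∀ x y ω, shift (x + y) ω = shift x (shift y ω)
  measurePreserving : ∀ x, MeasurePreserving (shift x) μ μ
  measurable_joint : Measurable (fun p : Ω × Euc d => shift p.2 p.1)
  ergodic : ∀ F : Set Ω, MeasurableSet F → (∀ x, shift x '' F ⊆ F) → μ F = 0 ∨ μ F = 1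

section Random

variable {d : ℕ} {Ω : Type u} [MeasurableSpace Ω] {μ : Measure Ω}

/-- `A ∈ L^∞(Ω, M_{αβ}^sym)`: an (a.e. defined) measurable field of symmetric elliptic matrices. -/
structure IsSymmetricCoefficient (μ : Measure Ω) (α β : ℝ) (A : Ω → Matrix (Fin d) (Fin d) ℝ) :
    Prop where
  aemeasurable : ∀ i j, AEMeasurable (fun ω => A ω i j) μ
  elliptic : ∀ᵐ ω ∂μ, A ω ∈ ellipticMatrices d α β
  symmetric : ∀ᵐ ω ∂μ, (A ω).IsSymm

/-- The transposed field `A^*`. -/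
def transposeField (A : Ω → Matrix (Fin d) (Fin d) ℝ) : Ω → Matrix (Fin d) (Fin d) ℝ :=
  fun ω => (A ω).transpose

/-! ### Differential calculus in the probability space -/

/-- The translation `f ↦ f ∘ θ_x` on `L²(Ω)`. -/
def translate (θ : ErgodicTranslationGroup d μ) (x : Euc d) (f : Lp ℝ 2 μ) : Lp ℝ 2 μ :=
  Lp.compMeasurePreserving (θ.shift x) (θ.measurePreserving x) f

/-- `F ∈ L²(Ω, ℝ^d)` is the stochastic gradient of `f ∈ L²(Ω)`: for each `i`, the difference
quotients `(f ∘ θ_{h e_i} - f) / h` converge to `F_i` in `L²(Ω)` as `h ↓ 0`. -/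
def HasStochGrad (θ : ErgodicTranslationGroup d μ) (f : Lp ℝ 2 μ) (F : Lp (Euc d) 2 μ) : Prop :=
  ∀ i : Fin d, Tendsto
    (fun h : ℝ => h⁻¹ • (translate θ (EuclideanSpace.single i h) f - f)) (𝓝[>] 0)
    (𝓝 ((EuclideanSpace.proj i : Euc d →L[ℝ] ℝ).compLp F))

/-- The domain `ℋ(Ω)` of the stochastic gradient. -/
def gradDomain (θ : ErgodicTranslationGroup d μ) : Set (Lp ℝ 2 μ) :=
  {f | ∃ F, HasStochGrad θ f F}

open Classical in
/-- The stochastic gradient `D f` of `f ∈ ℋ(Ω)` (and `0` outside of `ℋ(Ω)`). -/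
def stochGrad (θ : ErgodicTranslationGroup d μ) (f : Lp ℝ 2 μ) : Lp (Euc d) 2 μ :=
  if h : ∃ F, HasStochGrad θ f F then h.choose else 0

/-- The graph of the operator `ℒ = -D · A D` on `L²(Ω)` associated with the quadratic form
`u ↦ E[Du · A Du]` on `ℋ(Ω)` (Friedrichs extension): the pairs `(u, f)` with `u ∈ ℋ(Ω)` and
`E[Dψ · A Du] = E[ψ f]` for all `ψ ∈ ℋ(Ω)`. -/
def ellipticGraph (θ : ErgodicTranslationGroup d μ) (A : Ω → Matrix (Fin d) (Fin d) ℝ) :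
    Set (Lp ℝ 2 μ × Lp ℝ 2 μ) :=
  {p | p.1 ∈ gradDomain θ ∧ ∀ ψ ∈ gradDomain θ,
    ∫ ω, inner ℝ (stochGrad θ ψ ω) (act (A ω) (stochGrad θ p.1 ω)) ∂μ = ∫ ω, ψ ω * p.2 ω ∂μ}

/-- The local drift `𝔡 = D · A ξ`, as a functional on `ℋ(Ω)`: `⟨𝔡, ψ⟩ = - E[Dψ · A ξ]`. -/
def localDrift (θ : ErgodicTranslationGroup d μ) (A : Ω → Matrix (Fin d) (Fin d) ℝ) (ξ : Euc d)
    (ψ : Lp ℝ 2 μ) : ℝ :=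
  - ∫ ω, inner ℝ (stochGrad θ ψ ω) (act (A ω) ξ) ∂μ

/-- `w = (1 + ℒ)⁻¹ ℓ` for a functional `ℓ` on `ℋ(Ω)`: `w ∈ ℋ(Ω)` and
`E[ψ w] + E[Dψ · A Dw] = ⟨ℓ, ψ⟩` for all `ψ ∈ ℋ(Ω)`. -/
def IsResolventAtOne (θ : ErgodicTranslationGroup d μ) (A : Ω → Matrix (Fin d) (Fin d) ℝ)
    (l : Lp ℝ 2 μ → ℝ) (w : Lp ℝ 2 μ) : Prop :=
  w ∈ gradDomain θ ∧ ∀ ψ ∈ gradDomain θ,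
    ∫ ω, ψ ω * w ω ∂μ + ∫ ω, inner ℝ (stochGrad θ ψ ω) (act (A ω) (stochGrad θ w ω)) ∂μ = l ψ

/-- The projection `e_𝔡(ds) = ⟨𝔡, G(ds) 𝔡⟩` of the resolution `G` of `ℒ` onto the local drift.
As `𝔡` only belongs to the dual of `ℋ(Ω)`, one writes `𝔡 = (1 + ℒ) w` with
`w = (1 + ℒ)⁻¹ 𝔡 ∈ ℋ(Ω)`, so that `⟨𝔡, G(ds) 𝔡⟩ = (1 + s)² ⟨w, G(ds) w⟩`. -/
def driftMeasure (θ : ErgodicTranslationGroup d μ) (A : Ω → Matrix (Fin d) (Fin d) ℝ)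
    (G : ResolutionOfIdentity (Lp ℝ 2 μ)) (ξ : Euc d) : Measure ℝ :=
  (G.scalarMeasure (Classical.epsilon (IsResolventAtOne θ A (localDrift θ A ξ)))).withDensity
    (fun s => ENNReal.ofReal ((1 + s) ^ 2))

/-- The integral `∫_{ℝ⁺} T^{-2k} / (s (T⁻¹ + s)^{2k}) de_𝔡(s)`, with values in `[0, ∞]`
(the integrand is `∞` at `s = 0`). -/
def driftIntegral (θ : ErgodicTranslationGroup d μ) (A : Ω → Matrix (Fin d) (Fin d) ℝ)
    (G : ResolutionOfIdentity (Lp ℝ 2 μ)) (ξ : Euc d) (T : ℝ) (k : ℕ) : ℝ≥0∞ :=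
  ∫⁻ s in Ici (0 : ℝ), ENNReal.ofReal (T⁻¹ ^ (2 * k)) / ENNReal.ofReal (s * (T⁻¹ + s) ^ (2 * k))
    ∂driftMeasure θ A G ξ

/-! ### Correctors -/

/-- `φ : ℝ^d × Ω → ℝ` is a corrector in direction `ξ` for the coefficients `A`, with stationary
gradient `∇φ(x, ω) = Φ(θ_x ω)`. -/
structure IsCorrector (θ : ErgodicTranslationGroup d μ) (A : Ω → Matrix (Fin d) (Fin d) ℝ)
    (ξ : Euc d) (φ : Euc d → Ω → ℝ) (Φ : Ω → Euc d) : Prop where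
  measurable : Measurable (fun p : Euc d × Ω => φ p.1 p.2)
  anchored : ∀ᵐ ω ∂μ, φ 0 ω = 0
  gradient_memLp : MemLp Φ 2 μ
  gradient_mean : ∫ ω, Φ ω ∂μ = 0
  /-- `φ(·, ω) ∈ L²_loc` and `x ↦ Φ(θ_x ω) ∈ L²_loc`. -/
  locally_L2 : ∀ᵐ ω ∂μ, ∀ K : Set (Euc d), IsCompact K →
    MemLp (fun x => φ x ω) 2 (volume.restrict K) ∧
      MemLp (fun x => Φ (θ.shift x ω)) 2 (volume.restrict K)
  /-- `x ↦ Φ(θ_x ω)` is the weak gradient of `φ(·, ω)`. -/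
  weak_gradient : ∀ᵐ ω ∂μ, ∀ η : Euc d → ℝ, ContDiff ℝ (⊤ : ℕ∞) η → HasCompactSupport η →
    ∀ i : Fin d, ∫ x, φ x ω * gradient η x i = - ∫ x, Φ (θ.shift x ω) i * η x
  /-- `-∇ · A(x, ω)(ξ + ∇φ(x, ω)) = 0` in the sense of distributions on `ℝ^d`. -/
  equation : ∀ᵐ ω ∂μ, ∀ η : Euc d → ℝ, ContDiff ℝ (⊤ : ℕ∞) η → HasCompactSupport η →
    ∫ x, inner ℝ (gradient η x) (act (A (θ.shift x ω)) (ξ + Φ (θ.shift x ω))) = 0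

/-- `u` is a weak solution in `ℋ(Ω)` of `T⁻¹ u - D · A (ξ + D u) = 0`. -/
def IsRegularizedCorrector (θ : ErgodicTranslationGroup d μ)
    (A : Ω → Matrix (Fin d) (Fin d) ℝ) (ξ : Euc d) (T : ℝ) (u : Lp ℝ 2 μ) : Prop :=
  u ∈ gradDomain θ ∧ ∀ ψ ∈ gradDomain θ,
    ∫ ω, (T⁻¹ * u ω * ψ ω
      + inner ℝ (stochGrad θ ψ ω) (act (A ω) (ξ + stochGrad θ u ω))) ∂μ = 0

/-- The regularized corrector `φ_T(0, ·)` in direction `ξ`: the unique weak solution. -/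
def regularizedCorrector (θ : ErgodicTranslationGroup d μ)
    (A : Ω → Matrix (Fin d) (Fin d) ℝ) (ξ : Euc d) (T : ℝ) : Lp ℝ 2 μ :=
  Classical.epsilon (IsRegularizedCorrector θ A ξ T)

/-- Richardson extrapolation in `T`, for `k ≥ 1` (the value at `k = 0` is not used):
`f_{T,1} = f_T` and `f_{T,k+1} = (2^k f_{2T,k} - f_{T,k}) / (2^k - 1)`. -/
def richardson {V : Type*} [AddCommGroup V] [Module ℝ V] (f : ℝ → V) : ℕ → ℝ → V
  | 0, _ => 0
  | 1, T => f T
  | k + 2, T => ((2 : ℝ) ^ (k + 1) - 1)⁻¹ •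
      ((2 : ℝ) ^ (k + 1) • richardson f (k + 1) (2 * T) - richardson f (k + 1) T)

/-- The gradient `∇φ_{T,k}(0, ·) = D φ_{T,k}(0, ·)` of the extrapolated regularized corrector
`φ_{T,k}` in direction `ξ`. -/
def extrapolatedGradient (θ : ErgodicTranslationGroup d μ)
    (A : Ω → Matrix (Fin d) (Fin d) ℝ) (ξ : Euc d) (T : ℝ) (k : ℕ) : Lp (Euc d) 2 μ :=
  stochGrad θ (richardson (regularizedCorrector θ A ξ) k T)

/-- The matrix `M` with entries `e_i · M e_j = E[(e_i + Φ'_{e_i}) · A (e_j + Φ_{e_j})]`, where `Φ_ξ`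
and `Φ'_ξ` are the fields attached to the direction `ξ`. -/
def effectiveMatrix (μ : Measure Ω) (A : Ω → Matrix (Fin d) (Fin d) ℝ)
    (Φ Φ' : Euc d → Ω → Euc d) : Matrix (Fin d) (Fin d) ℝ :=
  Matrix.of fun i j => ∫ ω, inner ℝ
    (EuclideanSpace.single i 1 + Φ' (EuclideanSpace.single i 1) ω)
    (act (A ω) (EuclideanSpace.single j 1 + Φ (EuclideanSpace.single j 1) ω)) ∂μ

/-- The approximation `A_{T,k}` of the homogenized coefficients: the effective matrix of the
extrapolated primal and dual regularized correctors. -/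
def approxMatrix (θ : ErgodicTranslationGroup d μ) (A : Ω → Matrix (Fin d) (Fin d) ℝ)
    (T : ℝ) (k : ℕ) : Matrix (Fin d) (Fin d) ℝ :=
  effectiveMatrix μ A (fun ξ ω => extrapolatedGradient θ A ξ T k ω)
    (fun ξ ω => extrapolatedGradient θ (transposeField A) ξ T k ω)

end Random

end StochHom

end

open StochHom

/-! Write L for the operator -D·AD, 𝔡 for the drift and v_T = T⁻¹φ_T. Formally φ_T = (T⁻¹ + L)⁻¹𝔡,
so v_T = (1 + TL)⁻¹𝔡, and the error e = Φ - Dφ_T satisfies -D·Ae = v_T. The Richardson weights sum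
to one, so the error of the extrapolated gradient solves the same equation with v_{T,k}, the
extrapolation of v_T (`richardson_error`). Extrapolating v_T amounts to applying one more resolvent,
v_{T,k+1} = (1 + 2^k T L)⁻¹ v_{T,k} (`richardson_recursion`), because 2(1 + 2X)⁻¹ - (1 + X)⁻¹ = ((1
+ X)(1 + 2X))⁻¹ and likewise at higher order. Hence v_{T,k} = ∏_{j<k} (1 + 2^j T L)⁻¹ 𝔡.

If e is a limit of gradients and -D·Ae = v, its energy E[e·Ae] is ∫ s⁻¹ d⟨v, G(s)v⟩
(`energy_eq_lintegral`). The energy of the error is therefore ∫ s⁻¹ ∏_{j<k} (1 + 2^j T s)⁻² de_𝔡(s).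
The product lies between 2^(-2k²) and 1 times (1 + Ts)^(-2k) = T^(-2k)/(T⁻¹ + s)^(2k), so the energy
is comparable to I_{T,k} (`extrapolation_energy_bounds`).

Ellipticity turns energy into the squared L² norm. The corrected field ξ + Φ is A-orthogonal to
limits of gradients, so ξ·(A_{T,k} - A_hom)ξ is exactly the energy of the error
(`inner_matrix_error`). The matrix error is thus symmetric and nonnegative, and its operator norm is
the supremum of its quadratic form over unit vectors.

Two supports are needed. On the spectral side 𝔡 is only a functional, so all spectral measures are
computed from w = (1 + L)⁻¹𝔡 through affine expressions in L (`scalarMeasure_linear_combination`).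
On the probabilistic side the corrector equation on ℝ^d is carried over to Ω, and its stationary
gradient is shown to be a limit of stochastic gradients by a Weyl decomposition in which ergodicity
enters (`IsCurlFree.mem_closure`). -/

namespace StochHom

/-! ### Spectral measures of a resolution of the identity and of the operator ∫ s G(ds). -/

namespace ResolutionOfIdentity

variable {H : Type*} [NormedAddCommGroup H] [InnerProductSpace ℝ H] [CompleteSpace H]
  (G : ResolutionOfIdentity H)

theorem scalarMeasure_apply (x : H) {B : Set ℝ} (hB : MeasurableSet B) :
    G.scalarMeasure x B = ENNReal.ofReal (inner ℝ x (G.proj B x)) :=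
  Measure.ofMeasurable_apply B hB

theorem inner_proj_symm {B : Set ℝ} (hB : MeasurableSet B) (x y : H) :
    inner ℝ (G.proj B x) y = inner ℝ x (G.proj B y) := by
  have h2 : ContinuousLinearMap.adjoint (G.proj B) = G.proj B :=
    (G.isStarProjection B hB).isSelfAdjoint
  rw [← ContinuousLinearMap.adjoint_inner_left, h2]

theorem proj_proj {B C : Set ℝ} (hB : MeasurableSet B) (hC : MeasurableSet C) (x : H) :
    G.proj B (G.proj C x) = G.proj (B ∩ C) x := by
  rw [G.proj_inter B C hB hC]; rfl

/-- Finite additivity follows from countable additivity by padding the pair B, Bᶜ with empty sets.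
-/
theorem proj_add_proj_compl {B : Set ℝ} (hB : MeasurableSet B) (x : H) :
    G.proj B x + G.proj Bᶜ x = x := by
  have h := G.hasSum_iUnion (fun n => if n = 0 then B else if n = 1 then Bᶜ else ∅)
    (fun n => by split_ifs <;> simp [hB])
    (fun i j hij => by
      simp only [Function.onFun]
      split_ifs <;> simp_all [disjoint_compl_right, disjoint_compl_left]) x
  have hU : (⋃ n : ℕ, if n = 0 then B else if n = 1 then Bᶜ else ∅) = univ := by
    refine eq_univ_of_forall fun s => ?_
    by_cases hs : s ∈ B
    · exact mem_iUnion.2 ⟨0, by simpa using hs⟩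
    · exact mem_iUnion.2 ⟨1, by simpa using hs⟩
  rw [hU, G.proj_univ] at h
  have h2 : HasSum (fun n : ℕ => G.proj (if n = 0 then B else if n = 1 then Bᶜ else ∅) x)
      (∑ n ∈ ({0, 1} : Finset ℕ), G.proj (if n = 0 then B else if n = 1 then Bᶜ else ∅) x) :=
    hasSum_sum_of_ne_finset_zero (fun n hn => by
      simp only [Finset.mem_insert, Finset.mem_singleton, not_or] at hn
      simp [hn.1, hn.2, G.proj_empty x])
  simpa using (h.unique h2).symm

instance (x : H) : IsFiniteMeasure (G.scalarMeasure x) :=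
  ⟨by rw [scalarMeasure_apply G x MeasurableSet.univ]; exact ENNReal.ofReal_lt_top⟩

/-- The spectral measure is quadratic in the vector; self-adjointness of the projections makes the
hypothesis kill both cross terms. -/
theorem scalarMeasure_add_of_orthogonal {x y : H}
    (h : ∀ E, MeasurableSet E → inner ℝ x (G.proj E y) = 0) :
    G.scalarMeasure (x + y) = G.scalarMeasure x + G.scalarMeasure y := by
  ext E hE
  rw [Measure.add_apply, G.scalarMeasure_apply _ hE, G.scalarMeasure_apply _ hE,
    G.scalarMeasure_apply _ hE, ← ENNReal.ofReal_add (G.inner_proj_nonneg hE x)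
      (G.inner_proj_nonneg hE y)]
  congr 1
  have h1 : inner ℝ y (G.proj E x) = 0 := by
    rw [← G.inner_proj_symm hE, real_inner_comm, h E hE]
  rw [map_add, inner_add_left, inner_add_right, inner_add_right, h E hE, h1]
  ring

theorem scalarMeasure_proj {B : Set ℝ} (hB : MeasurableSet B) (x : H) :
    G.scalarMeasure (G.proj B x) = (G.scalarMeasure x).restrict B := by
  ext E hE
  rw [Measure.restrict_apply hE, G.scalarMeasure_apply _ hE, G.scalarMeasure_apply _ (hE.inter hB),
    G.inner_proj_symm hB, G.proj_proj hE hB, G.proj_proj hB (hE.inter hB)]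
  congr 4
  ext s; simp

theorem scalarMeasure_smul (c : ℝ) (x : H) :
    G.scalarMeasure (c • x) = ENNReal.ofReal (c ^ 2) • G.scalarMeasure x := by
  ext E hE
  rw [Measure.smul_apply, G.scalarMeasure_apply _ hE, G.scalarMeasure_apply _ hE, smul_eq_mul,
    ← ENNReal.ofReal_mul (sq_nonneg c), map_smul, inner_smul_left, inner_smul_right]
  congr 1
  simp; ring

theorem scalarMeasure_neg (x : H) : G.scalarMeasure (-x) = G.scalarMeasure x := by
  have := G.scalarMeasure_smul (-1) x
  simpa using this

theorem inner_proj_disjoint {B C : Set ℝ} (hB : MeasurableSet B) (hC : MeasurableSet C)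
    (h : Disjoint B C) (x y : H) {E : Set ℝ} (hE : MeasurableSet E) :
    inner ℝ (G.proj B x) (G.proj E (G.proj C y)) = 0 := by
  rw [G.inner_proj_symm hB, G.proj_proj hE hC, G.proj_proj hB (hE.inter hC)]
  have : B ∩ (E ∩ C) = ∅ := by
    rw [inter_left_comm, h.inter_eq, inter_empty]
  rw [this, G.proj_empty, inner_zero_right]

theorem scalarMeasure_proj_add_proj_compl {B : Set ℝ} (hB : MeasurableSet B) (x y : H) :
    G.scalarMeasure (G.proj B x + G.proj Bᶜ y) =
      G.scalarMeasure (G.proj B x) + G.scalarMeasure (G.proj Bᶜ y) :=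
  G.scalarMeasure_add_of_orthogonal fun _ hE =>
    G.inner_proj_disjoint hB hB.compl disjoint_compl_right x y hE

/-- Parallelogram inequality: the discarded term is ⟨x - y, G(E)(x - y)⟩ ≥ 0. It makes the domain of
∫ s G(ds) stable under addition. -/
theorem scalarMeasure_add_le (x y : H) :
    G.scalarMeasure (x + y) ≤ (2 : ℝ≥0∞) • (G.scalarMeasure x + G.scalarMeasure y) := by
  refine Measure.le_iff.2 fun E hE => ?_
  rw [Measure.smul_apply, Measure.add_apply, G.scalarMeasure_apply _ hE, G.scalarMeasure_apply _ hE,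
    G.scalarMeasure_apply _ hE, ← ENNReal.ofReal_add (G.inner_proj_nonneg hE x)
      (G.inner_proj_nonneg hE y), smul_eq_mul, show (2 : ℝ≥0∞) = ENNReal.ofReal 2 by simp,
    ← ENNReal.ofReal_mul (by norm_num)]
  refine ENNReal.ofReal_le_ofReal ?_
  have h := G.inner_proj_nonneg hE (x - y)
  simp only [map_add, map_sub, inner_add_left, inner_sub_left, inner_add_right,
    inner_sub_right] at h ⊢
  linarith

theorem mem_integralDomain {x : H} :
    x ∈ G.integralDomain ↔ ∫⁻ s, ENNReal.ofReal (s ^ 2) ∂G.scalarMeasure x < ∞ := Iff.rfl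

variable {G}

theorem integralDomain_add {x y : H} (hx : x ∈ G.integralDomain) (hy : y ∈ G.integralDomain) :
    x + y ∈ G.integralDomain := by
  rw [mem_integralDomain] at *
  refine (lintegral_mono' (G.scalarMeasure_add_le x y) le_rfl).trans_lt ?_
  rw [lintegral_smul_measure, lintegral_add_measure, smul_eq_mul]
  exact ENNReal.mul_lt_top (by simp) (ENNReal.add_lt_top.2 ⟨hx, hy⟩)

theorem integralDomain_neg {x : H} (hx : x ∈ G.integralDomain) : -x ∈ G.integralDomain := by
  rw [mem_integralDomain] at *
  rwa [G.scalarMeasure_neg]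

theorem integralDomain_sub {x y : H} (hx : x ∈ G.integralDomain) (hy : y ∈ G.integralDomain) :
    x - y ∈ G.integralDomain := by
  rw [sub_eq_add_neg]; exact integralDomain_add hx (integralDomain_neg hy)

theorem integralDomain_proj {x : H} (hx : x ∈ G.integralDomain) {B : Set ℝ}
    (hB : MeasurableSet B) : G.proj B x ∈ G.integralDomain := by
  rw [mem_integralDomain] at *
  rw [G.scalarMeasure_proj hB]
  exact (lintegral_mono' Measure.restrict_le_self le_rfl).trans_lt hx

/-- Supplies test vectors: truncating any vector to a bounded spectral window puts it in the domain.
-/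
theorem proj_mem_integralDomain_of_bounded (x : H) {B : Set ℝ} (hB : MeasurableSet B) {n : ℝ}
    (hn : B ⊆ Icc (-n) n) : G.proj B x ∈ G.integralDomain := by
  rw [mem_integralDomain, G.scalarMeasure_proj hB]
  calc ∫⁻ s in B, ENNReal.ofReal (s ^ 2) ∂G.scalarMeasure x
      ≤ ∫⁻ _ in B, ENNReal.ofReal (n ^ 2) ∂G.scalarMeasure x := by
        refine setLIntegral_mono measurable_const fun s hs => ?_
        refine ENNReal.ofReal_le_ofReal ?_
        have := hn hs
        exact sq_le_sq' this.1 this.2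
    _ < ∞ := by
        rw [lintegral_const]
        exact ENNReal.mul_lt_top ENNReal.ofReal_lt_top (measure_lt_top _ _)

theorem integrable_sq {x : H} (hx : x ∈ G.integralDomain) :
    Integrable (fun s : ℝ => s ^ 2) (G.scalarMeasure x) := by
  refine ⟨(by fun_prop), ?_⟩
  rw [hasFiniteIntegral_iff_ofReal (Eventually.of_forall fun s => sq_nonneg s)]
  exact hx

theorem integrable_id {x : H} (hx : x ∈ G.integralDomain) :
    Integrable (fun s : ℝ => s) (G.scalarMeasure x) := by
  refine ((integrable_sq hx).add (integrable_const (1 : ℝ))).mono' (by fun_prop)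
    (Eventually.of_forall fun s => ?_)
  simp only [Pi.add_apply, Real.norm_eq_abs]
  nlinarith [sq_abs s, sq_nonneg (|s| - 1), abs_nonneg s]

theorem mem_integralGraph {x f : H} : (x, f) ∈ G.integralGraph ↔ x ∈ G.integralDomain ∧
    ∀ z ∈ G.integralDomain, inner ℝ f z =
      ((∫ s, s ∂G.scalarMeasure (x + z)) - ∫ s, s ∂G.scalarMeasure (x - z)) / 4 := Iff.rfl

/-- The operator `∫ s G(ds)` commutes with the projections of `G`. -/
theorem proj_mem_integralGraph {x f : H} (h : (x, f) ∈ G.integralGraph) {B : Set ℝ}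
    (hB : MeasurableSet B) : (G.proj B x, G.proj B f) ∈ G.integralGraph := by
  refine mem_integralGraph.2 ⟨integralDomain_proj h.1 hB, fun z hz => ?_⟩
  have hBz := integralDomain_proj hz hB
  have hBx := integralDomain_proj h.1 hB
  have hCz := integralDomain_proj hz hB.compl
  have hCx := integralDomain_proj h.1 hB.compl
  rw [G.inner_proj_symm hB, (mem_integralGraph.1 h).2 _ hBz]
  -- All four vectors of the polarization formulas are split along B and Bᶜ. The parts over Bᶜ are
  -- ±x-free of B and agree within each pair, so they cancel in the differences and only G(B)(x ± z)
  -- survives.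
  have e1 : x + G.proj B z = G.proj B (x + z) + G.proj Bᶜ x := by
    conv_lhs => rw [← G.proj_add_proj_compl hB x]
    rw [map_add]; abel
  have e2 : x - G.proj B z = G.proj B (x - z) + G.proj Bᶜ x := by
    conv_lhs => rw [← G.proj_add_proj_compl hB x]
    rw [map_sub]; abel
  have e3 : G.proj B x + z = G.proj B (x + z) + G.proj Bᶜ z := by
    conv_lhs => rw [← G.proj_add_proj_compl hB z]
    rw [map_add]; abel
  have e4 : G.proj B x - z = G.proj B (x - z) + G.proj Bᶜ (-z) := by
    conv_lhs => rw [← G.proj_add_proj_compl hB z]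
    rw [map_sub, map_neg]; abel
  rw [e1, e2, e3, e4]
  simp only [G.scalarMeasure_proj_add_proj_compl hB]
  rw [map_neg, G.scalarMeasure_neg]
  have i1 := integrable_id (integralDomain_proj (integralDomain_add h.1 hz) hB)
  have i2 := integrable_id (integralDomain_proj (integralDomain_sub h.1 hz) hB)
  have i3 := integrable_id hCx
  have i4 := integrable_id hCz
  rw [integral_add_measure i1 i3, integral_add_measure i2 i3, integral_add_measure i1 i4,
    integral_add_measure i2 i4]
  ring

/-- Take z = G(B)x in the definition of the graph: x + z and x - z differ only over B, where they
equal 2x and 0, so the factor 4 cancels the denominator. -/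
theorem inner_proj_eq_setIntegral {x f : H} (h : (x, f) ∈ G.integralGraph) {B : Set ℝ}
    (hB : MeasurableSet B) : inner ℝ f (G.proj B x) = ∫ s in B, s ∂G.scalarMeasure x := by
  have hBx := integralDomain_proj h.1 hB
  rw [(mem_integralGraph.1 h).2 _ hBx]
  have e1 : x + G.proj B x = G.proj B ((2 : ℝ) • x) + G.proj Bᶜ x := by
    conv_lhs => rw [← G.proj_add_proj_compl hB x]
    rw [map_smul, two_smul, map_add, G.proj_proj hB hB, G.proj_proj hB hB.compl]
    simp [G.proj_empty]; abel
  have e2 : x - G.proj B x = G.proj Bᶜ x := by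
    rw [sub_eq_iff_eq_add', G.proj_add_proj_compl hB]
  have i3 := integrable_id (integralDomain_proj h.1 hB.compl)
  have i1 := integrable_id hBx
  rw [e1, e2, G.scalarMeasure_proj_add_proj_compl hB, map_smul, G.scalarMeasure_smul,
    integral_add_measure (i1.smul_measure (by simp)) i3, integral_smul_measure,
    ← G.scalarMeasure_proj hB]
  norm_num

theorem ae_nonneg_of_Iio {ν : Measure ℝ} (h : ν (Iio 0) = 0) : ∀ᵐ s ∂ν, 0 ≤ s := by
  rw [ae_iff]
  simp only [not_le]
  exact h

/-- Formally ⟨Lx, G(E)Lx⟩ = ∫_E s² dμ_x. The vector f = Lx need not lie in the domain, so it cannot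
serve as a test vector directly; it is truncated to bounded windows, which then exhaust the line.
Nonnegativity of the spectrum seen by x makes s·μ_x a positive measure. -/
theorem scalarMeasure_of_mem_integralGraph {x f : H} (h : (x, f) ∈ G.integralGraph)
    (hpos : G.scalarMeasure x (Iio 0) = 0) :
    G.scalarMeasure f = (G.scalarMeasure x).withDensity (fun s => ENNReal.ofReal (s ^ 2)) := by
  have hpos' : ∀ᵐ s ∂G.scalarMeasure x, 0 ≤ s := by
    exact ae_nonneg_of_Iio hpos
  have hint := integrable_id h.1
  have hdens : ∀ E, MeasurableSet E →
      (G.scalarMeasure x).withDensity (fun s => ENNReal.ofReal s) E =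
        ENNReal.ofReal (inner ℝ f (G.proj E x)) := fun E hE => by
    rw [withDensity_apply _ hE, inner_proj_eq_setIntegral h hE,
      ofReal_integral_eq_lintegral_ofReal hint.integrableOn (ae_restrict_of_ae hpos')]
  have hnn : ∀ E, MeasurableSet E → 0 ≤ inner ℝ f (G.proj E x) := fun E hE => by
    rw [inner_proj_eq_setIntegral h hE]
    exact integral_nonneg_of_ae (ae_restrict_of_ae hpos')
  have key : ∀ B, MeasurableSet B → ∀ n : ℝ, B ⊆ Icc (-n) n →
      G.scalarMeasure f B = ∫⁻ s in B, ENNReal.ofReal (s ^ 2) ∂G.scalarMeasure x := by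
    intro B hB n hn
    have hz := proj_mem_integralDomain_of_bounded (G := G) f hB hn
    -- ρ represents the cross term E ↦ ⟨x, G(E)G(B)f⟩, which equals s·μ_x restricted to B.
    set ρ := ((G.scalarMeasure x).withDensity (fun s => ENNReal.ofReal s)).restrict B with hρ
    have hρ_apply : ∀ E, MeasurableSet E → ρ E = ENNReal.ofReal (inner ℝ x (G.proj E (G.proj B f)))
        ∧ 0 ≤ inner ℝ x (G.proj E (G.proj B f)) := by
      intro E hE
      have : inner ℝ x (G.proj E (G.proj B f)) = inner ℝ f (G.proj (E ∩ B) x) := by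
        rw [G.proj_proj hE hB, ← G.inner_proj_symm (hE.inter hB), real_inner_comm]
      rw [this]
      exact ⟨by rw [hρ, Measure.restrict_apply hE, hdens _ (hE.inter hB)], hnn _ (hE.inter hB)⟩
    have hsymm : ∀ E, MeasurableSet E → inner ℝ (G.proj B f) (G.proj E x) =
        inner ℝ x (G.proj E (G.proj B f)) := fun E hE => by
      rw [← G.inner_proj_symm hE, real_inner_comm]
    have m1 : G.scalarMeasure (x + G.proj B f) =
        G.scalarMeasure x + G.scalarMeasure (G.proj B f) + (2 : ℝ≥0∞) • ρ := by
      ext E hE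
      obtain ⟨a1, a2⟩ := hρ_apply E hE
      rw [Measure.add_apply, Measure.add_apply, Measure.smul_apply, a1, G.scalarMeasure_apply _ hE,
        G.scalarMeasure_apply _ hE, G.scalarMeasure_apply _ hE, smul_eq_mul,
        show (2 : ℝ≥0∞) = ENNReal.ofReal 2 by simp, ← ENNReal.ofReal_mul (by norm_num),
        ← ENNReal.ofReal_add (G.inner_proj_nonneg hE x) (G.inner_proj_nonneg hE _),
        ← ENNReal.ofReal_add (add_nonneg (G.inner_proj_nonneg hE x) (G.inner_proj_nonneg hE _))
          (by positivity)]
      congr 1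
      rw [map_add, inner_add_left, inner_add_right, inner_add_right, hsymm E hE]
      ring
    -- The cross term is kept on the left because measures cannot be subtracted.
    have m2 : G.scalarMeasure (x - G.proj B f) + (2 : ℝ≥0∞) • ρ =
        G.scalarMeasure x + G.scalarMeasure (G.proj B f) := by
      ext E hE
      obtain ⟨a1, a2⟩ := hρ_apply E hE
      rw [Measure.add_apply, Measure.add_apply, Measure.smul_apply, a1, G.scalarMeasure_apply _ hE,
        G.scalarMeasure_apply _ hE, G.scalarMeasure_apply _ hE, smul_eq_mul,
        show (2 : ℝ≥0∞) = ENNReal.ofReal 2 by simp, ← ENNReal.ofReal_mul (by norm_num),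
        ← ENNReal.ofReal_add (G.inner_proj_nonneg hE x) (G.inner_proj_nonneg hE _),
        ← ENNReal.ofReal_add (G.inner_proj_nonneg hE _) (by positivity)]
      congr 1
      rw [map_sub, inner_sub_left, inner_sub_right, inner_sub_right, hsymm E hE]
      ring
    have hle : (2 : ℝ≥0∞) • ρ ≤ G.scalarMeasure (x + G.proj B f) := by
      rw [m1]; exact Measure.le_add_left le_rfl
    have i0 : Integrable (fun s : ℝ => s) ((2 : ℝ≥0∞) • ρ) :=
      (integrable_id (integralDomain_add h.1 hz)).mono_measure hle
    have i0' : Integrable (fun s : ℝ => s) ρ := by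
      refine i0.mono_measure ?_
      rw [two_smul]; exact Measure.le_add_left le_rfl
    have e1 := congrArg (fun m => ∫ s, s ∂m) m1
    have e2 := congrArg (fun m => ∫ s, s ∂m) m2
    rw [integral_add_measure ((integrable_id h.1).add_measure (integrable_id hz)) i0,
      integral_smul_measure] at e1
    rw [integral_add_measure (integrable_id (integralDomain_sub h.1 hz)) i0,
      integral_smul_measure] at e2
    have e3 := (mem_integralGraph.1 h).2 _ hz
    -- The two expansions differ by 4ρ, so the polarization formula tested with G(B)f returns ∫ s dρ
    -- = ∫_B s² dμ_x.
    have e4 : inner ℝ f (G.proj B f) = ∫ s, s ∂ρ := by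
      rw [e3, e1, ← e2]; norm_num; ring
    rw [G.scalarMeasure_apply _ hB, e4, ofReal_integral_eq_lintegral_ofReal i0', hρ,
      restrict_withDensity hB, lintegral_withDensity_eq_lintegral_mul _ (by fun_prop) (by fun_prop)]
    · refine lintegral_congr_ae ?_
      filter_upwards [ae_restrict_of_ae hpos'] with s hs
      simp only [Pi.mul_apply]
      rw [← ENNReal.ofReal_mul hs, sq]
    · rw [hρ, restrict_withDensity hB]
      exact withDensity_absolutelyContinuous _ _ (ae_restrict_of_ae hpos')
  have hU : (⋃ n : ℕ, Icc (-(n : ℝ)) n) = univ := by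
    refine eq_univ_of_forall fun s => mem_iUnion.2 ?_
    obtain ⟨n, hn⟩ := exists_nat_ge |s|
    exact ⟨n, abs_le.1 hn⟩
  refine (Measure.ext_iff_of_iUnion_eq_univ hU).2 fun n => ?_
  ext E hE
  rw [Measure.restrict_apply hE, Measure.restrict_apply hE,
    withDensity_apply _ (hE.inter measurableSet_Icc),
    key _ (hE.inter measurableSet_Icc) n inter_subset_right]

/-- Expanding the square, the products ⟨f, G(E)f⟩, ⟨f, G(E)x⟩ and ⟨x, G(E)x⟩ are the second, first
and zeroth moments of μ_x on E. This is the functional calculus that the sequel needs: resolvents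
are handled by inverting such a density. -/
theorem scalarMeasure_linear_combination {x f : H} (h : (x, f) ∈ G.integralGraph)
    (hpos : G.scalarMeasure x (Iio 0) = 0) (a b : ℝ) :
    G.scalarMeasure (a • f + b • x) =
      (G.scalarMeasure x).withDensity (fun s => ENNReal.ofReal ((a * s + b) ^ 2)) := by
  have i1 := integrable_id h.1
  have i2 := integrable_sq h.1
  ext E hE
  have h2 : inner ℝ f (G.proj E f) = ∫ s in E, s ^ 2 ∂G.scalarMeasure x := by
    have := G.scalarMeasure_apply f hE
    rw [scalarMeasure_of_mem_integralGraph h hpos, withDensity_apply _ hE,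
      ← ofReal_integral_eq_lintegral_ofReal i2.integrableOn
        (Eventually.of_forall fun s => sq_nonneg s)] at this
    exact ((ENNReal.ofReal_eq_ofReal_iff (integral_nonneg fun s => sq_nonneg s)
      (G.inner_proj_nonneg hE f)).1 this).symm
  have h0 : inner ℝ x (G.proj E x) = ∫ s in E, 1 ∂G.scalarMeasure x := by
    rw [setIntegral_const, smul_eq_mul, mul_one, measureReal_def, G.scalarMeasure_apply x hE,
      ENNReal.toReal_ofReal (G.inner_proj_nonneg hE x)]
  have h1 := inner_proj_eq_setIntegral h hE
  have h1' : inner ℝ x (G.proj E f) = ∫ s in E, s ∂G.scalarMeasure x := by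
    rw [← h1, ← G.inner_proj_symm hE, real_inner_comm]
  have i3 : Integrable (fun s : ℝ => (a * s + b) ^ 2) (G.scalarMeasure x) := by
    have : (fun s : ℝ => (a * s + b) ^ 2) = fun s => a ^ 2 * s ^ 2 + 2 * a * b * s + b ^ 2 := by
      ext s; ring
    rw [this]
    exact ((i2.const_mul _).add (i1.const_mul _)).add (integrable_const _)
  rw [withDensity_apply _ hE, G.scalarMeasure_apply _ hE,
    ← ofReal_integral_eq_lintegral_ofReal i3.integrableOn
        (Eventually.of_forall fun s => sq_nonneg _)]
  congr 1
  have : ∫ s in E, (a * s + b) ^ 2 ∂G.scalarMeasure x =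
      a ^ 2 * ∫ s in E, s ^ 2 ∂G.scalarMeasure x + 2 * a * b * ∫ s in E, s ∂G.scalarMeasure x
        + b ^ 2 * ∫ s in E, 1 ∂G.scalarMeasure x := by
    rw [← integral_const_mul, ← integral_const_mul, ← integral_const_mul, ← integral_add,
      ← integral_add]
    · congr 1; ext s; ring
    · exact ((i2.const_mul _).add (i1.const_mul _)).integrableOn
    · exact (integrable_const _).integrableOn
    · exact (i2.const_mul _).integrableOn
    · exact (i1.const_mul _).integrableOn
  rw [this, ← h2, ← h0]
  simp only [map_add, map_smul, inner_add_left, inner_add_right, inner_smul_left,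
    inner_smul_right, RCLike.conj_to_real]
  rw [h1, h1']
  ring

/-- With y = (L + t)x this is ⟨y, (L + t)⁻¹y⟩ = ∫ (s + t)⁻¹ dμ_y: the left side is ∫ (s + t) dμ_x,
and μ_y has density (s + t)² with respect to μ_x. -/
theorem inner_linear_combination {x f : H} (h : (x, f) ∈ G.integralGraph)
    (hpos : G.scalarMeasure x (Iio 0) = 0) {t : ℝ} (ht : 0 < t) :
    ENNReal.ofReal (inner ℝ (f + t • x) x) =
      ∫⁻ s, ENNReal.ofReal (s + t)⁻¹ ∂G.scalarMeasure (f + t • x) := by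
  have hpos' : ∀ᵐ s ∂G.scalarMeasure x, 0 ≤ s := by
    exact ae_nonneg_of_Iio hpos
  have e := scalarMeasure_linear_combination h hpos 1 t
  rw [one_smul] at e
  rw [e, lintegral_withDensity_eq_lintegral_mul _ (by fun_prop) (by fun_prop)]
  have h1 := inner_proj_eq_setIntegral h MeasurableSet.univ
  have h0 : inner ℝ x x = ∫ s, 1 ∂G.scalarMeasure x := by
    have h3 := G.scalarMeasure_apply x MeasurableSet.univ
    have h4 := G.inner_proj_nonneg MeasurableSet.univ x
    rw [G.proj_univ, one_apply_eq_self] at h3 h4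
    rw [integral_const, smul_eq_mul, mul_one, measureReal_def, h3, ENNReal.toReal_ofReal h4]
  rw [G.proj_univ, one_apply_eq_self, Measure.restrict_univ] at h1
  have i3 : Integrable (fun s : ℝ => s + t) (G.scalarMeasure x) :=
    (integrable_id h.1).add (integrable_const _)
  have h2 : inner ℝ (f + t • x) x = ∫ s, (s + t) ∂G.scalarMeasure x := by
    rw [integral_add (integrable_id h.1) (integrable_const _), inner_add_left, inner_smul_left, h1,
      h0]
    simp [mul_comm]
  rw [h2, ofReal_integral_eq_lintegral_ofReal i3]
  · refine lintegral_congr_ae ?_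
    filter_upwards [hpos'] with s hs
    have : 0 < s + t := by positivity
    simp only [Pi.mul_apply, one_mul]
    rw [← ENNReal.ofReal_mul (sq_nonneg _)]
    congr 1
    field_simp
  · filter_upwards [hpos'] with s hs
    simp only [Pi.zero_apply]
    positivity

end ResolutionOfIdentity

end StochHom

namespace StochHom

/-! ### Operators given by a closed coercive form, and spectral measures of their weak solutions. -/

section Form

variable {H K : Type*} [NormedAddCommGroup H] [InnerProductSpace ℝ H] [CompleteSpace H]
  [NormedAddCommGroup K] [InnerProductSpace ℝ K] [CompleteSpace K]

/-- The graph of the operator on `H` associated with the form `(u, v) ↦ ⟨D v, a D u⟩`, where `𝒢` is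
the graph of `D`. -/
def formGraph (𝒢 : Submodule ℝ (H × K)) (a : K →L[ℝ] K) : Set (H × H) :=
  {p | ∃ U, (p.1, U) ∈ 𝒢 ∧ ∀ ψ Ψ, (ψ, Ψ) ∈ 𝒢 → inner ℝ Ψ (a U) = inner ℝ ψ p.2}

variable {𝒢 : Submodule ℝ (H × K)} {a : K →L[ℝ] K} {α : ℝ}

/-- Lax–Milgram on the graph of D: it is closed, hence a Hilbert space, and the form is coercive
there with constant min δ α. -/
theorem exists_form_solution (hcl : IsClosed (𝒢 : Set (H × K))) (hα : 0 < α)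
    (hco : ∀ x, α * ‖x‖ ^ 2 ≤ inner ℝ x (a x)) {δ : ℝ} (hδ : 0 < δ) (h : H) (k : K) :
    ∃ u U, (u, U) ∈ 𝒢 ∧ ∀ ψ Ψ, (ψ, Ψ) ∈ 𝒢 →
      δ * inner ℝ ψ u + inner ℝ Ψ (a U) = inner ℝ ψ h + inner ℝ Ψ k := by
  -- H × K carries the sup norm; passing to the ℓ² product gives an inner product with the same
  -- topology.
  let e := WithLp.prodContinuousLinearEquiv 2 ℝ H K
  let 𝒢' : Submodule ℝ (WithLp 2 (H × K)) := 𝒢.comap e.toLinearEquiv.toLinearMap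
  have hcl' : IsClosed (𝒢' : Set (WithLp 2 (H × K))) := hcl.preimage e.continuous
  have : CompleteSpace 𝒢' := hcl'.completeSpace_coe
  let t : WithLp 2 (H × K) →L[ℝ] WithLp 2 (H × K) :=
    e.symm.toContinuousLinearMap.comp
      (((δ • ContinuousLinearMap.id ℝ H).prodMap a).comp e.toContinuousLinearMap)
  let b : WithLp 2 (H × K) →L[ℝ] WithLp 2 (H × K) →L[ℝ] ℝ :=
    (isBoundedBilinearMap_inner (𝕜 := ℝ)).toContinuousLinearMap
  let B : 𝒢' →L[ℝ] 𝒢' →L[ℝ] ℝ := b.bilinearComp (t.comp 𝒢'.subtypeL) 𝒢'.subtypeL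
  have hB : ∀ x y : 𝒢', B x y = δ * inner ℝ x.1.fst y.1.fst + inner ℝ (a x.1.snd) y.1.snd := by
    intro x y
    change inner ℝ (t x.1) y.1 = _
    rw [WithLp.prod_inner_apply]
    simp [t, e, inner_smul_left]
  have hBc : IsCoercive B := by
    refine ⟨min δ α, lt_min hδ hα, fun x => ?_⟩
    rw [hB, mul_assoc, ← sq]
    change _ * ‖x.1‖ ^ 2 ≤ _
    rw [WithLp.prod_norm_sq_eq_of_L2, real_inner_self_eq_norm_sq, real_inner_comm]
    have h1 := hco x.1.snd
    have h2 : min δ α * ‖x.1.fst‖ ^ 2 ≤ δ * ‖x.1.fst‖ ^ 2 := by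
      gcongr; exact min_le_left _ _
    have h3 : min δ α * ‖x.1.snd‖ ^ 2 ≤ α * ‖x.1.snd‖ ^ 2 := by
      gcongr; exact min_le_right _ _
    linarith
  let r : WithLp 2 (H × K) := e.symm (h, k)
  let ℓ : 𝒢' →L[ℝ] ℝ := (b r).comp 𝒢'.subtypeL
  let z := (InnerProductSpace.toDual ℝ 𝒢').symm ℓ
  let x := hBc.continuousLinearEquivOfBilin.symm z
  refine ⟨x.1.fst, x.1.snd, x.2, fun ψ Ψ hψ => ?_⟩
  let y : 𝒢' := ⟨e.symm (ψ, Ψ), by simpa [𝒢', e] using hψ⟩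
  have h1 := hBc.continuousLinearEquivOfBilin_apply x y
  rw [hB, ContinuousLinearEquiv.apply_symm_apply, InnerProductSpace.toDual_symm_apply] at h1
  have h2 : ℓ y = inner ℝ r y.1 := rfl
  rw [h2, WithLp.prod_inner_apply] at h1
  simp only [y, r, e, WithLp.prodContinuousLinearEquiv_symm_apply] at h1
  rw [real_inner_comm, real_inner_comm _ Ψ, real_inner_comm _ ψ, real_inner_comm _ Ψ]
  exact h1.symm

theorem form_solution_unique (hα : 0 < α)
    (hco : ∀ x, α * ‖x‖ ^ 2 ≤ inner ℝ x (a x)) {δ : ℝ} (hδ : 0 < δ) {ℓ : H → K → ℝ}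
    {u u' : H} {U U' : K} (hu : (u, U) ∈ 𝒢) (hu' : (u', U') ∈ 𝒢)
    (h : ∀ ψ Ψ, (ψ, Ψ) ∈ 𝒢 → δ * inner ℝ ψ u + inner ℝ Ψ (a U) = ℓ ψ Ψ)
    (h' : ∀ ψ Ψ, (ψ, Ψ) ∈ 𝒢 → δ * inner ℝ ψ u' + inner ℝ Ψ (a U') = ℓ ψ Ψ) :
    u = u' ∧ U = U' := by
  have hm := 𝒢.sub_mem hu hu'
  have h1 := h _ _ hm
  rw [← h' _ _ hm] at h1
  have h2 : δ * ‖u - u'‖ ^ 2 + inner ℝ (U - U') (a (U - U')) = 0 := by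
    rw [← real_inner_self_eq_norm_sq, map_sub, inner_sub_right, inner_sub_right (U - U')]
    linarith
  have h3 := hco (U - U')
  have h4 : ‖u - u'‖ ^ 2 = 0 := by
    have : 0 ≤ α * ‖U - U'‖ ^ 2 := by positivity
    nlinarith [sq_nonneg ‖u - u'‖]
  have h5 : ‖U - U'‖ ^ 2 = 0 := by
    have : 0 ≤ δ * ‖u - u'‖ ^ 2 := by positivity
    nlinarith [sq_nonneg ‖U - U'‖]
  exact ⟨sub_eq_zero.1 (by simpa using h4), sub_eq_zero.1 (by simpa using h5)⟩

variable {G : ResolutionOfIdentity H}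

open ResolutionOfIdentity

theorem inner_nonneg_of_coercive (hα : 0 < α) (hco : ∀ x, α * ‖x‖ ^ 2 ≤ inner ℝ x (a x)) (x : K) :
    0 ≤ inner ℝ x (a x) :=
  le_trans (by positivity) (hco x)

/-- Test the form with y = G((-∞,0))x. Positivity of the form gives ∫_{s<0} s dμ_x = ⟨y, Ly⟩ ≥ 0,
while the integrand is negative, so the mass there vanishes. -/
theorem scalarMeasure_Iio_of_mem (hG : formGraph 𝒢 a = G.integralGraph) (hα : 0 < α)
    (hco : ∀ x, α * ‖x‖ ^ 2 ≤ inner ℝ x (a x)) {x f : H} (h : (x, f) ∈ G.integralGraph) :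
    G.scalarMeasure x (Iio 0) = 0 := by
  have h1 := proj_mem_integralGraph h (B := Iio 0) measurableSet_Iio
  rw [← hG] at h1
  obtain ⟨U, hU, hU'⟩ := h1
  have h2 := hU' _ _ hU
  have h3 := inner_nonneg_of_coercive hα hco U
  rw [h2, G.inner_proj_symm measurableSet_Iio, G.proj_proj measurableSet_Iio measurableSet_Iio,
    inter_self, ← G.inner_proj_symm measurableSet_Iio, real_inner_comm,
    inner_proj_eq_setIntegral h measurableSet_Iio] at h3
  have hi : IntegrableOn (fun s : ℝ => -s) (Iio 0) (G.scalarMeasure x) :=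
    (integrable_id h.1).neg.integrableOn
  have hn : 0 ≤ᵐ[(G.scalarMeasure x).restrict (Iio 0)] fun s : ℝ => -s := by
    filter_upwards [ae_restrict_mem measurableSet_Iio] with s hs
    simp only [Pi.zero_apply, Left.nonneg_neg_iff]
    exact (mem_Iio.1 hs).le
  have h4 : ∫ s in Iio 0, -s ∂G.scalarMeasure x = 0 := by
    refine le_antisymm ?_ (integral_nonneg_of_ae hn)
    rw [integral_neg]; linarith
  have h5 := (integral_eq_zero_iff_of_nonneg_ae hn hi).1 h4
  rw [← Measure.restrict_eq_zero, ← ae_eq_bot, ← eventually_false_iff_eq_bot]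
  filter_upwards [h5, ae_restrict_mem measurableSet_Iio] with s hs hs'
  simp only [Pi.zero_apply, neg_eq_zero] at hs
  exact absurd hs' (by simp [hs])

/-- Every y has the form (L + δ)x, so properties proved on the domain of L can be transported to all
of H. -/
theorem exists_resolvent (hcl : IsClosed (𝒢 : Set (H × K))) (hα : 0 < α)
    (hco : ∀ x, α * ‖x‖ ^ 2 ≤ inner ℝ x (a x)) {δ : ℝ} (hδ : 0 < δ) (y : H) :
    ∃ x U, (x, U) ∈ 𝒢 ∧ (∀ ψ Ψ, (ψ, Ψ) ∈ 𝒢 →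
      δ * inner ℝ ψ x + inner ℝ Ψ (a U) = inner ℝ ψ y) ∧ (x, y - δ • x) ∈ formGraph 𝒢 a := by
  obtain ⟨x, U, hx, h⟩ := exists_form_solution hcl hα hco hδ y 0
  simp only [inner_zero_right, add_zero] at h
  refine ⟨x, U, hx, h, U, hx, fun ψ Ψ hψ => ?_⟩
  rw [inner_sub_right, inner_smul_right, ← h _ _ hψ]
  ring

/-- The spectral measure of a vector in the range of `D*` does not charge the kernel of `D`. -/
theorem scalarMeasure_singleton_zero (hcl : IsClosed (𝒢 : Set (H × K)))
    (hG : formGraph 𝒢 a = G.integralGraph) (hα : 0 < α)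
    (hco : ∀ x, α * ‖x‖ ^ 2 ≤ inner ℝ x (a x)) {w : H} {W k : K}
    (h : ∀ ψ Ψ, (ψ, Ψ) ∈ 𝒢 → inner ℝ ψ w + inner ℝ Ψ (a W) = inner ℝ Ψ k) :
    G.scalarMeasure w {0} = 0 := by
  obtain ⟨x, -, -, -, hx⟩ := exists_resolvent hcl hα hco one_pos w
  have h0 : MeasurableSet ({0} : Set ℝ) := measurableSet_singleton 0
  rw [hG, one_smul] at hx
  have h1 := proj_mem_integralGraph hx h0
  rw [← hG] at h1
  obtain ⟨U, hU, hU'⟩ := h1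
  -- Here w = (L + 1)x. Over the spectral set {0} the operator acts as multiplication by 0, so
  -- G({0})x has zero energy.
  have h2 : inner ℝ (w - x) (G.proj {0} x) = 0 := by
    rw [inner_proj_eq_setIntegral hx h0]
    refine (setIntegral_congr_fun h0 (g := fun _ => (0 : ℝ)) fun s hs => hs).trans (by simp)
  have h3 := hU' _ _ hU
  rw [G.inner_proj_symm h0, G.proj_proj h0 h0, inter_self, ← G.inner_proj_symm h0,
    real_inner_comm (w - x), h2] at h3
  have h4 : ‖U‖ ^ 2 = 0 := by nlinarith [hco U, sq_nonneg ‖U‖]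
  have h5 : U = 0 := by simpa using h4
  -- By coercivity the gradient U of G({0})x is zero, and the equation of w tested with this vector
  -- leaves ⟨G({0})x, w⟩ = 0.
  have h6 := h _ _ hU
  simp only [h5, inner_zero_left, add_zero] at h6
  have h7 : inner ℝ x (G.proj {0} x) = 0 := by
    rw [inner_sub_left, real_inner_comm, h6] at h2
    linarith
  have hp := scalarMeasure_Iio_of_mem hG hα hco hx
  have h8 := scalarMeasure_linear_combination hx hp 1 1
  rw [one_smul, one_smul, sub_add_cancel] at h8
  rw [h8]
  refine withDensity_absolutelyContinuous _ _ ?_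
  rw [G.scalarMeasure_apply _ h0, h7, ENNReal.ofReal_zero]

theorem scalarMeasure_Iio (hcl : IsClosed (𝒢 : Set (H × K)))
    (hG : formGraph 𝒢 a = G.integralGraph) (hα : 0 < α)
    (hco : ∀ x, α * ‖x‖ ^ 2 ≤ inner ℝ x (a x)) (w : H) : G.scalarMeasure w (Iio 0) = 0 := by
  obtain ⟨x, -, -, -, hx⟩ := exists_resolvent hcl hα hco one_pos w
  rw [hG, one_smul] at hx
  have hp := scalarMeasure_Iio_of_mem hG hα hco hx
  have h8 := scalarMeasure_linear_combination hx hp 1 1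
  rw [one_smul, one_smul, sub_add_cancel] at h8
  rw [h8]
  exact withDensity_absolutelyContinuous _ _ hp

/-- Since v = (1 + ML)v', the density of μ_v with respect to μ_{v'} is (1 + Ms)², which is positive
almost everywhere and can be inverted. -/
theorem scalarMeasure_of_resolvent_step
    (hG : formGraph 𝒢 a = G.integralGraph) (hα : 0 < α)
    (hco : ∀ x, α * ‖x‖ ^ 2 ≤ inner ℝ x (a x)) {v v' : H} {V' : K} {M : ℝ} (hM : 0 < M)
    (hv' : (v', V') ∈ 𝒢)
    (h : ∀ ψ Ψ, (ψ, Ψ) ∈ 𝒢 → inner ℝ ψ v' + M * inner ℝ Ψ (a V') = inner ℝ ψ v) :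
    G.scalarMeasure v' =
      (G.scalarMeasure v).withDensity fun s => ENNReal.ofReal (((1 + M * s)⁻¹) ^ 2) := by
  have hx : (v', M⁻¹ • (v - v')) ∈ G.integralGraph := by
    rw [← hG]
    refine ⟨V', hv', fun ψ Ψ hψ => ?_⟩
    rw [inner_smul_right, inner_sub_right, ← h _ _ hψ]
    field_simp
    ring
  have hp := scalarMeasure_Iio_of_mem hG hα hco hx
  have h8 := scalarMeasure_linear_combination hx hp M 1
  rw [one_smul, smul_smul, mul_inv_cancel₀ hM.ne', one_smul, sub_add_cancel] at h8
  rw [h8, ← withDensity_mul _ (by fun_prop) (by fun_prop)]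
  conv_lhs => rw [← withDensity_one (μ := G.scalarMeasure v')]
  refine withDensity_congr_ae ?_
  filter_upwards [ae_nonneg_of_Iio hp] with s hs
  have : 0 < 1 + M * s := by positivity
  simp only [Pi.one_apply, Pi.mul_apply]
  rw [← ENNReal.ofReal_mul (sq_nonneg _), ← ENNReal.ofReal_one]
  congr 1
  field_simp
  ring

/-- The functional Ψ ↦ ⟨Ψ, k⟩ is not a vector of H, so p is compared with w instead. Put x = (L +
T⁻¹)⁻¹w. The resolvent identity gives p = w + (1 - T⁻¹)x = (L + 1)x, so w and T⁻¹p are both affine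
in L applied to x, and the quotient of the two densities is the claimed one. -/
theorem scalarMeasure_of_drift_solution (hcl : IsClosed (𝒢 : Set (H × K)))
    (hG : formGraph 𝒢 a = G.integralGraph) (hα : 0 < α)
    (hco : ∀ x, α * ‖x‖ ^ 2 ≤ inner ℝ x (a x)) {k : K} {w p : H} {W P : K} {T : ℝ} (hT : 0 < T)
    (hw : (w, W) ∈ 𝒢) (hp : (p, P) ∈ 𝒢)
    (hw' : ∀ ψ Ψ, (ψ, Ψ) ∈ 𝒢 → inner ℝ ψ w + inner ℝ Ψ (a W) = inner ℝ Ψ k)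
    (hp' : ∀ ψ Ψ, (ψ, Ψ) ∈ 𝒢 → T⁻¹ * inner ℝ ψ p + inner ℝ Ψ (a P) = inner ℝ Ψ k) :
    G.scalarMeasure (T⁻¹ • p) = (G.scalarMeasure w).withDensity
      fun s => ENNReal.ofReal ((1 + s) ^ 2 * ((1 + T * s)⁻¹) ^ 2) := by
  have ht : 0 < T⁻¹ := inv_pos.2 hT
  obtain ⟨x, X, hX, hx', hx⟩ := exists_resolvent hcl hα hco ht w
  have e : p = w + (1 - T⁻¹) • x := by
    refine (form_solution_unique (U := P) (U' := W + (1 - T⁻¹) • X) hα hco ht hp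
      (𝒢.add_mem hw (𝒢.smul_mem (1 - T⁻¹) hX)) hp' fun ψ Ψ hψ => ?_).1
    have h1 := hw' _ _ hψ
    have h2 := hx' _ _ hψ
    rw [map_add, map_smul, inner_add_right (x := Ψ), inner_smul_right (x := Ψ), Prod.smul_mk,
      inner_add_right, inner_smul_right]
    linear_combination h1 + (1 - T⁻¹) * h2
  rw [hG] at hx
  have hpos := scalarMeasure_Iio_of_mem hG hα hco hx
  have h1 := scalarMeasure_linear_combination hx hpos T⁻¹ T⁻¹
  have h2 := scalarMeasure_linear_combination hx hpos 1 T⁻¹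
  have e1 : T⁻¹ • (w - T⁻¹ • x) + T⁻¹ • x = T⁻¹ • p := by rw [e]; module
  have e2 : (1 : ℝ) • (w - T⁻¹ • x) + T⁻¹ • x = w := by module
  rw [e1] at h1
  rw [e2] at h2
  rw [h1, h2, ← withDensity_mul _ (by fun_prop) (by fun_prop)]
  refine withDensity_congr_ae ?_
  filter_upwards [ae_nonneg_of_Iio hpos] with s hs
  have : 0 < 1 + T * s := by positivity
  simp only [Pi.mul_apply]
  rw [← ENNReal.ofReal_mul (sq_nonneg _)]
  congr 1
  field_simp
  ring

/-- The energy of the "potential" part with divergence `v` is `∫ s⁻¹ d⟨v, G(s) v⟩`. -/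
theorem energy_eq_lintegral (hcl : IsClosed (𝒢 : Set (H × K)))
    (hG : formGraph 𝒢 a = G.integralGraph) (hα : 0 < α)
    (hco : ∀ x, α * ‖x‖ ^ 2 ≤ inner ℝ x (a x))
    (hsymm : ∀ x y, inner ℝ x (a y) = inner ℝ y (a x)) {v : H} {e : K}
    (he : e ∈ closure {Ψ | ∃ ψ, (ψ, Ψ) ∈ 𝒢})
    (h : ∀ ψ Ψ, (ψ, Ψ) ∈ 𝒢 → inner ℝ Ψ (a e) = inner ℝ ψ v) :
    ENNReal.ofReal (inner ℝ e (a e)) = ∫⁻ s, (ENNReal.ofReal s)⁻¹ ∂G.scalarMeasure v := by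
  -- The field e is only a limit of gradients, so there is no potential to insert into the spectral
  -- calculus. It is approximated by U n, the gradient of u n = (L + δ n)⁻¹v, with δ n ↓ 0.
  set δ : ℕ → ℝ := fun n => 1 / ((n : ℝ) + 1) with hδ
  have hδpos : ∀ n, 0 < δ n := fun n => by simp only [hδ]; positivity
  have hδlim : Tendsto δ atTop (𝓝 0) := tendsto_one_div_add_atTop_nhds_zero_nat
  have hδanti : Antitone δ := fun m n hmn => by
    simp only [hδ]
    exact one_div_le_one_div_of_le (by positivity) (by gcongr)
  choose u U hU hu hx using fun n => exists_resolvent (a := a) hcl hα hco (hδpos n) v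
  set c := inner ℝ e (a e) with hc
  have hnn := inner_nonneg_of_coercive hα hco
  have hUe : ∀ n, inner ℝ (U n) (a e) = inner ℝ (u n) v := fun n => h _ _ (hU n)
  have hself : ∀ n, δ n * ‖u n‖ ^ 2 + inner ℝ (U n) (a (U n)) = inner ℝ (u n) v := fun n => by
    rw [← real_inner_self_eq_norm_sq]; exact hu n _ _ (hU n)
  have hexp : ∀ x y, inner ℝ (x - y) (a (x - y)) =
      inner ℝ x (a x) - 2 * inner ℝ y (a x) + inner ℝ y (a y) := fun x y => by
    rw [map_sub, inner_sub_left, inner_sub_right, inner_sub_right, hsymm x y]; ring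
  -- Expand ⟨e - U, a(e - U)⟩ ≥ 0 and insert ⟨U, aU⟩ = ⟨u, v⟩ - δ‖u‖².
  have hup : ∀ n, inner ℝ (u n) v + δ n * ‖u n‖ ^ 2 ≤ c := fun n => by
    have h1 := hnn (e - U n)
    rw [hexp, hUe] at h1
    linarith [hself n]
  have hvu_nonneg : ∀ n, 0 ≤ inner ℝ (u n) v := fun n => by
    rw [← hself n]
    have := hnn (U n)
    have := (hδpos n).le
    positivity
  -- The bound δ‖u‖² ≤ c gives δ‖u‖ ≤ √(δc), so the zeroth-order term disappears in the limit.
  have hsmall : ∀ ψ : H, Tendsto (fun n => δ n * inner ℝ ψ (u n)) atTop (𝓝 0) := by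
    intro ψ
    have hb : Tendsto (fun n => ‖ψ‖ * √(δ n * c)) atTop (𝓝 0) := by
      have : Tendsto (fun n => ‖ψ‖ * √(δ n * c)) atTop (𝓝 (‖ψ‖ * √(0 * c))) :=
        ((hδlim.mul_const c).sqrt).const_mul _
      simpa using this
    refine squeeze_zero_norm (fun n => ?_) hb
    have h1 : δ n * ‖u n‖ ≤ √(δ n * c) := by
      refine Real.le_sqrt_of_sq_le ?_
      have h2 : δ n * ‖u n‖ ^ 2 ≤ c := by linarith [hup n, hvu_nonneg n]
      have := mul_le_mul_of_nonneg_left h2 (hδpos n).le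
      linarith
    rw [norm_mul, Real.norm_of_nonneg (hδpos n).le]
    calc δ n * ‖inner ℝ ψ (u n)‖ ≤ δ n * (‖ψ‖ * ‖u n‖) := by
          have := (hδpos n).le
          gcongr
          exact norm_inner_le_norm _ _
      _ = ‖ψ‖ * (δ n * ‖u n‖) := by ring
      _ ≤ _ := by gcongr
  have hlim : Tendsto (fun n => inner ℝ (u n) v) atTop (𝓝 c) := by
    refine tendsto_order.2 ⟨fun b hb => ?_, fun b hb => Eventually.of_forall fun n => ?_⟩
    -- For the lower bound, Ψ ↦ 2⟨Ψ, ae⟩ - ⟨Ψ, aΨ⟩ is continuous and equals c at e, so some genuine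
    -- gradient Ψ gives a value above b. Comparing U n with this Ψ through ⟨U n - Ψ, a(U n - Ψ)⟩ ≥ 0
    -- bounds ⟨u n, v⟩ below by that value up to a term that tends to 0.
    · have hcont : Continuous fun Ψ : K => 2 * inner ℝ Ψ (a e) - inner ℝ Ψ (a Ψ) := by fun_prop
      have hopen : IsOpen {Ψ : K | b < 2 * inner ℝ Ψ (a e) - inner ℝ Ψ (a Ψ)} :=
        isOpen_lt continuous_const hcont
      obtain ⟨Ψ, hΨ, ψ, hψ⟩ := mem_closure_iff.1 he _ hopen (by
        simp only [mem_ofPred_eq, ← hc]; linarith)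
      simp only [mem_ofPred_eq] at hΨ
      have h1 : Tendsto (fun n => 2 * inner ℝ Ψ (a e) - inner ℝ Ψ (a Ψ)
          - 2 * (δ n * inner ℝ ψ (u n))) atTop
          (𝓝 (2 * inner ℝ Ψ (a e) - inner ℝ Ψ (a Ψ) - 2 * 0)) :=
        ((hsmall ψ).const_mul 2).const_sub _
      rw [mul_zero, sub_zero] at h1
      filter_upwards [(tendsto_order.1 h1).1 b hΨ] with n hn
      have h2 := hnn (U n - Ψ)
      rw [hexp] at h2
      have h3 := hu n _ _ hψ
      have h4 := h _ _ hψ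
      have h5 := hself n
      have : 0 ≤ δ n * ‖u n‖ ^ 2 := mul_nonneg (hδpos n).le (sq_nonneg _)
      linarith
    · have : 0 ≤ δ n * ‖u n‖ ^ 2 := mul_nonneg (hδpos n).le (sq_nonneg _)
      linarith [hup n]
  have hform : ∀ n, ENNReal.ofReal (inner ℝ (u n) v) =
      ∫⁻ s, ENNReal.ofReal (s + δ n)⁻¹ ∂G.scalarMeasure v := fun n => by
    have h1 := hx n
    rw [hG] at h1
    have h2 := inner_linear_combination h1 (scalarMeasure_Iio_of_mem hG hα hco h1) (hδpos n)
    rwa [sub_add_cancel, real_inner_comm] at h2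
  have hv := ae_nonneg_of_Iio (scalarMeasure_Iio hcl hG hα hco v)
  -- Monotone convergence in `[0, ∞]`: (s + δ n)⁻¹ increases to s⁻¹, with the value ∞ at s = 0.
  have hMCT : Tendsto (fun n => ∫⁻ s, ENNReal.ofReal (s + δ n)⁻¹ ∂G.scalarMeasure v) atTop
      (𝓝 (∫⁻ s, (ENNReal.ofReal s)⁻¹ ∂G.scalarMeasure v)) := by
    refine lintegral_tendsto_of_tendsto_of_monotone (fun n => by fun_prop) ?_ ?_
    · filter_upwards [hv] with s hs m n hmn
      refine ENNReal.ofReal_le_ofReal ?_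
      have := hδpos n
      exact inv_anti₀ (by positivity) (by linarith [hδanti hmn])
    · filter_upwards [hv] with s hs
      have h1 : ∀ n, ENNReal.ofReal (s + δ n)⁻¹ = (ENNReal.ofReal (s + δ n))⁻¹ := fun n =>
        ENNReal.ofReal_inv_of_pos (by have := hδpos n; positivity)
      simp only [h1]
      have h2 : Tendsto (fun n => s + δ n) atTop (𝓝 (s + 0)) := hδlim.const_add s
      rw [add_zero] at h2
      exact (ENNReal.continuous_ofReal.tendsto s |>.comp h2).inv
  refine tendsto_nhds_unique (ENNReal.continuous_ofReal.tendsto c |>.comp hlim) ?_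
  refine hMCT.congr fun n => ?_
  rw [Function.comp_apply, hform]

end Form

end StochHom

namespace StochHom

/-! ### Algebra of Richardson extrapolation. -/

section Richardson

variable {V : Type*} [AddCommGroup V] [Module ℝ V]

theorem richardson_one (f : ℝ → V) (T : ℝ) : richardson f 1 T = f T := rfl

theorem richardson_succ_succ (f : ℝ → V) (k : ℕ) (T : ℝ) :
    richardson f (k + 2) T = ((2 : ℝ) ^ (k + 1) - 1)⁻¹ •
      ((2 : ℝ) ^ (k + 1) • richardson f (k + 1) (2 * T) - richardson f (k + 1) T) := rfl

theorem two_pow_succ_sub_one_pos (k : ℕ) : (0 : ℝ) < 2 ^ (k + 1) - 1 :=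
  sub_pos.2 (one_lt_pow₀ one_lt_two (by omega))

/-- The predicate is quantified over all T > 0 because one extrapolation step evaluates the previous
level at both T and 2T. The index is shifted by one since extrapolation starts at level 1. -/
theorem richardson_induction {p : ℕ → ℝ → Prop} (h1 : ∀ T, 0 < T → p 0 T)
    (hs : ∀ k, (∀ T, 0 < T → p k T) → ∀ T, 0 < T → p (k + 1) T) (k : ℕ) {T : ℝ} (hT : 0 < T) :
    p k T := by
  induction k generalizing T with
  | zero => exact h1 T hT
  | succ k ih => exact hs k (fun T hT => ih hT) T hT

theorem map_richardson {W : Type*} [AddCommGroup W] [Module ℝ W] (L : V →ₗ[ℝ] W) (f : ℝ → V)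
    (k : ℕ) (T : ℝ) : L (richardson f (k + 1) T) = richardson (fun S => L (f S)) (k + 1) T := by
  induction k generalizing T with
  | zero => rfl
  | succ k ih => simp only [richardson_succ_succ, map_smul, map_sub, ih]

theorem richardson_congr {f g : ℝ → V} (h : ∀ T, 0 < T → f T = g T) (k : ℕ) {T : ℝ} (hT : 0 < T) :
    richardson f (k + 1) T = richardson g (k + 1) T := by
  refine richardson_induction (p := fun k T => richardson f (k + 1) T = richardson g (k + 1) T)
    (fun T hT => h T hT) (fun k ih T hT => ?_) k hT
  simp only [richardson_succ_succ, ih T hT, ih (2 * T) (by positivity)]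

theorem richardson_sum {ι : Type*} (s : Finset ι) (c : ι → ℝ) (f : ι → ℝ → V) (k : ℕ) (T : ℝ) :
    richardson (fun S => ∑ i ∈ s, c i • f i S) (k + 1) T =
      ∑ i ∈ s, c i • richardson (f i) (k + 1) T := by
  induction k generalizing T with
  | zero => rfl
  | succ k ih =>
    simp only [richardson_succ_succ, ih]
    rw [Finset.smul_sum, ← Finset.sum_sub_distrib, Finset.smul_sum]
    exact Finset.sum_congr rfl fun i _ => by module

theorem richardson_mem (𝒱 : Submodule ℝ V) {f : ℝ → V} (h : ∀ T, 0 < T → f T ∈ 𝒱) (k : ℕ) {T : ℝ}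
    (hT : 0 < T) : richardson f (k + 1) T ∈ 𝒱 := by
  refine richardson_induction (p := fun k T => richardson f (k + 1) T ∈ 𝒱)
    (fun T hT => h T hT) (fun k ih T hT => ?_) k hT
  exact 𝒱.smul_mem _ (𝒱.sub_mem (𝒱.smul_mem _ (ih (2 * T) (by positivity))) (ih T hT))

end Richardson

/-! ### Spectral symbol of the extrapolation error. -/

section Extrapolation

variable {H K : Type*} [NormedAddCommGroup H] [InnerProductSpace ℝ H] [CompleteSpace H]
  [NormedAddCommGroup K] [InnerProductSpace ℝ K] [CompleteSpace K]
  {𝒢 : Submodule ℝ (H × K)} {a : K →L[ℝ] K} {α : ℝ} {G : ResolutionOfIdentity H}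

theorem richardson_pair_mem {p : ℝ → H} {P : ℝ → K} (hp : ∀ T, 0 < T → (p T, P T) ∈ 𝒢) (k : ℕ)
    {T : ℝ} (hT : 0 < T) : (richardson p (k + 1) T, richardson P (k + 1) T) ∈ 𝒢 := by
  have h := richardson_mem 𝒢 (f := fun T => (p T, P T)) hp k hT
  have e1 := map_richardson (LinearMap.fst ℝ H K) (fun T => (p T, P T)) k T
  have e2 := map_richardson (LinearMap.snd ℝ H K) (fun T => (p T, P T)) k T
  simp only [LinearMap.fst_apply, LinearMap.snd_apply] at e1 e2
  rw [← e1, ← e2]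
  exact h

/-- For a single T, subtracting the equations of F and P T leaves T⁻¹ p T on the right. The
extrapolation weights 2^k/(2^k - 1) and -1/(2^k - 1) sum to one, so F is reproduced and the right
side is extrapolated in the same way. -/
theorem richardson_error {p : ℝ → H} {P : ℝ → K} {k F : K}
    (hF : ∀ ψ Ψ, (ψ, Ψ) ∈ 𝒢 → inner ℝ Ψ (a F) = inner ℝ Ψ k)
    (hp : ∀ T, 0 < T → ∀ ψ Ψ, (ψ, Ψ) ∈ 𝒢 →
      T⁻¹ * inner ℝ ψ (p T) + inner ℝ Ψ (a (P T)) = inner ℝ Ψ k) (n : ℕ) {T : ℝ} (hT : 0 < T)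
    (ψ : H) (Ψ : K) (hψ : (ψ, Ψ) ∈ 𝒢) :
    inner ℝ Ψ (a (F - richardson P (n + 1) T)) =
      inner ℝ ψ (richardson (fun S => S⁻¹ • p S) (n + 1) T) := by
  refine richardson_induction (p := fun n T => inner ℝ Ψ (a (F - richardson P (n + 1) T)) =
      inner ℝ ψ (richardson (fun S => S⁻¹ • p S) (n + 1) T)) (fun T hT => ?_) (fun n ih T hT => ?_)
      n hT
  · rw [richardson_one, richardson_one, map_sub, inner_sub_right, inner_smul_right, hF _ _ hψ,
      ← hp T hT _ _ hψ]
    ring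
  · have h1 := ih T hT
    have h2 := ih (2 * T) (by positivity)
    have h3 := two_pow_succ_sub_one_pos n
    simp only [richardson_succ_succ, map_sub, map_smul, inner_sub_right, inner_smul_right]
      at h1 h2 ⊢
    rw [← h1, ← h2]
    field_simp
    ring

/-- In operator form, v_{T,n+2} = (1 + 2^(n+1) T L)⁻¹ v_{T,n+1} for v_T = T⁻¹p_T. At the first level
the equations at T and 2T share their right side; at higher levels the recursion at T and at 2T
combine linearly. -/
theorem richardson_recursion {p : ℝ → H} {P : ℝ → K} {k : K}
    (hp : ∀ T, 0 < T → ∀ ψ Ψ, (ψ, Ψ) ∈ 𝒢 →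
      T⁻¹ * inner ℝ ψ (p T) + inner ℝ Ψ (a (P T)) = inner ℝ Ψ k) (n : ℕ) {T : ℝ} (hT : 0 < T)
    (ψ : H) (Ψ : K) (hψ : (ψ, Ψ) ∈ 𝒢) :
    inner ℝ ψ (richardson (fun S => S⁻¹ • p S) (n + 2) T) +
        2 ^ (n + 1) * T * inner ℝ Ψ (a (richardson (fun S => S⁻¹ • P S) (n + 2) T)) =
      inner ℝ ψ (richardson (fun S => S⁻¹ • p S) (n + 1) T) := by
  refine richardson_induction (p := fun n T =>
    inner ℝ ψ (richardson (fun S => S⁻¹ • p S) (n + 2) T) +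
        2 ^ (n + 1) * T * inner ℝ Ψ (a (richardson (fun S => S⁻¹ • P S) (n + 2) T)) =
      inner ℝ ψ (richardson (fun S => S⁻¹ • p S) (n + 1) T)) (fun T hT => ?_) (fun n ih T hT => ?_)
      n hT
  · have h1 := hp T hT _ _ hψ
    have h2 := hp (2 * T) (by positivity) _ _ hψ
    simp only [zero_add, richardson_succ_succ, richardson_one, map_sub, map_smul, inner_sub_right,
      inner_smul_right]
    rw [← h2] at h1
    norm_num
    field_simp at h1 ⊢
    linarith
  · have h1 := ih T hT
    have h2 := ih (2 * T) (by positivity)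
    have h3 := two_pow_succ_sub_one_pos (n + 1)
    have h4 := two_pow_succ_sub_one_pos n
    rw [richardson_succ_succ _ (n + 1), richardson_succ_succ _ (n + 1)]
    simp only [map_sub, map_smul, inner_sub_right, inner_smul_right]
    -- This is the definition of level n + 2 with its denominator cleared; it trades the level n + 1
    -- terms coming from T and 2T for the level n + 2 term at T.
    have h5 : inner ℝ ψ (richardson (fun S => S⁻¹ • p S) (n + 2) T) * (2 ^ (n + 1) - 1) =
        2 ^ (n + 1) * inner ℝ ψ (richardson (fun S => S⁻¹ • p S) (n + 1) (2 * T)) -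
          inner ℝ ψ (richardson (fun S => S⁻¹ • p S) (n + 1) T) := by
      rw [richardson_succ_succ]
      simp only [inner_sub_right, inner_smul_right]
      field_simp
    rw [show n + 1 + 1 = n + 2 from rfl] at *
    generalize inner ℝ ψ (richardson (fun S => S⁻¹ • p S) (n + 2) T) = x1 at *
    generalize inner ℝ ψ (richardson (fun S => S⁻¹ • p S) (n + 2) (2 * T)) = x2 at *
    generalize inner ℝ ψ (richardson (fun S => S⁻¹ • p S) (n + 1) T) = y1 at *
    generalize inner ℝ ψ (richardson (fun S => S⁻¹ • p S) (n + 1) (2 * T)) = y2 at *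
    generalize inner ℝ Ψ (a (richardson (fun S => S⁻¹ • P S) (n + 2) T)) = X1 at *
    generalize inner ℝ Ψ (a (richardson (fun S => S⁻¹ • P S) (n + 2) (2 * T))) = X2 at *
    rw [pow_succ 2 (n + 1)] at *
    field_simp
    linear_combination (2 * 2 ^ (n + 1)) * h2 - 2 * h1 - 2 * h5

/-- The base case compares T⁻¹p_T with w, and each further extrapolation contributes one resolvent
factor through `richardson_recursion`. -/
theorem scalarMeasure_richardson (hcl : IsClosed (𝒢 : Set (H × K)))
    (hG : formGraph 𝒢 a = G.integralGraph) (hα : 0 < α)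
    (hco : ∀ x, α * ‖x‖ ^ 2 ≤ inner ℝ x (a x)) {p : ℝ → H} {P : ℝ → K} {k W : K} {w : H}
    (hw : (w, W) ∈ 𝒢)
    (hw' : ∀ ψ Ψ, (ψ, Ψ) ∈ 𝒢 → inner ℝ ψ w + inner ℝ Ψ (a W) = inner ℝ Ψ k)
    (hpm : ∀ T, 0 < T → (p T, P T) ∈ 𝒢)
    (hp : ∀ T, 0 < T → ∀ ψ Ψ, (ψ, Ψ) ∈ 𝒢 →
      T⁻¹ * inner ℝ ψ (p T) + inner ℝ Ψ (a (P T)) = inner ℝ Ψ k) (n : ℕ) {T : ℝ} (hT : 0 < T) :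
    G.scalarMeasure (richardson (fun S => S⁻¹ • p S) (n + 1) T) =
      (G.scalarMeasure w).withDensity fun s => ENNReal.ofReal
        ((1 + s) ^ 2 * ∏ j ∈ Finset.range (n + 1), ((1 + 2 ^ j * T * s)⁻¹) ^ 2) := by
  induction n with
  | zero =>
    rw [zero_add, richardson_one,
      scalarMeasure_of_drift_solution hcl hG hα hco hT hw (hpm T hT) hw' (hp T hT)]
    simp
  | succ n ih =>
    rw [scalarMeasure_of_resolvent_step hG hα hco (M := 2 ^ (n + 1) * T) (by positivity)
      (richardson_pair_mem (fun S hS => 𝒢.smul_mem S⁻¹ (hpm S hS)) (n + 1) hT)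
      (richardson_recursion hp n hT), ih, ← withDensity_mul _ (by fun_prop) (by fun_prop)]
    refine congrArg _ (funext fun s => ?_)
    rw [Pi.mul_apply, ← ENNReal.ofReal_mul (by positivity), Finset.prod_range_succ _ (n + 1),
      mul_assoc]

/-- A lower bound for the ratio of the extrapolated symbol to the symbol of the drift integral. -/
noncomputable def extrapolationConstant (k : ℕ) : ℝ := ((2 : ℝ) ^ (k * (2 * k)))⁻¹

theorem extrapolationConstant_pos (k : ℕ) : 0 < extrapolationConstant k := by
  unfold extrapolationConstant; positivity

/-- For j < k one has 1 + x ≤ 1 + 2^j x ≤ 2^k (1 + x). The k squared factors turn the loss 2^k into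
2^(2k²). -/
theorem extrapolated_symbol_bounds (k : ℕ) {x : ℝ} (hx : 0 ≤ x) :
    extrapolationConstant k * ((1 + x)⁻¹) ^ (2 * k) ≤
        ∏ j ∈ Finset.range k, ((1 + 2 ^ j * x)⁻¹) ^ 2 ∧
      ∏ j ∈ Finset.range k, ((1 + 2 ^ j * x)⁻¹) ^ 2 ≤ ((1 + x)⁻¹) ^ (2 * k) := by
  have hc : ∀ c : ℝ, ∏ _j ∈ Finset.range k, c ^ 2 = c ^ (2 * k) := fun c => by
    rw [Finset.prod_const, Finset.card_range, ← pow_mul]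
  constructor
  · have : extrapolationConstant k * ((1 + x)⁻¹) ^ (2 * k) =
        ∏ _j ∈ Finset.range k, ((2 ^ k * (1 + x))⁻¹) ^ 2 := by
      rw [hc, mul_inv, mul_pow, extrapolationConstant, inv_pow (2 ^ k), ← pow_mul]
    rw [this]
    refine Finset.prod_le_prod (fun _ _ => by positivity) fun j hj => ?_
    have h1 : (2 : ℝ) ^ j ≤ 2 ^ k :=
      pow_le_pow_right₀ one_le_two (Finset.mem_range.1 hj).le
    have h2 : (1 : ℝ) ≤ 2 ^ k := one_le_pow₀ one_le_two
    gcongr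
    nlinarith
  · rw [← hc]
    refine Finset.prod_le_prod (fun _ _ => by positivity) fun j _ => ?_
    have h2 : (1 : ℝ) ≤ 2 ^ j := one_le_pow₀ one_le_two
    gcongr
    nlinarith

/-- Two-sided spectral bound for the energy of the error of the extrapolated solutions. -/
theorem extrapolation_energy_bounds (hcl : IsClosed (𝒢 : Set (H × K)))
    (hG : formGraph 𝒢 a = G.integralGraph) (hα : 0 < α)
    (hco : ∀ x, α * ‖x‖ ^ 2 ≤ inner ℝ x (a x))
    (hsymm : ∀ x y, inner ℝ x (a y) = inner ℝ y (a x))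
    {p : ℝ → H} {P : ℝ → K} {b W F : K} {w : H}
    (hw : (w, W) ∈ 𝒢)
    (hw' : ∀ ψ Ψ, (ψ, Ψ) ∈ 𝒢 → inner ℝ ψ w + inner ℝ Ψ (a W) = inner ℝ Ψ b)
    (hpm : ∀ T, 0 < T → (p T, P T) ∈ 𝒢)
    (hp : ∀ T, 0 < T → ∀ ψ Ψ, (ψ, Ψ) ∈ 𝒢 →
      T⁻¹ * inner ℝ ψ (p T) + inner ℝ Ψ (a (P T)) = inner ℝ Ψ b)
    (hFm : F ∈ closure {Ψ | ∃ ψ, (ψ, Ψ) ∈ 𝒢})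
    (hF : ∀ ψ Ψ, (ψ, Ψ) ∈ 𝒢 → inner ℝ Ψ (a F) = inner ℝ Ψ b)
    {k : ℕ} (hk : 1 ≤ k) {T : ℝ} (hT : 0 < T) :
    let I := ∫⁻ s in Ici (0 : ℝ),
      ENNReal.ofReal (T⁻¹ ^ (2 * k)) / ENNReal.ofReal (s * (T⁻¹ + s) ^ (2 * k))
        ∂(G.scalarMeasure w).withDensity fun s => ENNReal.ofReal ((1 + s) ^ 2)
    let E := ENNReal.ofReal (inner ℝ (F - richardson P k T) (a (F - richardson P k T)))
    ENNReal.ofReal (extrapolationConstant k) * I ≤ E ∧ E ≤ I := by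
  obtain ⟨n, rfl⟩ : ∃ n, k = n + 1 := ⟨k - 1, by omega⟩
  intro I E
  have hem : F - richardson P (n + 1) T ∈ closure {Ψ | ∃ ψ, (ψ, Ψ) ∈ 𝒢} := by
    have hr : ({Ψ | ∃ ψ, (ψ, Ψ) ∈ 𝒢} : Set K) = (𝒢.map (LinearMap.snd ℝ H K) : Set K) := by
      ext Ψ; simp
    rw [hr, ← Submodule.topologicalClosure_coe] at hFm ⊢
    refine Submodule.sub_mem _ hFm (Submodule.le_topologicalClosure _ ?_)
    exact ⟨_, richardson_pair_mem hpm n hT, rfl⟩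
  have hE : E = ∫⁻ s, (ENNReal.ofReal s)⁻¹
      ∂G.scalarMeasure (richardson (fun S => S⁻¹ • p S) (n + 1) T) :=
    energy_eq_lintegral hcl hG hα hco hsymm hem (richardson_error hF hp n hT)
  rw [scalarMeasure_richardson hcl hG hα hco hw hw' hpm hp n hT,
    lintegral_withDensity_eq_lintegral_mul _ (by fun_prop) (by fun_prop)] at hE
  -- There is no mass on s ≤ 0: the spectrum is nonnegative and the drift does not charge the
  -- kernel. This removes the infinite value of the integrands at s = 0 and the restriction to the
  -- half-line.
  have hpos : ∀ᵐ s ∂G.scalarMeasure w, 0 < s := by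
    have h0 : ∀ᵐ s ∂G.scalarMeasure w, s ≠ 0 := by
      rw [ae_iff]
      simpa using scalarMeasure_singleton_zero hcl hG hα hco hw'
    filter_upwards [ResolutionOfIdentity.ae_nonneg_of_Iio (scalarMeasure_Iio hcl hG hα hco w), h0] with s hs hs'
    exact lt_of_le_of_ne hs (Ne.symm hs')
  have hI : I = ∫⁻ s, ENNReal.ofReal ((1 + s) ^ 2) *
      (ENNReal.ofReal (T⁻¹ ^ (2 * (n + 1))) / ENNReal.ofReal (s * (T⁻¹ + s) ^ (2 * (n + 1))))
        ∂G.scalarMeasure w := by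
    have : (G.scalarMeasure w).restrict (Ici 0) = G.scalarMeasure w := by
      rw [Measure.restrict_eq_self_of_ae_mem]
      filter_upwards [hpos] with s hs using hs.le
    simp only [I]
    rw [restrict_withDensity measurableSet_Ici, this,
      lintegral_withDensity_eq_lintegral_mul _ (by fun_prop) (by fun_prop)]
    rfl
  -- Uses T⁻¹/(T⁻¹ + s) = (1 + Ts)⁻¹ to write the symbol of the drift integral in the variable x =
  -- Ts.
  have hsym : ∀ s : ℝ, 0 < s → ENNReal.ofReal ((1 + s) ^ 2) *
      (ENNReal.ofReal (T⁻¹ ^ (2 * (n + 1))) / ENNReal.ofReal (s * (T⁻¹ + s) ^ (2 * (n + 1)))) =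
      ENNReal.ofReal ((1 + s) ^ 2 * (((1 + T * s)⁻¹) ^ (2 * (n + 1)) * s⁻¹)) := fun s hs => by
    rw [← ENNReal.ofReal_div_of_pos (by positivity), ← ENNReal.ofReal_mul (by positivity)]
    congr 2
    have : 1 + T * s = T * (T⁻¹ + s) := by field_simp
    rw [this, mul_inv, mul_pow, div_eq_mul_inv, mul_inv, inv_pow (T⁻¹ + s)]
    ring
  have hsym' : ∀ s : ℝ, 0 < s → ENNReal.ofReal ((1 + s) ^ 2 *
      ∏ j ∈ Finset.range (n + 1), ((1 + 2 ^ j * T * s)⁻¹) ^ 2) * (ENNReal.ofReal s)⁻¹ =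
      ENNReal.ofReal ((1 + s) ^ 2 *
        ((∏ j ∈ Finset.range (n + 1), ((1 + 2 ^ j * (T * s))⁻¹) ^ 2) * s⁻¹)) := fun s hs => by
    rw [← ENNReal.ofReal_inv_of_pos hs, ← ENNReal.ofReal_mul (by positivity)]
    simp only [mul_assoc]
  have hb : ∀ s : ℝ, 0 < s → _ := fun s hs =>
    extrapolated_symbol_bounds (n + 1) (x := T * s) (by positivity)
  rw [hE, hI]
  constructor
  · rw [← lintegral_const_mul _ (by fun_prop)]
    refine lintegral_mono_ae ?_
    filter_upwards [hpos] with s hs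
    rw [Pi.mul_apply, hsym s hs, hsym' s hs,
      ← ENNReal.ofReal_mul (extrapolationConstant_pos _).le]
    refine ENNReal.ofReal_le_ofReal ?_
    have h1 := (hb s hs).1
    calc _ = (1 + s) ^ 2 * ((extrapolationConstant (n + 1) *
          ((1 + T * s)⁻¹) ^ (2 * (n + 1))) * s⁻¹) := by ring
      _ ≤ _ := by gcongr
  · refine lintegral_mono_ae ?_
    filter_upwards [hpos] with s hs
    rw [Pi.mul_apply, hsym s hs, hsym' s hs]
    refine ENNReal.ofReal_le_ofReal ?_
    have h1 := (hb s hs).2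
    gcongr

end Extrapolation

end StochHom

namespace StochHom

/-! ### The translation group on L²(Ω) and its strong continuity. -/

section Translation

variable {d : ℕ} {Ω : Type u} [MeasurableSpace Ω] {μ : Measure Ω}
  (θ : ErgodicTranslationGroup d μ)

/-- The translation on `L²(Ω)` as a linear isometry. -/
noncomputable def translateₗᵢ (x : Euc d) : Lp ℝ 2 μ →ₗᵢ[ℝ] Lp ℝ 2 μ :=
  Lp.compMeasurePreservingₗᵢ ℝ (θ.shift x) (θ.measurePreserving x)

theorem translateₗᵢ_apply (x : Euc d) (f : Lp ℝ 2 μ) : translateₗᵢ θ x f = translate θ x f := rfl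

theorem coeFn_translate (x : Euc d) (f : Lp ℝ 2 μ) :
    translate θ x f =ᵐ[μ] fun ω => f (θ.shift x ω) :=
  Lp.coeFn_compMeasurePreserving f (θ.measurePreserving x)

theorem translate_add_apply (x : Euc d) (f g : Lp ℝ 2 μ) :
    translate θ x (f + g) = translate θ x f + translate θ x g := map_add (translateₗᵢ θ x) f g

theorem translate_sub_apply (x : Euc d) (f g : Lp ℝ 2 μ) :
    translate θ x (f - g) = translate θ x f - translate θ x g := map_sub (translateₗᵢ θ x) f g

theorem translate_smul (x : Euc d) (c : ℝ) (f : Lp ℝ 2 μ) :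
    translate θ x (c • f) = c • translate θ x f := map_smul (translateₗᵢ θ x) c f

theorem norm_translate (x : Euc d) (f : Lp ℝ 2 μ) : ‖translate θ x f‖ = ‖f‖ :=
  (translateₗᵢ θ x).norm_map f

theorem translate_zero (f : Lp ℝ 2 μ) : translate θ 0 f = f := by
  refine Lp.ext ((coeFn_translate θ 0 f).trans ?_)
  simp only [θ.shift_zero]
  rfl

theorem translate_translate (x y : Euc d) (f : Lp ℝ 2 μ) :
    translate θ x (translate θ y f) = translate θ (x + y) f := by
  refine Lp.ext ((coeFn_translate θ x _).trans (EventuallyEq.trans ?_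
    (coeFn_translate θ (x + y) f).symm))
  have h := (θ.measurePreserving x).quasiMeasurePreserving.ae_eq_comp (coeFn_translate θ y f)
  refine h.trans (Eventually.of_forall fun ω => ?_)
  simp only [Function.comp_apply]
  rw [add_comm, θ.shift_add]

theorem inner_translate_translate (x : Euc d) (f g : Lp ℝ 2 μ) :
    inner ℝ (translate θ x f) (translate θ x g) = inner ℝ f g :=
  (translateₗᵢ θ x).inner_map_map f g

theorem inner_translate_left (x : Euc d) (f g : Lp ℝ 2 μ) :
    inner ℝ (translate θ x f) g = inner ℝ f (translate θ (-x) g) := by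
  rw [← inner_translate_translate θ x f, translate_translate, add_neg_cancel, translate_zero]

/-- Each slice at fixed x preserves null sets, so Fubini applies. It makes (ω, x) ↦ q(θ_x ω)
meaningful for q defined only almost everywhere. -/
theorem quasiMeasurePreserving_shift [SFinite μ] :
    Measure.QuasiMeasurePreserving (fun p : Ω × Euc d => θ.shift p.2 p.1) (μ.prod volume) μ := by
  refine ⟨θ.measurable_joint, Measure.AbsolutelyContinuous.mk fun N hN h0 => ?_⟩
  rw [Measure.map_apply θ.measurable_joint hN, Measure.prod_apply_symm (θ.measurable_joint hN)]
  refine (lintegral_congr fun x => ?_).trans lintegral_zero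
  have := (θ.measurePreserving x).measure_preimage hN.nullMeasurableSet
  rw [h0] at this
  exact this

theorem lintegral_comp_shift (x : Euc d) {F : Ω → ℝ≥0∞} (hF : Measurable F) :
    ∫⁻ ω, F (θ.shift x ω) ∂μ = ∫⁻ ω, F ω ∂μ :=
  (θ.measurePreserving x).lintegral_comp hF

theorem sq_eLpNorm_two {X : Type*} [MeasurableSpace X] (ν : Measure X) (f : X → ℝ) :
    eLpNorm f 2 ν ^ 2 = ∫⁻ x, ‖f x‖ₑ ^ 2 ∂ν := by
  rw [eLpNorm_eq_lintegral_rpow_enorm_toReal (by simp) (by simp), ← ENNReal.rpow_natCast,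
    ← ENNReal.rpow_mul]
  simp

theorem tendsto_eLpNorm_translation {u : Euc d → ℝ} (hu : MemLp u 2 volume) :
    Tendsto (fun y => eLpNorm (fun x => u (x + y) - u x) 2 volume) (𝓝 0) (𝓝 0) := by
  let g : Euc d → C(Euc d, Euc d) := fun y => ⟨fun x => x + y, by fun_prop⟩
  have hg : Tendsto g (𝓝 0) (𝓝 (g 0)) := by
    have : Continuous g :=
      ContinuousMap.continuous_of_continuous_uncurry g (by
        change Continuous fun p : Euc d × Euc d => p.2 + p.1
        fun_prop)
    exact this.tendsto 0
  have hm : ∀ y, MeasurePreserving (g y) (volume : Measure (Euc d)) volume := fun y =>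
    measurePreserving_add_right volume y
  have h := Filter.Tendsto.compMeasurePreservingLp (p := 2) (f := fun _ => hu.toLp u)
    (g := g) tendsto_const_nhds hg hm (hm 0) (by simp)
  rw [tendsto_iff_edist_tendsto_0] at h
  refine h.congr fun y => ?_
  rw [Lp.edist_def]
  refine eLpNorm_congr_ae ?_
  have e : ∀ y, Lp.compMeasurePreserving (g y) (hm y) (hu.toLp u) =ᵐ[volume]
      fun x => u (x + y) := fun y =>
    (Lp.coeFn_compMeasurePreserving _ (hm y)).trans
      ((hm y).quasiMeasurePreserving.ae_eq_comp hu.coeFn_toLp)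
  filter_upwards [e y, e 0] with x h1 h2
  simp only [Pi.sub_apply, h1, h2, add_zero]

/-- The realization `x ↦ f (θ_x ω)`, cut off outside of a ball. -/
noncomputable def window (f : Ω → ℝ) (ω : Ω) (x : Euc d) : ℝ :=
  (Metric.ball (0 : Euc d) 2).indicator (fun x => f (θ.shift x ω)) x

theorem window_of_mem (f : Ω → ℝ) (ω : Ω) {x : Euc d} (hx : x ∈ Metric.ball (0 : Euc d) 2) :
    window θ f ω x = f (θ.shift x ω) := indicator_of_mem hx _

theorem window_of_notMem (f : Ω → ℝ) (ω : Ω) {x : Euc d} (hx : x ∉ Metric.ball (0 : Euc d) 2) :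
    window θ f ω x = 0 := indicator_of_notMem hx _

theorem measurable_window {f : Ω → ℝ} (hf : Measurable f) :
    Measurable fun p : Ω × Euc d => window θ f p.1 p.2 := by
  have : (fun p : Ω × Euc d => window θ f p.1 p.2) =
      (Prod.snd ⁻¹' Metric.ball (0 : Euc d) 2).indicator fun p => f (θ.shift p.2 p.1) := by
    ext p; simp only [window, indicator]; rfl
  rw [this]
  exact (hf.comp θ.measurable_joint).indicator (measurable_snd Metric.isOpen_ball.measurableSet)

variable [SFinite μ]

theorem lintegral_window_lt_top {f : Ω → ℝ} (hf : Measurable f) (hf2 : eLpNorm f 2 μ < ∞) :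
    ∫⁻ ω, eLpNorm (window θ f ω) 2 volume ^ 2 ∂μ < ∞ := by
  have hm := measurable_window θ hf
  simp only [sq_eLpNorm_two]
  rw [lintegral_lintegral_swap (hm.enorm.pow_const 2).aemeasurable]
  have : ∀ x, ∫⁻ ω, ‖window θ f ω x‖ₑ ^ 2 ∂μ ≤
      (Metric.ball (0 : Euc d) 2).indicator (fun _ => eLpNorm f 2 μ ^ 2) x := fun x => by
    by_cases hx : x ∈ Metric.ball (0 : Euc d) 2
    · simp only [window_of_mem θ f _ hx, indicator_of_mem hx]
      rw [sq_eLpNorm_two, lintegral_comp_shift θ x (F := fun ω => ‖f ω‖ₑ ^ 2) (by fun_prop)]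
    · simp [window_of_notMem θ f _ hx]
  refine (lintegral_mono this).trans_lt ?_
  rw [lintegral_indicator Metric.isOpen_ball.measurableSet, lintegral_const,
    Measure.restrict_apply_univ]
  exact ENNReal.mul_lt_top (ENNReal.pow_lt_top hf2) measure_ball_lt_top

/-- By stationarity E|f∘θ_{x+y} - f∘θ_x|² does not depend on x, so it can be averaged over the unit
ball. The average is controlled by the L²(ℝ^d) modulus of continuity of the truncated realizations,
which tends to 0 for almost every ω and is dominated in ω. -/
theorem tendsto_translate_zero (f : Lp ℝ 2 μ) :
    Tendsto (fun y => translate θ y f) (𝓝 0) (𝓝 f) := by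
  have hfm : Measurable f := (Lp.stronglyMeasurable f).measurable
  have hqm := measurable_window θ hfm
  have hfin := (lintegral_window_lt_top θ hfm (Lp.eLpNorm_lt_top f)).ne
  generalize hq : window θ f = q at *
  have hqs : ∀ ω, Measurable (q ω) := fun ω => hqm.comp measurable_prodMk_left
  have hdiff : ∀ y, Measurable fun p : Ω × Euc d => q p.1 (p.2 + y) - q p.1 p.2 := fun y =>
    (hqm.comp (measurable_fst.prodMk (measurable_snd.add_const y))).sub hqm
  have hae : ∀ᵐ ω ∂μ, MemLp (q ω) 2 volume := by
    filter_upwards [ae_lt_top (by simp only [sq_eLpNorm_two]; fun_prop) hfin] with ω hω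
    refine ⟨(hqs ω).aestronglyMeasurable, ?_⟩
    by_contra h
    rw [not_lt_top_iff.1 h] at hω
    simp at hω
  have hlim : Tendsto (fun y => ∫⁻ ω, eLpNorm (fun x => q ω (x + y) - q ω x) 2 volume ^ 2 ∂μ) (𝓝 0)
      (𝓝 (∫⁻ _, 0 ∂μ)) := by
    refine tendsto_lintegral_filter_of_dominated_convergence
      (fun ω => (2 * eLpNorm (q ω) 2 volume) ^ 2) ?_ ?_ ?_ ?_
    · refine Eventually.of_forall fun y => ?_
      have := hdiff y
      simp only [sq_eLpNorm_two]
      fun_prop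
    · refine Eventually.of_forall fun y => Eventually.of_forall fun ω => ?_
      have h1 : eLpNorm (fun x => q ω (x + y)) 2 volume = eLpNorm (q ω) 2 volume :=
        eLpNorm_comp_measurePreserving (hqs ω).aestronglyMeasurable
          (measurePreserving_add_right volume y)
      gcongr
      refine (eLpNorm_sub_le (f := fun x => q ω (x + y)) ?_ (hqs ω).aestronglyMeasurable
        (by norm_num)).trans ?_
      · exact ((hqs ω).comp (measurable_add_const y)).aestronglyMeasurable
      · rw [h1, two_mul]
    · simp only [mul_pow]
      rw [lintegral_const_mul' _ _ (by simp)]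
      exact ENNReal.mul_ne_top (by simp) hfin
    · filter_upwards [hae] with ω hω
      have := (ENNReal.continuous_pow 2).tendsto 0 |>.comp (tendsto_eLpNorm_translation hω)
      simpa [Function.comp_def] using this
  rw [lintegral_zero] at hlim
  set v := volume (Metric.ball (0 : Euc d) 1) with hv
  have hv0 : v ≠ 0 := (Metric.measure_ball_pos volume _ one_pos).ne'
  have hvt : v ≠ ∞ := measure_ball_lt_top.ne
  -- For x and y in the unit ball, x and x + y both lie in the ball of radius 2, so the cutoff is
  -- invisible.
  have hbound : ∀ᶠ y in 𝓝 (0 : Euc d), v * edist (translate θ y f) f ^ 2 ≤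
      ∫⁻ ω, eLpNorm (fun x => q ω (x + y) - q ω x) 2 volume ^ 2 ∂μ := by
    filter_upwards [Metric.ball_mem_nhds (0 : Euc d) one_pos] with y hy
    rw [Lp.edist_def, sq_eLpNorm_two]
    have e1 : ∀ x, ∫⁻ ω, ‖f (θ.shift (x + y) ω) - f (θ.shift x ω)‖ₑ ^ 2 ∂μ =
        ∫⁻ ω, ‖(⇑(translate θ y f) - ⇑f) ω‖ₑ ^ 2 ∂μ := fun x => by
      have h1 : ∫⁻ ω, ‖(⇑(translate θ y f) - ⇑f) ω‖ₑ ^ 2 ∂μ =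
          ∫⁻ ω, ‖f (θ.shift y ω) - f ω‖ₑ ^ 2 ∂μ := by
        refine lintegral_congr_ae ?_
        filter_upwards [coeFn_translate θ y f] with ω hω
        rw [Pi.sub_apply, hω]
      have hmy := (θ.measurePreserving y).measurable
      rw [h1, ← lintegral_comp_shift θ x (F := fun ω => ‖f (θ.shift y ω) - f ω‖ₑ ^ 2)
        (by fun_prop)]
      simp only [← θ.shift_add, add_comm]
    calc v * ∫⁻ ω, ‖(⇑(translate θ y f) - ⇑f) ω‖ₑ ^ 2 ∂μ
        = ∫⁻ x in Metric.ball (0 : Euc d) 1,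
            ∫⁻ ω, ‖f (θ.shift (x + y) ω) - f (θ.shift x ω)‖ₑ ^ 2 ∂μ := by
          simp only [e1]
          rw [lintegral_const, Measure.restrict_apply_univ, mul_comm]
      _ = ∫⁻ x in Metric.ball (0 : Euc d) 1, ∫⁻ ω, ‖q ω (x + y) - q ω x‖ₑ ^ 2 ∂μ := by
          refine setLIntegral_congr_fun Metric.isOpen_ball.measurableSet fun x hx => ?_
          have h1 : x ∈ Metric.ball (0 : Euc d) 2 := Metric.ball_subset_ball (by norm_num) hx
          have h2 : x + y ∈ Metric.ball (0 : Euc d) 2 := by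
            rw [mem_ball_zero_iff] at *
            linarith [norm_add_le x y]
          simp only [← hq, window_of_mem θ f _ h1, window_of_mem θ f _ h2]
      _ ≤ ∫⁻ x, ∫⁻ ω, ‖q ω (x + y) - q ω x‖ₑ ^ 2 ∂μ := setLIntegral_le_lintegral _ _
      _ = _ := by
          simp only [sq_eLpNorm_two]
          have := hdiff y
          rw [lintegral_lintegral_swap]
          fun_prop
  have h2 : Tendsto (fun y => v * edist (translate θ y f) f ^ 2) (𝓝 0) (𝓝 0) :=
    tendsto_of_tendsto_of_tendsto_of_le_of_le' tendsto_const_nhds hlim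
      (Eventually.of_forall fun _ => zero_le) hbound
  have h3 : Tendsto (fun y => edist (translate θ y f) f ^ 2) (𝓝 0) (𝓝 0) := by
    have := ENNReal.Tendsto.const_mul (a := v⁻¹) h2 (Or.inr (ENNReal.inv_ne_top.2 hv0))
    simpa only [← mul_assoc, ENNReal.inv_mul_cancel hv0 hvt, one_mul, mul_zero] using this
  rw [tendsto_iff_edist_tendsto_0]
  have h4 := (ENNReal.continuous_rpow_const (y := 1 / 2)).tendsto 0 |>.comp h3
  simp only [Function.comp_def, ← ENNReal.rpow_natCast, ← ENNReal.rpow_mul] at h4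
  simpa using h4

/-- The translation group acts strongly continuously on `L²(Ω)`. -/
theorem continuous_translate (f : Lp ℝ 2 μ) : Continuous fun x => translate θ x f := by
  refine continuous_iff_continuousAt.2 fun x₀ => ?_
  have h1 : Tendsto (fun x => x - x₀) (𝓝 x₀) (𝓝 0) := by
    have : Continuous fun x : Euc d => x - x₀ := by fun_prop
    simpa using this.tendsto x₀
  have h2 := ((translateₗᵢ θ x₀).continuous.tendsto f).comp
    ((tendsto_translate_zero θ f).comp h1)
  refine h2.congr fun x => ?_
  simp only [Function.comp_apply, translateₗᵢ_apply, translate_translate, add_sub_cancel]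

end Translation

end StochHom

namespace StochHom

/-! ### Components of L² vector fields. -/

section Components

variable {d : ℕ} {Ω : Type u} [MeasurableSpace Ω] {μ : Measure Ω}

/-- The `i`-th component of an `L²` vector field. -/
noncomputable def component (i : Fin d) : Lp (Euc d) 2 μ →L[ℝ] Lp ℝ 2 μ :=
  (EuclideanSpace.proj i : Euc d →L[ℝ] ℝ).compLpL 2 μ

theorem coeFn_component (i : Fin d) (F : Lp (Euc d) 2 μ) :
    component i F =ᵐ[μ] fun ω => F ω i :=
  ContinuousLinearMap.coeFn_compLpL _ F

theorem component_ext {F F' : Lp (Euc d) 2 μ} (h : ∀ i, component i F = component i F') :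
    F = F' := by
  refine Lp.ext ?_
  have : ∀ᵐ ω ∂μ, ∀ i, F ω i = F' ω i := ae_all_iff.2 fun i => by
    filter_upwards [coeFn_component i F, coeFn_component i F'] with ω h1 h2
    rw [← h1, ← h2, h i]
  filter_upwards [this] with ω hω
  ext i
  exact hω i

/-- The `L²` vector field with given components. -/
noncomputable def ofComponents (f : Fin d → Lp ℝ 2 μ) : Lp (Euc d) 2 μ :=
  ∑ i, (ContinuousLinearMap.toSpanSingleton ℝ (EuclideanSpace.single i (1 : ℝ))).compLpL 2 μ (f i)

theorem component_ofComponents (f : Fin d → Lp ℝ 2 μ) (i : Fin d) :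
    component i (ofComponents f) = f i := by
  rw [ofComponents, map_sum, Finset.sum_eq_single i]
  · refine Lp.ext ?_
    filter_upwards [coeFn_component i ((ContinuousLinearMap.toSpanSingleton ℝ
      (EuclideanSpace.single i (1 : ℝ))).compLpL 2 μ (f i)),
      ContinuousLinearMap.coeFn_compLpL (ContinuousLinearMap.toSpanSingleton ℝ
      (EuclideanSpace.single i (1 : ℝ))) (f i)] with ω h1 h2
    rw [h1, h2]; simp
  · intro j _ hj
    refine Lp.ext ?_
    filter_upwards [coeFn_component i ((ContinuousLinearMap.toSpanSingleton ℝ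
      (EuclideanSpace.single j (1 : ℝ))).compLpL 2 μ (f j)),
      ContinuousLinearMap.coeFn_compLpL (ContinuousLinearMap.toSpanSingleton ℝ
      (EuclideanSpace.single j (1 : ℝ))) (f j), Lp.coeFn_zero ℝ 2 μ] with ω h1 h2 h3
    rw [h1, h2, h3]; simp [hj.symm]
  · simp

theorem inner_eq_sum_component (F F' : Lp (Euc d) 2 μ) :
    inner ℝ F F' = ∑ i, inner ℝ (component i F) (component i F') := by
  simp only [L2.inner_def]
  rw [← integral_finsetSum _ fun i _ => L2.integrable_inner (component i F) (component i F')]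
  refine integral_congr_ae ?_
  have : ∀ᵐ ω ∂μ, ∀ i, component i F ω = F ω i ∧ component i F' ω = F' ω i :=
    ae_all_iff.2 fun i => (coeFn_component i F).and (coeFn_component i F')
  filter_upwards [this] with ω hω
  rw [PiLp.inner_apply]
  exact Finset.sum_congr rfl fun i _ => by rw [(hω i).1, (hω i).2]

end Components

/-! ### The stochastic gradient: closedness, integration by parts and smoothing. -/

section Gradient

variable {d : ℕ} {Ω : Type u} [MeasurableSpace Ω] {μ : Measure Ω}
  (θ : ErgodicTranslationGroup d μ)

/-- `g` is the derivative of `f` in the direction `e_i`. -/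
def HasPartial (i : Fin d) (f g : Lp ℝ 2 μ) : Prop :=
  Tendsto (fun h : ℝ => h⁻¹ • (translate θ (EuclideanSpace.single i h) f - f)) (𝓝[>] 0) (𝓝 g)

theorem hasStochGrad_iff {f : Lp ℝ 2 μ} {F : Lp (Euc d) 2 μ} :
    HasStochGrad θ f F ↔ ∀ i, HasPartial θ i f (component i F) := Iff.rfl

variable {θ}

theorem HasPartial.unique {i : Fin d} {f g g' : Lp ℝ 2 μ} (h : HasPartial θ i f g)
    (h' : HasPartial θ i f g') : g = g' := tendsto_nhds_unique h h'

theorem HasPartial.add {i : Fin d} {f g f' g' : Lp ℝ 2 μ} (h : HasPartial θ i f f')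
    (h' : HasPartial θ i g g') : HasPartial θ i (f + g) (f' + g') := by
  refine (Tendsto.add h h').congr fun t => ?_
  rw [translate_add_apply]; module

theorem HasPartial.const_smul {i : Fin d} {f f' : Lp ℝ 2 μ} (c : ℝ) (h : HasPartial θ i f f') :
    HasPartial θ i (c • f) (c • f') := by
  refine (Tendsto.const_smul h c).congr fun t => ?_
  rw [translate_smul]; module

theorem HasPartial.translate {i : Fin d} {f f' : Lp ℝ 2 μ} (x : Euc d) (h : HasPartial θ i f f') :
    HasPartial θ i (translate θ x f) (translate θ x f') := by
  refine (((translateₗᵢ θ x).continuous.tendsto f').comp h).congr fun t => ?_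
  simp only [Function.comp_apply, map_smul, map_sub, translateₗᵢ_apply, translate_translate]
  rw [add_comm]

theorem hasStochGrad_unique {f : Lp ℝ 2 μ} {F F' : Lp (Euc d) 2 μ} (h : HasStochGrad θ f F)
    (h' : HasStochGrad θ f F') : F = F' :=
  component_ext fun i => HasPartial.unique (h i) (h' i)

theorem stochGrad_eq {f : Lp ℝ 2 μ} {F : Lp (Euc d) 2 μ} (h : HasStochGrad θ f F) :
    stochGrad θ f = F := by
  have h' : ∃ F, HasStochGrad θ f F := ⟨F, h⟩
  rw [stochGrad, dif_pos h']
  exact hasStochGrad_unique h'.choose_spec h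

theorem hasStochGrad_stochGrad {f : Lp ℝ 2 μ} (h : f ∈ gradDomain θ) :
    HasStochGrad θ f (stochGrad θ f) := by
  obtain ⟨F, hF⟩ := h
  rwa [stochGrad_eq hF]

variable (θ) in
/-- The graph of the stochastic gradient. -/
def gradGraph : Submodule ℝ (Lp ℝ 2 μ × Lp (Euc d) 2 μ) where
  carrier := {p | HasStochGrad θ p.1 p.2}
  add_mem' := fun {p q} hp hq => (hasStochGrad_iff θ).2 fun i => by
    rw [Prod.snd_add, map_add]; exact HasPartial.add (hp i) (hq i)
  zero_mem' := (hasStochGrad_iff θ).2 fun i => by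
    have : Tendsto (fun _ : ℝ => (0 : Lp ℝ 2 μ)) (𝓝[>] 0) (𝓝 0) := tendsto_const_nhds
    simp only [Prod.snd_zero, map_zero, Prod.fst_zero]
    refine this.congr fun t => ?_
    have h0 : StochHom.translate θ (EuclideanSpace.single i t) (0 : Lp ℝ 2 μ) = 0 :=
      map_zero (translateₗᵢ θ _)
    rw [h0]; simp
  smul_mem' := fun c p hp => (hasStochGrad_iff θ).2 fun i => by
    rw [Prod.smul_snd, map_smul]; exact HasPartial.const_smul c (hp i)

section Finite

variable [SFinite μ]

theorem continuous_translate_single (i : Fin d) (g : Lp ℝ 2 μ) :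
    Continuous fun s : ℝ => translate θ (EuclideanSpace.single i s) g := by
  have : (EuclideanSpace.single i : ℝ → Euc d) =
      fun s : ℝ => s • (EuclideanSpace.single i (1 : ℝ) : Euc d) := by
    ext s j; simp
  have h : Continuous (EuclideanSpace.single i : ℝ → Euc d) := by rw [this]; fun_prop
  exact (continuous_translate θ g).comp h

theorem single_add (i : Fin d) (s t : ℝ) :
    (EuclideanSpace.single i (s + t) : Euc d) =
      EuclideanSpace.single i s + EuclideanSpace.single i t := by
  ext j; by_cases h : j = i <;> simp [h]

/-- Trades the limit of difference quotients for a family of identities that are closed conditions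
on (f, g). Strong continuity gives the fundamental theorem of calculus with right derivatives only.
-/
theorem hasPartial_iff_integral {i : Fin d} {f g : Lp ℝ 2 μ} :
    HasPartial θ i f g ↔ ∀ h : ℝ, 0 ≤ h → translate θ (EuclideanSpace.single i h) f - f =
      ∫ s in (0 : ℝ)..h, translate θ (EuclideanSpace.single i s) g := by
  have h0 : ∀ f : Lp ℝ 2 μ, translate θ (EuclideanSpace.single i 0) f = f := fun f => by
    have : (EuclideanSpace.single i (0 : ℝ) : Euc d) = 0 := by ext j; simp
    rw [this, translate_zero]
  constructor
  · intro hfg h _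
    have := intervalIntegral.integral_eq_sub_of_hasDeriv_right (a := 0) (b := h)
      (f := fun s => translate θ (EuclideanSpace.single i s) f)
      (f' := fun s => translate θ (EuclideanSpace.single i s) g)
      (continuous_translate_single i f).continuousOn (fun s _ => ?_)
      ((continuous_translate_single i g).intervalIntegrable _ _)
    · rw [this, h0]
    -- The right derivative at s is the right derivative at 0 transported by the translation by s
    -- e_i.
    · rw [hasDerivWithinAt_iff_tendsto_slope' (by simp)]
      have h1 : Tendsto (fun y : ℝ => y - s) (𝓝[>] s) (𝓝[>] 0) := by
        refine tendsto_nhdsWithin_iff.2 ⟨?_, ?_⟩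
        · have : Tendsto (fun y : ℝ => y - s) (𝓝 s) (𝓝 (s - s)) :=
            (continuous_id.sub continuous_const).tendsto s
          rw [sub_self] at this
          exact this.mono_left nhdsWithin_le_nhds
        · filter_upwards [self_mem_nhdsWithin] with y hy
          simpa using hy
      refine (Tendsto.comp (HasPartial.translate (EuclideanSpace.single i s) hfg) h1).congr
        fun y => ?_
      simp only [Function.comp_apply, slope_def_module, translate_translate, ← single_add,
        sub_add_cancel]
  · intro H
    have h1 : HasDerivAt (fun h : ℝ => ∫ s in (0 : ℝ)..h, translate θ (EuclideanSpace.single i s) g)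
        (translate θ (EuclideanSpace.single i 0) g) 0 :=
      intervalIntegral.integral_hasDerivAt_right
        ((continuous_translate_single i g).intervalIntegrable _ _)
        ((continuous_translate_single i g).stronglyMeasurable.stronglyMeasurableAtFilter)
        (continuous_translate_single i g).continuousAt
    rw [h0] at h1
    have h2 := (hasDerivWithinAt_iff_tendsto_slope' (by simp)).1
      (h1.hasDerivWithinAt (s := Ioi 0))
    refine h2.congr' ?_
    filter_upwards [self_mem_nhdsWithin] with h hh
    rw [slope_def_module, intervalIntegral.integral_same, sub_zero, sub_zero, H h (le_of_lt hh)]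

theorem continuous_integral_translate (i : Fin d) (h : ℝ) :
    Continuous fun g : Lp ℝ 2 μ => ∫ s in (0 : ℝ)..h, translate θ (EuclideanSpace.single i s) g := by
  refine (LipschitzWith.of_dist_le_mul (K := ⟨|h|, abs_nonneg h⟩) fun g g' => ?_).continuous
  rw [dist_eq_norm, dist_eq_norm, ← intervalIntegral.integral_sub
    ((continuous_translate_single i g).intervalIntegrable _ _)
    ((continuous_translate_single i g').intervalIntegrable _ _)]
  refine (intervalIntegral.norm_integral_le_of_norm_le_const (C := ‖g - g'‖) fun s _ => ?_).trans ?_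
  · rw [← translate_sub_apply, norm_translate]
  · rw [sub_zero, mul_comm]; rfl

/-- The stochastic gradient is a closed operator. -/
theorem isClosed_gradGraph : IsClosed (gradGraph θ : Set (Lp ℝ 2 μ × Lp (Euc d) 2 μ)) := by
  have : (gradGraph θ : Set (Lp ℝ 2 μ × Lp (Euc d) 2 μ)) = ⋂ (i : Fin d) (h : ℝ) (_ : 0 ≤ h),
      {p | translate θ (EuclideanSpace.single i h) p.1 - p.1 =
        ∫ s in (0 : ℝ)..h, translate θ (EuclideanSpace.single i s) (component i p.2)} := by
    ext p
    simp only [mem_iInter]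
    exact forall_congr' fun i => hasPartial_iff_integral
  rw [this]
  refine isClosed_iInter fun i => isClosed_iInter fun h => isClosed_iInter fun _ => ?_
  refine isClosed_eq ?_ ?_
  · exact ((translateₗᵢ θ _).continuous.comp continuous_fst).sub continuous_fst
  · exact (continuous_integral_translate i h).comp ((component i).continuous.comp continuous_snd)

/-- Invariance of the inner product gives ⟨τ_h f - f, g⟩ = -⟨τ_h f, τ_h g - g⟩ for each h. Only
forward quotients appear, and τ_h f → f by strong continuity. -/
theorem HasPartial.inner_eq_neg {i : Fin d} {f f' g g' : Lp ℝ 2 μ} (hf : HasPartial θ i f f')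
    (hg : HasPartial θ i g g') : inner ℝ f' g = -inner ℝ f g' := by
  have h1 : Tendsto (fun h : ℝ => inner ℝ
      (h⁻¹ • (StochHom.translate θ (EuclideanSpace.single i h) f - f)) g) (𝓝[>] 0)
      (𝓝 (inner ℝ f' g)) := Tendsto.inner hf tendsto_const_nhds
  have h0 : Tendsto (fun h : ℝ => StochHom.translate θ (EuclideanSpace.single i h) f) (𝓝[>] 0)
      (𝓝 f) := by
    have := (continuous_translate_single (θ := θ) i f).tendsto 0
    have e : (EuclideanSpace.single i (0 : ℝ) : Euc d) = 0 := by ext j; simp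
    rw [e, translate_zero] at this
    exact this.mono_left nhdsWithin_le_nhds
  have h2 := (Tendsto.inner (𝕜 := ℝ) h0 hg).neg
  refine tendsto_nhds_unique h1 (h2.congr fun h => ?_)
  rw [inner_smul_left, inner_smul_right, inner_sub_left, inner_sub_right,
    inner_translate_translate]
  simp only [RCLike.conj_to_real]
  ring

/-- The smoothing `∫ η(x) f ∘ θ_x dx` of `f`. -/
noncomputable def smear (θ : ErgodicTranslationGroup d μ) (η : Euc d → ℝ) (f : Lp ℝ 2 μ) :
    Lp ℝ 2 μ := ∫ x, η x • translate θ x f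

theorem integrable_smear {η : Euc d → ℝ} (hη : Continuous η) (hs : HasCompactSupport η)
    (f : Lp ℝ 2 μ) : Integrable fun x => η x • translate θ x f :=
  (hη.smul (continuous_translate θ f)).integrable_of_hasCompactSupport hs.smul_right

theorem inner_smear {η : Euc d → ℝ} (hη : Continuous η) (hs : HasCompactSupport η)
    (f g : Lp ℝ 2 μ) : inner ℝ g (smear θ η f) = ∫ x, η x * inner ℝ g (translate θ x f) := by
  rw [smear, ← integral_inner (integrable_smear hη hs f)]
  simp only [inner_smul_right]

theorem smear_sub {η : Euc d → ℝ} (hη : Continuous η) (hs : HasCompactSupport η)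
    (f g : Lp ℝ 2 μ) : smear θ η (f - g) = smear θ η f - smear θ η g := by
  simp only [smear, translate_sub_apply, smul_sub]
  exact integral_sub (integrable_smear hη hs f) (integrable_smear hη hs g)

theorem norm_smear_le (η : Euc d → ℝ) (f : Lp ℝ 2 μ) :
    ‖smear θ η f‖ ≤ (∫ x, ‖η x‖) * ‖f‖ := by
  refine (norm_integral_le_integral_norm _).trans_eq ?_
  simp only [norm_smul, norm_translate]
  rw [integral_mul_const]

theorem continuous_smear {η : Euc d → ℝ} (hη : Continuous η) (hs : HasCompactSupport η) :
    Continuous fun f : Lp ℝ 2 μ => smear θ η f := by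
  refine (LipschitzWith.of_dist_le_mul
    (K := ⟨∫ x, ‖η x‖, integral_nonneg fun _ => norm_nonneg _⟩) fun g g' => ?_).continuous
  rw [dist_eq_norm, dist_eq_norm, ← smear_sub hη hs]
  exact norm_smear_le η _

theorem translate_smear {η : Euc d → ℝ} (hη : Continuous η) (hs : HasCompactSupport η)
    (f : Lp ℝ 2 μ) (y : Euc d) :
    translate θ y (smear θ η f) = ∫ x, η (x - y) • translate θ x f := by
  rw [← translateₗᵢ_apply, smear, ← LinearIsometry.coe_toContinuousLinearMap,
    ← ContinuousLinearMap.integral_comp_comm _ (integrable_smear hη hs f),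
    ← integral_add_right_eq_self (fun x => η (x - y) • translate θ x f) y]
  refine integral_congr_ae (Eventually.of_forall fun x => ?_)
  simp only [LinearIsometry.coe_toContinuousLinearMap, map_smul, translateₗᵢ_apply,
    translate_translate, add_comm y, add_sub_cancel_right]

/-- The `i`-th partial derivative. -/
noncomputable def partialDeriv (i : Fin d) (η : Euc d → ℝ) (x : Euc d) : ℝ :=
  fderiv ℝ η x (EuclideanSpace.single i 1)

theorem contDiff_partialDeriv {i : Fin d} {η : Euc d → ℝ} (hη : ContDiff ℝ (⊤ : ℕ∞) η) :
    ContDiff ℝ (⊤ : ℕ∞) (partialDeriv i η) :=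
  (hη.fderiv_right (m := (⊤ : ℕ∞)) le_rfl).clm_apply contDiff_const

theorem hasCompactSupport_partialDeriv {i : Fin d} {η : Euc d → ℝ} (hs : HasCompactSupport η) :
    HasCompactSupport (partialDeriv i η) :=
  (hs.fderiv ℝ).comp_left (g := fun L : Euc d →L[ℝ] ℝ => L (EuclideanSpace.single i 1)) rfl

theorem partialDeriv_comm {i j : Fin d} {η : Euc d → ℝ} (hη : ContDiff ℝ (⊤ : ℕ∞) η) :
    partialDeriv i (partialDeriv j η) = partialDeriv j (partialDeriv i η) := by
  have hd : Differentiable ℝ (fderiv ℝ η) :=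
    (hη.fderiv_right (m := (⊤ : ℕ∞)) le_rfl).differentiable (by simp)
  have key : ∀ i j : Fin d, ∀ x, partialDeriv i (partialDeriv j η) x =
      fderiv ℝ (fderiv ℝ η) x (EuclideanSpace.single i 1) (EuclideanSpace.single j 1) := by
    intro i j x
    unfold partialDeriv
    rw [fderiv_clm_apply (hd x) (by fun_prop)]
    simp
  ext x
  rw [key, key]
  exact (hη.contDiffAt.isSymmSndFDerivAt (by simp only [minSmoothness_of_isRCLikeNormedField]; exact WithTop.coe_le_coe.2 le_top)).eq _ _

theorem gradient_apply (η : Euc d → ℝ) (x : Euc d) (i : Fin d) :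
    gradient η x i = partialDeriv i η x := by
  have h := InnerProductSpace.toDual_symm_apply (𝕜 := ℝ) (x := EuclideanSpace.single i (1 : ℝ))
    (y := fderiv ℝ η x)
  rw [partialDeriv, ← h, gradient, EuclideanSpace.inner_single_right]
  simp

/-- A translation of the smoothed function moves onto the kernel as η(x - t e_i); differentiation
under the integral then produces the minus sign. -/
theorem hasPartial_smear {η : Euc d → ℝ} (hη : ContDiff ℝ (⊤ : ℕ∞) η) (hs : HasCompactSupport η)
    (i : Fin d) (f : Lp ℝ 2 μ) :
    HasPartial θ i (smear θ η f) (-smear θ (partialDeriv i η) f) := by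
  have hη' := contDiff_partialDeriv (i := i) hη
  have hs' := hasCompactSupport_partialDeriv (i := i) hs
  obtain ⟨M, hM⟩ := hs'.exists_bound_of_continuous hη'.continuous
  obtain ⟨R, hR⟩ := hs'.isCompact.isBounded.subset_closedBall 0
  have e0 : (EuclideanSpace.single i (0 : ℝ) : Euc d) = 0 := by ext j; simp
  have esm : ∀ t : ℝ, (EuclideanSpace.single i t : Euc d) =
      t • EuclideanSpace.single i (1 : ℝ) := fun t => by
    ext j; by_cases h : j = i <;> simp [h]
  have hderiv := hasDerivAt_integral_of_dominated_loc_of_deriv_le (𝕜 := ℝ)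
    (μ := (volume : Measure (Euc d))) (x₀ := (0 : ℝ))
    (F := fun (t : ℝ) x => η (x - EuclideanSpace.single i t) • translate θ x f)
    (F' := fun (t : ℝ) x => (-partialDeriv i η (x - EuclideanSpace.single i t)) • translate θ x f)
    (s := Metric.ball (0 : ℝ) 1)
    -- The radius R + 1 contains the support of every kernel shifted by |t| < 1.
    (bound := (Metric.closedBall (0 : Euc d) (R + 1)).indicator fun _ => M * ‖f‖)
    (Metric.ball_mem_nhds 0 one_pos) ?_ ?_ ?_ ?_ ?_ ?_
  · have h1 := (hasDerivWithinAt_iff_tendsto_slope' (by simp)).1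
      (hderiv.2.hasDerivWithinAt (s := Ioi 0))
    have e1 : ∫ x, (-partialDeriv i η (x - EuclideanSpace.single i 0)) • translate θ x f =
        -smear θ (partialDeriv i η) f := by
      rw [e0, smear, ← integral_neg]
      simp only [sub_zero, neg_smul]
    rw [e1] at h1
    refine h1.congr fun t => ?_
    rw [slope_def_module, sub_zero, translate_smear hη.continuous hs, smear, e0]
    simp only [sub_zero]
  · refine Eventually.of_forall fun t => Continuous.aestronglyMeasurable ?_
    exact (hη.continuous.comp (by fun_prop)).smul (continuous_translate θ f)
  · rw [e0]
    simp only [sub_zero]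
    exact integrable_smear hη.continuous hs f
  · exact Continuous.aestronglyMeasurable
      ((hη'.continuous.comp (by fun_prop)).neg.smul (continuous_translate θ f))
  · refine Eventually.of_forall fun x t ht => ?_
    rw [norm_smul, norm_translate, norm_neg]
    by_cases hx : x ∈ Metric.closedBall (0 : Euc d) (R + 1)
    · rw [indicator_of_mem hx]
      gcongr
      exact hM _
    · have hz : x - EuclideanSpace.single i t ∉ tsupport (partialDeriv i η) := by
        intro h
        refine hx ?_
        have h1 := mem_closedBall_zero_iff.1 (hR h)
        have h2 : ‖(EuclideanSpace.single i t : Euc d)‖ < 1 := by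
          rw [PiLp.norm_single]
          simpa using ht
        rw [mem_closedBall_zero_iff]
        have := norm_add_le (x - EuclideanSpace.single i t) (EuclideanSpace.single i t)
        rw [sub_add_cancel] at this
        linarith
      rw [indicator_of_notMem hx, image_eq_zero_of_notMem_tsupport hz, norm_zero, zero_mul]
  · exact (integrable_indicator_iff Metric.isClosed_closedBall.measurableSet).2
      (integrableOn_const (by exact measure_closedBall_lt_top.ne))
  · refine Eventually.of_forall fun x t _ => ?_
    have h1 : HasDerivAt (fun t : ℝ => x - EuclideanSpace.single i t)
        (-(EuclideanSpace.single i (1 : ℝ) : Euc d)) t := by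
      have : HasDerivAt (fun t : ℝ => t • (EuclideanSpace.single i (1 : ℝ) : Euc d))
          ((1 : ℝ) • EuclideanSpace.single i (1 : ℝ)) t := (hasDerivAt_id t).smul_const _
      rw [one_smul] at this
      have e : (fun t : ℝ => x - EuclideanSpace.single i t) =
          fun t : ℝ => x - t • (EuclideanSpace.single i (1 : ℝ) : Euc d) :=
        funext fun t => by rw [esm t]
      rw [e]
      exact this.const_sub x
    have h2 : HasFDerivAt η (fderiv ℝ η (x - EuclideanSpace.single i t))
        (x - EuclideanSpace.single i t) :=
      (hη.differentiable (by simp) _).hasFDerivAt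
    have h3 := (h2.comp_hasDerivAt t h1).smul_const (translate θ x f)
    rw [map_neg] at h3
    exact h3

theorem hasStochGrad_smear {η : Euc d → ℝ} (hη : ContDiff ℝ (⊤ : ℕ∞) η)
    (hs : HasCompactSupport η) (f : Lp ℝ 2 μ) :
    HasStochGrad θ (smear θ η f) (ofComponents fun i => -smear θ (partialDeriv i η) f) :=
  (hasStochGrad_iff θ).2 fun i => by
    rw [component_ofComponents]; exact hasPartial_smear hη hs i f

/-- Smooth nonnegative kernels concentrating at the origin give an approximation of the identity. -/
theorem exists_smear_tendsto (θ : ErgodicTranslationGroup d μ) :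
    ∃ η : ℕ → Euc d → ℝ, (∀ n, ContDiff ℝ (⊤ : ℕ∞) (η n)) ∧ (∀ n, HasCompactSupport (η n)) ∧
      ∀ f : Lp ℝ 2 μ, Tendsto (fun n => smear θ (η n) f) atTop (𝓝 f) := by
  let b : ℕ → ContDiffBump (0 : Euc d) := fun n =>
    ⟨1 / ((n : ℝ) + 1) / 2, 1 / ((n : ℝ) + 1), by positivity, by
      have : (0 : ℝ) < 1 / ((n : ℝ) + 1) := by positivity
      linarith⟩
  refine ⟨fun n => (b n).normed volume, fun n => (b n).contDiff_normed, fun n =>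
    (b n).hasCompactSupport_normed, fun f => ?_⟩
  -- The smoothing is the convolution of the bump with x ↦ τ_{-x} f, evaluated at the origin.
  have h := ContDiffBump.convolution_tendsto_right_of_continuous (φ := b) (l := atTop)
    (μ := (volume : Measure (Euc d))) (g := fun x => translate θ (-x) f)
    (tendsto_one_div_add_atTop_nhds_zero_nat)
    ((continuous_translate θ f).comp continuous_neg) 0
  simp only [neg_zero, translate_zero] at h
  refine h.congr fun n => ?_
  rw [convolution_def, smear]
  simp

end Finite

end Gradient

end StochHom

namespace StochHom

/-! ### Ergodicity, curl-free stationary fields and the Weyl decomposition. -/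

section Stationary

variable {d : ℕ} {Ω : Type u} [MeasurableSpace Ω] {μ : Measure Ω} [IsProbabilityMeasure μ]
  {θ : ErgodicTranslationGroup d μ}

/-- By ergodicity, translation invariant functions are constant. -/
theorem ae_eq_const_of_translate_eq {f : Lp ℝ 2 μ} (h : ∀ x, translate θ x f = f) :
    ∃ c : ℝ, f =ᵐ[μ] fun _ => c := by
  have hfm : Measurable f := (Lp.stronglyMeasurable f).measurable
  have hjoint : Measurable fun p : Ω × Euc d => f (θ.shift p.2 p.1) := hfm.comp θ.measurable_joint
  -- Fubini converts invariance for each x outside an x-dependent null set into invariance for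
  -- almost every x, almost surely.
  have hinv : ∀ᵐ ω ∂μ, ∀ᵐ x ∂(volume : Measure (Euc d)), f (θ.shift x ω) = f ω := by
    refine (Measure.ae_ae_comm (p := fun ω x => f (θ.shift x ω) = f ω)
      (measurableSet_eq_fun hjoint (hfm.comp measurable_fst))).2 (Eventually.of_forall fun x => ?_)
    filter_upwards [coeFn_translate θ x f] with ω hω
    rw [← hω, h x]
  refine Filter.exists_eventuallyEq_const_of_forall_separating MeasurableSet fun U hU => ?_
  let S : Set (Ω × Euc d) := {p | f (θ.shift p.2 p.1) ∉ U}
  have hS : MeasurableSet S := (hjoint hU).compl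
  -- The event {f ∈ U} is invariant only up to null sets, while ergodicity concerns exactly
  -- invariant sets. F, the set of ω whose orbit is in U for almost every x, is exactly invariant
  -- and agrees almost surely with that event.
  let F : Set Ω := {ω | (volume : Measure (Euc d)) (Prod.mk ω ⁻¹' S) = 0}
  have hF : MeasurableSet F := (measurable_measure_prodMk_left hS) (measurableSet_singleton 0)
  have hFinv : ∀ y, θ.shift y '' F ⊆ F := by
    rintro y _ ⟨ω, hω, rfl⟩
    have : Prod.mk (θ.shift y ω) ⁻¹' S = (fun x => x + y) ⁻¹' (Prod.mk ω ⁻¹' S) := by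
      ext x
      simp only [S, mem_preimage, mem_ofPred_eq, θ.shift_add]
    change (volume : Measure (Euc d)) _ = 0
    rw [this, measure_preimage_add_right]
    exact hω
  have hFU : ∀ᵐ ω ∂μ, ω ∈ F ↔ f ω ∈ U := by
    filter_upwards [hinv] with ω hω
    constructor
    · intro hωF
      have h1 : ∀ᵐ x ∂(volume : Measure (Euc d)), f (θ.shift x ω) ∈ U := by
        rw [ae_iff]; exact hωF
      obtain ⟨x, hx1, hx2⟩ := (hω.and h1).exists
      rwa [← hx1]
    · intro hU'
      have h1 : ∀ᵐ x ∂(volume : Measure (Euc d)), f (θ.shift x ω) ∈ U := by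
        filter_upwards [hω] with x hx
        rwa [hx]
      rw [ae_iff] at h1
      exact h1
  rcases θ.ergodic F hF hFinv with h0 | h1
  · right
    have : ∀ᵐ ω ∂μ, ω ∉ F := measure_eq_zero_iff_ae_notMem.1 h0
    filter_upwards [this, hFU] with ω h2 h3
    rwa [← h3]
  · left
    have : ∀ᵐ ω ∂μ, ω ∈ F := by
      rw [← prob_compl_eq_zero_iff hF] at h1
      filter_upwards [measure_eq_zero_iff_ae_notMem.1 h1] with ω hω
      simpa using hω
    filter_upwards [this, hFU] with ω h2 h3
    rwa [← h3]

theorem integrable_prod_shift {η : Euc d → ℝ} (hη : Continuous η) (hs : HasCompactSupport η)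
    {q : Ω → ℝ} (hq : MemLp q 2 μ) :
    Integrable (fun p : Ω × Euc d => η p.2 * q (θ.shift p.2 p.1)) (μ.prod volume) := by
  have hq1 : Integrable q μ := hq.integrable (by norm_num)
  have hmeas : AEStronglyMeasurable (fun p : Ω × Euc d => η p.2 * q (θ.shift p.2 p.1))
      (μ.prod volume) :=
    (hη.measurable.comp measurable_snd).aestronglyMeasurable.mul
      (hq.aestronglyMeasurable.comp_quasiMeasurePreserving (quasiMeasurePreserving_shift θ))
  refine (integrable_prod_iff' hmeas).2 ⟨Eventually.of_forall fun x => ?_, ?_⟩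
  · exact (((θ.measurePreserving x).integrable_comp hq1.aestronglyMeasurable).2 hq1).const_mul (η x)
  · have : ∀ x, ∫ ω, ‖η x * q (θ.shift x ω)‖ ∂μ = ‖η x‖ * ∫ ω, ‖q ω‖ ∂μ := fun x => by
      simp only [norm_mul]
      rw [integral_const_mul]
      congr 1
      have h1 := integral_map (f := fun ω => ‖q ω‖)
        (θ.measurePreserving x).measurable.aemeasurable (by
          rw [(θ.measurePreserving x).map_eq]; exact hq.aestronglyMeasurable.norm)
      rw [(θ.measurePreserving x).map_eq] at h1
      exact h1.symm
    simp only [this]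
    exact ((hη.integrable_of_hasCompactSupport hs).norm).mul_const _

theorem ae_integrable_shift {η : Euc d → ℝ} (hη : Continuous η) (hs : HasCompactSupport η)
    {q : Ω → ℝ} (hq : MemLp q 2 μ) :
    ∀ᵐ ω ∂μ, Integrable (fun x => η x * q (θ.shift x ω)) (volume : Measure (Euc d)) :=
  (integrable_prod_shift hη hs hq).prod_right_ae

/-- Pointwise representation of the smoothing operator. -/
theorem coeFn_smear {η : Euc d → ℝ} (hη : Continuous η) (hs : HasCompactSupport η)
    {q : Ω → ℝ} (hq : MemLp q 2 μ) :
    smear θ η (hq.toLp q) =ᵐ[μ] fun ω => ∫ x, η x * q (θ.shift x ω) := by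
  have hint := integrable_prod_shift (θ := θ) hη hs hq
  refine Integrable.ae_eq_of_forall_setIntegral_eq _ _
    ((Lp.memLp _).integrable (by norm_num)) hint.integral_prod_left fun s hsm _ => ?_
  -- Both sides are compared by integrating over an arbitrary event s; Fubini exchanges the
  -- integrals in ω and x.
  have hsfin : μ s ≠ ∞ := measure_ne_top μ s
  rw [← L2.inner_indicatorConstLp_one (𝕜 := ℝ) hsm hsfin, inner_smear hη hs]
  have h1 : Integrable (fun p : Ω × Euc d => η p.2 * q (θ.shift p.2 p.1))
      ((μ.restrict s).prod volume) := by
    refine hint.mono_measure ?_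
    exact Measure.prod_mono Measure.restrict_le_self le_rfl
  rw [integral_integral_swap (f := fun ω x => η x * q (θ.shift x ω)) h1]
  refine integral_congr_ae (Eventually.of_forall fun x => ?_)
  simp only
  rw [L2.inner_indicatorConstLp_one (𝕜 := ℝ) hsm hsfin, integral_const_mul]
  congr 1
  refine integral_congr_ae (ae_restrict_of_ae ?_)
  filter_upwards [coeFn_translate θ x (hq.toLp q),
    (θ.measurePreserving x).quasiMeasurePreserving.ae_eq_comp hq.coeFn_toLp] with ω h2 h3
  rw [h2]
  exact h3

/-- Smooth Q, integrate by parts so that the derivative falls on the kernel, use the hypothesis, and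
let the kernels concentrate. -/
theorem inner_eq_zero_of_smear_divergence {Q : Lp (Euc d) 2 μ}
    (h : ∀ η : Euc d → ℝ, ContDiff ℝ (⊤ : ℕ∞) η → HasCompactSupport η →
      ∑ i, smear θ (partialDeriv i η) (component i Q) = 0)
    {ψ : Lp ℝ 2 μ} {Ψ : Lp (Euc d) 2 μ} (hψ : HasStochGrad θ ψ Ψ) : inner ℝ Ψ Q = 0 := by
  obtain ⟨η, hη, hs, hlim⟩ := exists_smear_tendsto θ
  have h1 : Tendsto (fun n => ∑ i, inner ℝ (component i Ψ) (smear θ (η n) (component i Q))) atTop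
      (𝓝 (∑ i, inner ℝ (component i Ψ) (component i Q))) :=
    tendsto_finsetSum _ fun i _ => Tendsto.inner tendsto_const_nhds (hlim _)
  rw [inner_eq_sum_component]
  refine tendsto_nhds_unique h1 (tendsto_const_nhds.congr fun n => ?_)
  have h2 : ∀ i, inner ℝ (component i Ψ) (smear θ (η n) (component i Q)) =
      inner ℝ ψ (smear θ (partialDeriv i (η n)) (component i Q)) := fun i => by
    rw [HasPartial.inner_eq_neg ((hasStochGrad_iff θ).1 hψ i) (hasPartial_smear (hη n) (hs n) i _), inner_neg_right,
      neg_neg]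
  simp only [h2]
  rw [← inner_sum, h _ (hη n) (hs n), inner_zero_right]

variable (θ) in
/-- A stationary `L²` field is curl-free in the sense of distributions. -/
def IsCurlFree (Q : Lp (Euc d) 2 μ) : Prop :=
  ∀ η : Euc d → ℝ, ContDiff ℝ (⊤ : ℕ∞) η → HasCompactSupport η → ∀ i j,
    smear θ (partialDeriv j η) (component i Q) = smear θ (partialDeriv i η) (component j Q)

theorem smear_smul (η : Euc d → ℝ) (c : ℝ) (f : Lp ℝ 2 μ) :
    smear θ η (c • f) = c • smear θ η f := by
  rw [smear, smear, ← integral_smul]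
  refine integral_congr_ae (Eventually.of_forall fun x => ?_)
  simp only [translate_smul]
  rw [smul_comm]

theorem translate_smear_comm {η : Euc d → ℝ} (hη : Continuous η) (hs : HasCompactSupport η)
    (f : Lp ℝ 2 μ) (y : Euc d) : translate θ y (smear θ η f) = smear θ η (translate θ y f) := by
  rw [← translateₗᵢ_apply, smear, ← LinearIsometry.coe_toContinuousLinearMap,
    ← ContinuousLinearMap.integral_comp_comm _ (integrable_smear hη hs f), smear]
  refine integral_congr_ae (Eventually.of_forall fun x => ?_)
  simp only [LinearIsometry.coe_toContinuousLinearMap, map_smul, translateₗᵢ_apply,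
    translate_translate, add_comm]

theorem HasPartial.smear {i : Fin d} {f f' : Lp ℝ 2 μ} (h : HasPartial θ i f f') {η : Euc d → ℝ}
    (hη : Continuous η) (hs : HasCompactSupport η) :
    HasPartial θ i (smear θ η f) (smear θ η f') := by
  refine (((continuous_smear hη hs).tendsto f').comp h).congr fun t => ?_
  simp only [Function.comp_apply]
  rw [smear_smul, smear_sub hη hs, translate_smear_comm hη hs]

theorem HasPartial.smear_eq {i : Fin d} {f f' : Lp ℝ 2 μ} (h : HasPartial θ i f f') {η : Euc d → ℝ}
    (hη : ContDiff ℝ (⊤ : ℕ∞) η) (hs : HasCompactSupport η) :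
    StochHom.smear θ η f' = -StochHom.smear θ (partialDeriv i η) f :=
  (h.smear hη.continuous hs).unique (hasPartial_smear hη hs i f)

/-- Both sides become smoothings of ψ by second derivatives of the kernel, which commute. -/
theorem HasStochGrad.isCurlFree {ψ : Lp ℝ 2 μ} {Ψ : Lp (Euc d) 2 μ} (h : HasStochGrad θ ψ Ψ) :
    IsCurlFree θ Ψ := by
  intro η hη hs i j
  rw [HasPartial.smear_eq ((hasStochGrad_iff θ).1 h i) (contDiff_partialDeriv hη) (hasCompactSupport_partialDeriv hs),
    HasPartial.smear_eq ((hasStochGrad_iff θ).1 h j) (contDiff_partialDeriv hη) (hasCompactSupport_partialDeriv hs),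
    partialDeriv_comm hη]

theorem isClosed_isCurlFree : IsClosed {Q : Lp (Euc d) 2 μ | IsCurlFree θ Q} := by
  simp only [IsCurlFree, ofPred_forall]
  refine isClosed_iInter fun η => isClosed_iInter fun hη => isClosed_iInter fun hs =>
    isClosed_iInter fun i => isClosed_iInter fun j => isClosed_eq ?_ ?_
  · exact (continuous_smear (contDiff_partialDeriv hη).continuous
      (hasCompactSupport_partialDeriv hs)).comp (component i).continuous
  · exact (continuous_smear (contDiff_partialDeriv hη).continuous
      (hasCompactSupport_partialDeriv hs)).comp (component j).continuous

theorem IsCurlFree.sub {Q Q' : Lp (Euc d) 2 μ} (h : IsCurlFree θ Q) (h' : IsCurlFree θ Q') :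
    IsCurlFree θ (Q - Q') := by
  intro η hη hs i j
  have hc := fun k : Fin d => (contDiff_partialDeriv (i := k) hη).continuous
  have hk := fun k : Fin d => hasCompactSupport_partialDeriv (i := k) hs
  rw [map_sub, map_sub, smear_sub (hc j) (hk j), smear_sub (hc i) (hk i), h η hη hs i j,
    h' η hη hs i j]

variable (μ) in
/-- The constant function `1`. -/
noncomputable def oneLp : Lp ℝ 2 μ :=
  indicatorConstLp 2 MeasurableSet.univ (measure_ne_top μ univ) (1 : ℝ)

theorem inner_oneLp (f : Lp ℝ 2 μ) : inner ℝ (oneLp μ) f = ∫ ω, f ω ∂μ := by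
  rw [oneLp, L2.inner_indicatorConstLp_one, Measure.restrict_univ]

theorem translate_oneLp (x : Euc d) : translate θ x (oneLp μ) = oneLp μ := by
  rw [oneLp, translate, Lp.indicatorConstLp_compMeasurePreserving]
  simp only [preimage_univ]

theorem hasPartial_oneLp (i : Fin d) : HasPartial θ i (oneLp μ) 0 := by
  have : Tendsto (fun _ : ℝ => (0 : Lp ℝ 2 μ)) (𝓝[>] 0) (𝓝 0) := tendsto_const_nhds
  refine this.congr fun t => ?_
  rw [translate_oneLp, sub_self, smul_zero]

theorem HasPartial.inner_oneLp {i : Fin d} {f f' : Lp ℝ 2 μ} (h : HasPartial θ i f f') :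
    inner ℝ (oneLp μ) f' = 0 := by
  rw [real_inner_comm, h.inner_eq_neg (hasPartial_oneLp i), inner_zero_right, neg_zero]

theorem inner_oneLp_smear {η : Euc d → ℝ} (hη : Continuous η) (hs : HasCompactSupport η)
    {f : Lp ℝ 2 μ} (h : inner ℝ (oneLp μ) f = 0) : inner ℝ (oneLp μ) (smear θ η f) = 0 := by
  rw [inner_smear hη hs]
  refine (integral_congr_ae (Eventually.of_forall fun x => ?_)).trans (integral_zero _ _)
  rw [real_inner_comm, inner_translate_left, translate_oneLp, real_inner_comm, h, mul_zero]

theorem translate_eq_of_hasPartial_zero {f : Lp ℝ 2 μ} (h : ∀ i, HasPartial θ i f 0) (x : Euc d) :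
    translate θ x f = f := by
  have h1 : ∀ i : Fin d, ∀ t : ℝ, 0 ≤ t → translate θ (EuclideanSpace.single i t) f = f :=
    fun i t ht => by
      have h2 := hasPartial_iff_integral.1 (h i) t ht
      have h3 : ∀ y, translate θ y (0 : Lp ℝ 2 μ) = 0 := fun y => map_zero (translateₗᵢ θ y)
      simp only [h3, intervalIntegral.integral_zero] at h2
      exact sub_eq_zero.1 h2
  have h2 : ∀ i : Fin d, ∀ t : ℝ, translate θ (EuclideanSpace.single i t) f = f := fun i t => by
    rcases le_total 0 t with ht | ht
    · exact h1 i t ht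
    · conv_lhs => rw [← h1 i (-t) (by linarith)]
      rw [translate_translate, ← single_add, add_neg_cancel]
      have e : (EuclideanSpace.single i (0 : ℝ) : Euc d) = 0 := by ext j; simp
      rw [e, translate_zero]
  have h3 : ∀ s : Finset (Fin d),
      translate θ (∑ i ∈ s, EuclideanSpace.single i (x i)) f = f := fun s => by
    classical
    induction s using Finset.induction_on with
    | empty => rw [Finset.sum_empty, translate_zero]
    | insert i s hi ih => rw [Finset.sum_insert hi, ← translate_translate, ih, h2]
  have e : x = ∑ i, EuclideanSpace.single i (x i) := by
    ext j
    simp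
  rw [e]
  exact h3 _

/-- A vanishing gradient forces translation invariance, ergodicity forces constancy, and the zero
mean fixes the constant. -/
theorem eq_zero_of_hasPartial_zero {f : Lp ℝ 2 μ} (h : ∀ i, HasPartial θ i f 0)
    (h0 : inner ℝ (oneLp μ) f = 0) : f = 0 := by
  obtain ⟨c, hc⟩ := ae_eq_const_of_translate_eq (translate_eq_of_hasPartial_zero h)
  rw [inner_oneLp, integral_congr_ae hc] at h0
  simp only [integral_const, probReal_univ, one_smul] at h0
  refine Lp.ext ?_
  filter_upwards [hc, Lp.coeFn_zero ℝ 2 μ] with ω h1 h2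
  rw [h1, h2, h0, Pi.zero_apply]

/-- Orthogonality to gradients is invariant under translations, hence stable under averaging over
translations. -/
theorem inner_smear_eq_zero {Q : Lp (Euc d) 2 μ}
    (h : ∀ ψ Ψ, HasStochGrad θ ψ Ψ → inner ℝ Ψ Q = 0) {η : Euc d → ℝ} (hη : Continuous η)
    (hs : HasCompactSupport η) {ψ : Lp ℝ 2 μ} {Ψ : Lp (Euc d) 2 μ} (hψ : HasStochGrad θ ψ Ψ) :
    ∑ i, inner ℝ (component i Ψ) (smear θ η (component i Q)) = 0 := by
  simp only [inner_smear hη hs]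
  rw [← integral_finsetSum]
  · refine (integral_congr_ae (Eventually.of_forall fun x => ?_)).trans (integral_zero _ _)
    rw [← Finset.mul_sum]
    have h1 : HasStochGrad θ (translate θ (-x) ψ)
        (ofComponents fun i => translate θ (-x) (component i Ψ)) :=
      (hasStochGrad_iff θ).2 fun i => by
        rw [component_ofComponents]; exact HasPartial.translate (-x) (hψ i)
    have h2 := h _ _ h1
    rw [inner_eq_sum_component] at h2
    simp only [component_ofComponents, inner_translate_left, neg_neg] at h2
    rw [h2, mul_zero]
  · intro i _
    have := (integrable_smear (θ := θ) hη hs (component i Q)).const_inner (𝕜 := ℝ) (component i Ψ)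
    simpa only [inner_smul_right] using this

/-- Weyl decomposition: a curl-free centered stationary field is a limit of stochastic gradients. -/
theorem IsCurlFree.mem_closure {F : Lp (Euc d) 2 μ} (hF : IsCurlFree θ F)
    (hF0 : ∀ i, inner ℝ (oneLp μ) (component i F) = 0) :
    F ∈ closure {Ψ | ∃ ψ, (ψ, Ψ) ∈ gradGraph θ} := by
  let R : Submodule ℝ (Lp (Euc d) 2 μ) := (gradGraph θ).map (LinearMap.snd ℝ _ _)
  have hR : ({Ψ | ∃ ψ, (ψ, Ψ) ∈ gradGraph θ} : Set (Lp (Euc d) 2 μ)) = R := by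
    ext Ψ; simp [R]
  let W := R.topologicalClosure
  have hW : IsClosed (W : Set (Lp (Euc d) 2 μ)) := R.isClosed_topologicalClosure
  have : CompleteSpace W := hW.completeSpace_coe
  have hWsub : ∀ S : Set (Lp (Euc d) 2 μ), IsClosed S →
      (∀ ψ Ψ, HasStochGrad θ ψ Ψ → Ψ ∈ S) → ∀ Q ∈ W, Q ∈ S := by
    intro S hS hS' Q hQ
    have : (W : Set (Lp (Euc d) 2 μ)) ⊆ S := by
      rw [Submodule.topologicalClosure_coe, ← hR]
      exact closure_minimal (fun Ψ ⟨ψ, hψ⟩ => hS' ψ Ψ hψ) hS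
    exact this hQ
  -- Q = F - P, with P the projection of F onto the closure of gradients, is curl-free, centered and
  -- orthogonal to gradients. Such a field has to vanish.
  set P : Lp (Euc d) 2 μ := W.starProjection F with hP
  have hPW : P ∈ W := W.starProjection_apply_mem F
  set Q := F - P with hQ
  have hQorth : ∀ ψ Ψ, HasStochGrad θ ψ Ψ → inner ℝ Ψ Q = 0 := fun ψ Ψ hψ => by
    have h1 : Q ∈ Wᗮ := W.sub_starProjection_mem_orthogonal F
    exact h1 Ψ (R.le_topologicalClosure ⟨(ψ, Ψ), hψ, rfl⟩)
  have hQcurl : IsCurlFree θ Q :=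
    hF.sub (hWsub _ isClosed_isCurlFree (fun ψ Ψ hψ => HasStochGrad.isCurlFree hψ) P hPW)
  have hQ0 : ∀ i, inner ℝ (oneLp μ) (component i Q) = 0 := fun i => by
    have h1 : IsClosed {Q : Lp (Euc d) 2 μ | inner ℝ (oneLp μ) (component i Q) = 0} :=
      isClosed_eq (continuous_const.inner (component i).continuous) continuous_const
    have h2 : inner ℝ (oneLp μ) (component i P) = 0 :=
      hWsub _ h1 (fun ψ Ψ hψ => HasPartial.inner_oneLp (hψ i)) P hPW
    rw [hQ, map_sub, inner_sub_right, hF0, h2, sub_zero]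
  have hsm : ∀ η : Euc d → ℝ, ContDiff ℝ (⊤ : ℕ∞) η → HasCompactSupport η → ∀ j,
      smear θ η (component j Q) = 0 := by
    intro η hη hs j
    have hη' := fun k : Fin d => contDiff_partialDeriv (i := k) hη
    have hs' := fun k : Fin d => hasCompactSupport_partialDeriv (i := k) hs
    -- The smoothed components of Q are harmonic. Testing orthogonality with the gradient of the
    -- smoothing of Q_j by ∂_jη, then integrating by parts and exchanging i and j by curl-freeness,
    -- yields the Dirichlet energy of the smoothed Q_j.
    have h1 : ∑ i, ‖smear θ (partialDeriv i η) (component j Q)‖ ^ 2 = 0 := by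
      have h2 := inner_smear_eq_zero hQorth hη.continuous hs
        (hasStochGrad_smear (hη' j) (hs' j) (component j Q))
      simp only [component_ofComponents] at h2
      rw [← h2]
      refine Finset.sum_congr rfl fun i _ => ?_
      rw [← real_inner_self_eq_norm_sq]
      conv_lhs => arg 3; rw [← hQcurl η hη hs i j]
      have h3 := (hasPartial_smear (hη' i) (hs' i) j (component j Q)).inner_eq_neg
        (hasPartial_smear (θ := θ) hη hs j (component i Q))
      rw [inner_neg_right, neg_neg] at h3
      rw [← h3, partialDeriv_comm hη]
    refine eq_zero_of_hasPartial_zero (θ := θ) (fun i => ?_)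
      (inner_oneLp_smear hη.continuous hs (hQ0 j))
    have h3 := (Finset.sum_eq_zero_iff_of_nonneg (fun i _ => sq_nonneg _)).1 h1 i
      (Finset.mem_univ i)
    have h4 : smear θ (partialDeriv i η) (component j Q) = 0 := by simpa using h3
    have h5 := hasPartial_smear (θ := θ) hη hs i (component j Q)
    rwa [h4, neg_zero] at h5
  have hQz : Q = 0 := component_ext fun j => by
    obtain ⟨η, hη, hs, hlim⟩ := exists_smear_tendsto θ
    have h1 := hlim (component j Q)
    simp only [hsm _ (hη _) (hs _)] at h1
    rw [map_zero]
    exact tendsto_nhds_unique h1 tendsto_const_nhds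
  have hFP : F = P := sub_eq_zero.1 hQz
  rw [hR, ← Submodule.topologicalClosure_coe, hFP]
  exact hPW

end Stationary

end StochHom

namespace StochHom

/-! ### Multiplication by the coefficient field. -/

section Coefficients

variable {d : ℕ} {Ω : Type u} [MeasurableSpace Ω] {μ : Measure Ω}
  {A : Ω → Matrix (Fin d) (Fin d) ℝ} {α β : ℝ}

theorem act_apply (M : Matrix (Fin d) (Fin d) ℝ) (v : Euc d) (i : Fin d) :
    act M v i = ∑ j, M i j * v j := by
  rw [act, Matrix.ofLp_toEuclideanCLM]; rfl

theorem act_add (M : Matrix (Fin d) (Fin d) ℝ) (v w : Euc d) :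
    act M (v + w) = act M v + act M w := map_add (Matrix.toEuclideanCLM (𝕜 := ℝ) M) v w

theorem act_smul (M : Matrix (Fin d) (Fin d) ℝ) (c : ℝ) (v : Euc d) :
    act M (c • v) = c • act M v := map_smul (Matrix.toEuclideanCLM (𝕜 := ℝ) M) c v

theorem inner_act (M : Matrix (Fin d) (Fin d) ℝ) (v w : Euc d) :
    inner ℝ v (act M w) = ∑ i, ∑ j, v i * w j * M i j := by
  rw [PiLp.inner_apply]
  refine Finset.sum_congr rfl fun i _ => ?_
  rw [act_apply]
  simp only [RCLike.inner_apply, conj_trivial, Finset.sum_mul]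
  exact Finset.sum_congr rfl fun j _ => by ring

theorem inner_act_comm {M : Matrix (Fin d) (Fin d) ℝ} (hM : M.IsSymm) (v w : Euc d) :
    inner ℝ v (act M w) = inner ℝ w (act M v) := by
  rw [inner_act, inner_act, Finset.sum_comm]
  refine Finset.sum_congr rfl fun i _ => Finset.sum_congr rfl fun j _ => ?_
  rw [hM.apply i j]; ring

theorem aestronglyMeasurable_act (hA : IsSymmetricCoefficient μ α β A) {F : Ω → Euc d}
    (hF : AEStronglyMeasurable F μ) : AEStronglyMeasurable (fun ω => act (A ω) (F ω)) μ := by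
  have h1 : AEMeasurable (fun ω => (fun i => ∑ j, A ω i j * F ω j : Fin d → ℝ)) μ := by
    refine aemeasurable_pi_lambda _ fun i => Finset.aemeasurable_fun_sum _ fun j _ => ?_
    refine (hA.aemeasurable i j).mul ?_
    exact (EuclideanSpace.proj j : Euc d →L[ℝ] ℝ).continuous.measurable.comp_aemeasurable
      hF.aemeasurable
  have h2 : AEMeasurable (fun ω => act (A ω) (F ω)) μ := by
    have h3 := (PiLp.continuous_toLp 2 (fun _ : Fin d => ℝ)).measurable.comp_aemeasurable h1
    refine h3.congr (Eventually.of_forall fun ω => ?_)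
    ext i
    simp only [Function.comp_apply, act_apply]
  exact h2.aestronglyMeasurable

theorem memLp_act (hA : IsSymmetricCoefficient μ α β A) {F : Ω → Euc d} (hF : MemLp F 2 μ) :
    MemLp (fun ω => act (A ω) (F ω)) 2 μ := by
  refine hF.of_le_mul (c := β) (aestronglyMeasurable_act hA hF.aestronglyMeasurable) ?_
  filter_upwards [hA.elliptic] with ω hω
  exact (hω (F ω)).2

/-- Multiplication by the coefficient field on `L²(Ω; ℝ^d)`. -/
noncomputable def coefficientOperator (hA : IsSymmetricCoefficient μ α β A) :
    Lp (Euc d) 2 μ →L[ℝ] Lp (Euc d) 2 μ :=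
  LinearMap.mkContinuous
    { toFun := fun F => (memLp_act hA (Lp.memLp F)).toLp _
      map_add' := fun F F' => by
        refine Lp.ext ?_
        filter_upwards [(memLp_act hA (Lp.memLp (F + F'))).coeFn_toLp,
          (memLp_act hA (Lp.memLp F)).coeFn_toLp, (memLp_act hA (Lp.memLp F')).coeFn_toLp,
          Lp.coeFn_add F F', Lp.coeFn_add ((memLp_act hA (Lp.memLp F)).toLp _)
            ((memLp_act hA (Lp.memLp F')).toLp _)] with ω h1 h2 h3 h4 h5
        rw [h1, h5, Pi.add_apply, h2, h3, h4, Pi.add_apply, act_add]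
      map_smul' := fun c F => by
        refine Lp.ext ?_
        filter_upwards [(memLp_act hA (Lp.memLp (c • F))).coeFn_toLp,
          (memLp_act hA (Lp.memLp F)).coeFn_toLp, Lp.coeFn_smul c F,
          Lp.coeFn_smul c ((memLp_act hA (Lp.memLp F)).toLp _)] with ω h1 h2 h4 h5
        rw [RingHom.id_apply, h1, h5, Pi.smul_apply, h2, h4, Pi.smul_apply, act_smul] } β
    (fun F => by
      refine Lp.norm_le_mul_norm_of_ae_le_mul ?_
      filter_upwards [(memLp_act hA (Lp.memLp F)).coeFn_toLp, hA.elliptic] with ω h1 hω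
      change ‖((memLp_act hA (Lp.memLp F)).toLp _ : Lp (Euc d) 2 μ) ω‖ ≤ _
      rw [h1]
      exact (hω (F ω)).2)

theorem coeFn_coefficientOperator (hA : IsSymmetricCoefficient μ α β A) (F : Lp (Euc d) 2 μ) :
    coefficientOperator hA F =ᵐ[μ] fun ω => act (A ω) (F ω) :=
  (memLp_act hA (Lp.memLp F)).coeFn_toLp

theorem inner_coefficientOperator (hA : IsSymmetricCoefficient μ α β A) {f g : Ω → Euc d}
    {F F' : Lp (Euc d) 2 μ} (hF : F =ᵐ[μ] f) (hF' : F' =ᵐ[μ] g) :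
    inner ℝ F (coefficientOperator hA F') = ∫ ω, inner ℝ (f ω) (act (A ω) (g ω)) ∂μ := by
  rw [L2.inner_def]
  refine integral_congr_ae ?_
  filter_upwards [coeFn_coefficientOperator hA F', hF, hF'] with ω h1 h2 h3
  rw [h1, h2, h3]

theorem norm_sq_eq_integral (F : Lp (Euc d) 2 μ) : ‖F‖ ^ 2 = ∫ ω, ‖F ω‖ ^ 2 ∂μ := by
  rw [← real_inner_self_eq_norm_sq, L2.inner_def]
  simp only [real_inner_self_eq_norm_sq]

theorem integrable_norm_sq (F : Lp (Euc d) 2 μ) : Integrable (fun ω => ‖F ω‖ ^ 2) μ := by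
  have := L2.integrable_inner (𝕜 := ℝ) F F
  simpa only [real_inner_self_eq_norm_sq] using this

theorem integrable_inner_act (hA : IsSymmetricCoefficient μ α β A) (F F' : Lp (Euc d) 2 μ) :
    Integrable (fun ω => (inner ℝ (F ω) (act (A ω) (F' ω)) : ℝ)) μ := by
  refine (L2.integrable_inner (𝕜 := ℝ) F (coefficientOperator hA F')).congr ?_
  filter_upwards [coeFn_coefficientOperator hA F'] with ω h1
  rw [h1]

theorem coefficientOperator_coercive (hA : IsSymmetricCoefficient μ α β A) (F : Lp (Euc d) 2 μ) :
    α * ‖F‖ ^ 2 ≤ inner ℝ F (coefficientOperator hA F) := by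
  rw [inner_coefficientOperator hA EventuallyEq.rfl EventuallyEq.rfl, norm_sq_eq_integral,
    ← integral_const_mul]
  refine integral_mono_ae ((integrable_norm_sq F).const_mul α) (integrable_inner_act hA F F) ?_
  filter_upwards [hA.elliptic] with ω hω
  exact (hω (F ω)).1

theorem inner_coefficientOperator_le (hA : IsSymmetricCoefficient μ α β A) (F : Lp (Euc d) 2 μ) :
    inner ℝ F (coefficientOperator hA F) ≤ β * ‖F‖ ^ 2 := by
  rw [inner_coefficientOperator hA EventuallyEq.rfl EventuallyEq.rfl, norm_sq_eq_integral,
    ← integral_const_mul]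
  refine integral_mono_ae (integrable_inner_act hA F F) ((integrable_norm_sq F).const_mul β) ?_
  filter_upwards [hA.elliptic] with ω hω
  have h1 := real_inner_le_norm (F ω) (act (A ω) (F ω))
  have h2 := mul_le_mul_of_nonneg_left (hω (F ω)).2 (norm_nonneg (F ω))
  linarith

theorem coefficientOperator_symm (hA : IsSymmetricCoefficient μ α β A) (F F' : Lp (Euc d) 2 μ) :
    inner ℝ F (coefficientOperator hA F') = inner ℝ F' (coefficientOperator hA F) := by
  rw [inner_coefficientOperator hA EventuallyEq.rfl EventuallyEq.rfl,
    inner_coefficientOperator hA EventuallyEq.rfl EventuallyEq.rfl]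
  refine integral_congr_ae ?_
  filter_upwards [hA.symmetric] with ω hω
  exact inner_act_comm hω _ _

theorem act_transposeField (hA : IsSymmetricCoefficient μ α β A) :
    ∀ᵐ ω ∂μ, transposeField A ω = A ω := by
  filter_upwards [hA.symmetric] with ω hω using hω

theorem IsSymmetricCoefficient.transposeField (hA : IsSymmetricCoefficient μ α β A) :
    IsSymmetricCoefficient μ α β (transposeField A) where
  aemeasurable i j := hA.aemeasurable j i
  elliptic := by
    filter_upwards [act_transposeField hA, hA.elliptic] with ω h1 h2
    rwa [h1]
  symmetric := by
    filter_upwards [act_transposeField hA, hA.symmetric] with ω h1 h2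
    rwa [h1]

theorem coefficientOperator_transposeField (hA : IsSymmetricCoefficient μ α β A) :
    coefficientOperator hA.transposeField = coefficientOperator hA := by
  ext1 F
  refine Lp.ext ?_
  filter_upwards [coeFn_coefficientOperator hA F, coeFn_coefficientOperator hA.transposeField F,
    act_transposeField hA] with ω h1 h2 h3
  rw [h1, h2, h3]

end Coefficients

/-! ### Weak formulations in L²(Ω) and linearity in the direction ξ. -/

section Weak

variable {d : ℕ} {Ω : Type u} [MeasurableSpace Ω] {μ : Measure Ω} [IsProbabilityMeasure μ]
  {θ : ErgodicTranslationGroup d μ} {A : Ω → Matrix (Fin d) (Fin d) ℝ} {α β : ℝ}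

theorem inner_eq_integral_mul (f g : Lp ℝ 2 μ) : inner ℝ f g = ∫ ω, f ω * g ω ∂μ := by
  rw [L2.inner_def]
  refine integral_congr_ae (Eventually.of_forall fun ω => ?_)
  simp [mul_comm]

/-- Replaces the chosen gradient by arbitrary pairs of the graph, so that the abstract form results
apply. -/
theorem forall_gradDomain_iff {p : Lp ℝ 2 μ → Lp (Euc d) 2 μ → Prop} :
    (∀ ψ ∈ gradDomain θ, p ψ (stochGrad θ ψ)) ↔ ∀ ψ Ψ, (ψ, Ψ) ∈ gradGraph θ → p ψ Ψ := by
  constructor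
  · intro h ψ Ψ hψ
    have := h ψ ⟨Ψ, hψ⟩
    rwa [stochGrad_eq hψ] at this
  · intro h ψ hψ
    exact h ψ _ (hasStochGrad_stochGrad hψ)

theorem ellipticGraph_eq_formGraph (hA : IsSymmetricCoefficient μ α β A) :
    ellipticGraph θ A = formGraph (gradGraph θ) (coefficientOperator hA) := by
  ext ⟨u, f⟩
  have key : ∀ U, (∀ ψ ∈ gradDomain θ, ∫ ω, inner ℝ (stochGrad θ ψ ω) (act (A ω) (U ω)) ∂μ =
      ∫ ω, ψ ω * f ω ∂μ) ↔ ∀ ψ Ψ, (ψ, Ψ) ∈ gradGraph θ →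
        inner ℝ Ψ (coefficientOperator hA U) = inner ℝ ψ f := fun U => by
    rw [← forall_gradDomain_iff]
    refine forall_congr' fun ψ => forall_congr' fun _ => ?_
    rw [inner_coefficientOperator hA EventuallyEq.rfl EventuallyEq.rfl, inner_eq_integral_mul]
  constructor
  · rintro ⟨hu, h⟩
    exact ⟨_, hasStochGrad_stochGrad hu, (key _).1 h⟩
  · rintro ⟨U, hU, h⟩
    refine ⟨⟨U, hU⟩, ?_⟩
    simp only
    rw [stochGrad_eq hU]
    exact (key U).2 h

variable (μ) in
/-- The constant field `ξ`. -/
noncomputable def constField (ξ : Euc d) : Lp (Euc d) 2 μ := (memLp_const ξ).toLp _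

theorem coeFn_constField (ξ : Euc d) : constField μ ξ =ᵐ[μ] fun _ => ξ :=
  (memLp_const ξ).coeFn_toLp

theorem constField_eq_sum (ξ : Euc d) :
    constField μ ξ = ∑ i, ξ i • constField μ (EuclideanSpace.single i 1) := by
  have h : ∀ s : Finset (Fin d), constField μ (∑ i ∈ s, ξ i • EuclideanSpace.single i (1 : ℝ)) =
      ∑ i ∈ s, ξ i • constField μ (EuclideanSpace.single i 1) := fun s => by
    classical
    induction s using Finset.induction_on with
    | empty =>
      refine Lp.ext ?_
      filter_upwards [coeFn_constField (μ := μ) (0 : Euc d), Lp.coeFn_zero (Euc d) 2 μ] with ω h1 h2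
      rw [Finset.sum_empty, Finset.sum_empty, h1, h2, Pi.zero_apply]
    | insert i s hi ih =>
      rw [Finset.sum_insert hi, Finset.sum_insert hi, ← ih]
      rfl
  have e : ξ = ∑ i, ξ i • EuclideanSpace.single i (1 : ℝ) := by
    ext j; simp [Pi.single_apply]
  conv_lhs => rw [e]
  exact h _

theorem exists_isResolventAtOne (hα : 0 < α) (hA : IsSymmetricCoefficient μ α β A) (ξ : Euc d) :
    ∃ w, IsResolventAtOne θ A (localDrift θ A ξ) w := by
  obtain ⟨w, W, hw, h⟩ := exists_form_solution (isClosed_gradGraph (θ := θ)) hα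
    (coefficientOperator_coercive hA) one_pos 0 (-coefficientOperator hA (constField μ ξ))
  refine ⟨w, ⟨W, hw⟩, ?_⟩
  rw [stochGrad_eq hw]
  refine (forall_gradDomain_iff (p := fun ψ Ψ => ∫ ω, ψ ω * w ω ∂μ +
    ∫ ω, inner ℝ (Ψ ω) (act (A ω) (W ω)) ∂μ = - ∫ ω, inner ℝ (Ψ ω) (act (A ω) ξ) ∂μ)).2 ?_
  intro ψ Ψ hψ
  have := h ψ Ψ hψ
  rwa [inner_coefficientOperator hA EventuallyEq.rfl EventuallyEq.rfl, inner_eq_integral_mul,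
    inner_zero_right, zero_add, inner_neg_right,
    inner_coefficientOperator hA EventuallyEq.rfl (coeFn_constField ξ), one_mul] at this

theorem IsResolventAtOne.weak_formulation (hA : IsSymmetricCoefficient μ α β A) {ξ : Euc d}
    {w : Lp ℝ 2 μ} (h : IsResolventAtOne θ A (localDrift θ A ξ) w) :
    ∃ W, (w, W) ∈ gradGraph θ ∧ ∀ ψ Ψ, (ψ, Ψ) ∈ gradGraph θ →
      inner ℝ ψ w + inner ℝ Ψ (coefficientOperator hA W) =
        inner ℝ Ψ (-coefficientOperator hA (constField μ ξ)) := by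
  refine ⟨_, hasStochGrad_stochGrad h.1, ?_⟩
  have h2 := (forall_gradDomain_iff (p := fun ψ Ψ => ∫ ω, ψ ω * w ω ∂μ +
    ∫ ω, inner ℝ (Ψ ω) (act (A ω) (stochGrad θ w ω)) ∂μ =
      - ∫ ω, inner ℝ (Ψ ω) (act (A ω) ξ) ∂μ)).1 h.2
  intro ψ Ψ hψ
  rw [inner_coefficientOperator hA EventuallyEq.rfl EventuallyEq.rfl, inner_eq_integral_mul,
    inner_neg_right, inner_coefficientOperator hA EventuallyEq.rfl (coeFn_constField ξ)]
  exact h2 ψ Ψ hψ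

theorem integral_regularized (hA : IsSymmetricCoefficient μ α β A) (ξ : Euc d) (T : ℝ)
    (u ψ : Lp ℝ 2 μ) (U Ψ : Lp (Euc d) 2 μ) :
    ∫ ω, (T⁻¹ * u ω * ψ ω + inner ℝ (Ψ ω) (act (A ω) (ξ + U ω))) ∂μ =
      T⁻¹ * inner ℝ ψ u + inner ℝ Ψ (coefficientOperator hA (constField μ ξ + U)) := by
  have e : (constField μ ξ + U : Lp (Euc d) 2 μ) =ᵐ[μ] fun ω => ξ + U ω := by
    filter_upwards [Lp.coeFn_add (constField μ ξ) U, coeFn_constField (μ := μ) ξ] with ω h1 h2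
    rw [h1, Pi.add_apply, h2]
  have i1 : Integrable (fun ω => T⁻¹ * u ω * ψ ω) μ := by
    have := (L2.integrable_inner (𝕜 := ℝ) ψ u).const_mul T⁻¹
    refine this.congr (Eventually.of_forall fun ω => ?_)
    simp [mul_assoc]
  have i2 : Integrable (fun ω => (inner ℝ (Ψ ω) (act (A ω) (ξ + U ω)) : ℝ)) μ := by
    refine (integrable_inner_act hA Ψ (constField μ ξ + U)).congr ?_
    filter_upwards [e] with ω h1
    rw [h1]
  rw [integral_add i1 i2, inner_coefficientOperator hA EventuallyEq.rfl e,
    inner_eq_integral_mul, ← integral_const_mul]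
  congr 1
  exact integral_congr_ae (Eventually.of_forall fun ω => by simp only; ring)

theorem isRegularizedCorrector_iff (hA : IsSymmetricCoefficient μ α β A) {ξ : Euc d} {T : ℝ}
    {u : Lp ℝ 2 μ} : IsRegularizedCorrector θ A ξ T u ↔ u ∈ gradDomain θ ∧
      ∀ ψ Ψ, (ψ, Ψ) ∈ gradGraph θ → T⁻¹ * inner ℝ ψ u +
        inner ℝ Ψ (coefficientOperator hA (stochGrad θ u)) =
          inner ℝ Ψ (-coefficientOperator hA (constField μ ξ)) := by
  refine and_congr_right fun _ => ?_
  refine (forall_gradDomain_iff (p := fun ψ Ψ => ∫ ω, (T⁻¹ * u ω * ψ ω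
      + inner ℝ (Ψ ω) (act (A ω) (ξ + stochGrad θ u ω))) ∂μ = 0)).trans ?_
  refine forall_congr' fun ψ => forall_congr' fun Ψ => forall_congr' fun _ => ?_
  rw [integral_regularized hA, map_add, inner_add_right, inner_neg_right]
  constructor <;> intro h <;> linarith

theorem exists_isRegularizedCorrector (hα : 0 < α) (hA : IsSymmetricCoefficient μ α β A) (ξ : Euc d)
    {T : ℝ} (hT : 0 < T) : ∃ u, IsRegularizedCorrector θ A ξ T u := by
  obtain ⟨u, U, hu, h⟩ := exists_form_solution (isClosed_gradGraph (θ := θ)) hα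
    (coefficientOperator_coercive hA) (inv_pos.2 hT) 0
    (-coefficientOperator hA (constField μ ξ))
  refine ⟨u, (isRegularizedCorrector_iff hA).2 ⟨⟨U, hu⟩, fun ψ Ψ hψ => ?_⟩⟩
  rw [stochGrad_eq hu, h ψ Ψ hψ, inner_zero_right, zero_add]

theorem isRegularizedCorrector_regularizedCorrector (hα : 0 < α)
    (hA : IsSymmetricCoefficient μ α β A) (ξ : Euc d) {T : ℝ} (hT : 0 < T) :
    IsRegularizedCorrector θ A ξ T (regularizedCorrector θ A ξ T) :=
  Classical.epsilon_spec (exists_isRegularizedCorrector hα hA ξ hT)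

theorem regularizedCorrector_transposeField (hA : IsSymmetricCoefficient μ α β A) (ξ : Euc d)
    (T : ℝ) : regularizedCorrector θ (transposeField A) ξ T = regularizedCorrector θ A ξ T := by
  unfold regularizedCorrector
  -- The two defining predicates coincide, so the same solution is selected for both fields.
  congr 1
  ext u
  rw [isRegularizedCorrector_iff hA, isRegularizedCorrector_iff hA.transposeField,
    coefficientOperator_transposeField]

theorem extrapolatedGradient_transposeField (hA : IsSymmetricCoefficient μ α β A) (ξ : Euc d)
    (T : ℝ) (k : ℕ) :
    extrapolatedGradient θ (transposeField A) ξ T k = extrapolatedGradient θ A ξ T k := by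
  unfold extrapolatedGradient
  rw [show regularizedCorrector θ (transposeField A) ξ = regularizedCorrector θ A ξ from
    funext fun T => regularizedCorrector_transposeField hA ξ T]

theorem extrapolatedGradient_eq_richardson (hα : 0 < α) (hA : IsSymmetricCoefficient μ α β A)
    (ξ : Euc d) {T : ℝ} (hT : 0 < T) (n : ℕ) :
    extrapolatedGradient θ A ξ T (n + 1) =
      richardson (fun S => stochGrad θ (regularizedCorrector θ A ξ S)) (n + 1) T := by
  have hm : ∀ S, 0 < S → (regularizedCorrector θ A ξ S,
      stochGrad θ (regularizedCorrector θ A ξ S)) ∈ gradGraph θ := fun S hS =>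
    hasStochGrad_stochGrad (isRegularizedCorrector_regularizedCorrector hα hA ξ hS).1
  have h := richardson_pair_mem hm n hT
  unfold extrapolatedGradient
  exact stochGrad_eq h

/-- The right side is linear in ξ and solutions are unique. This is needed because the effective
matrices are defined through the basis directions only. -/
theorem stochGrad_regularizedCorrector_eq_sum (hα : 0 < α) (hA : IsSymmetricCoefficient μ α β A)
    (ξ : Euc d) {T : ℝ} (hT : 0 < T) :
    stochGrad θ (regularizedCorrector θ A ξ T) =
      ∑ i, ξ i • stochGrad θ (regularizedCorrector θ A (EuclideanSpace.single i 1) T) := by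
  have h := fun ζ => (isRegularizedCorrector_iff hA).1
    (isRegularizedCorrector_regularizedCorrector (θ := θ) hα hA ζ hT)
  have hm : ∀ ζ, (regularizedCorrector θ A ζ T, stochGrad θ (regularizedCorrector θ A ζ T)) ∈
      gradGraph θ := fun ζ => hasStochGrad_stochGrad (h ζ).1
  have hs := (gradGraph θ).sum_mem (t := Finset.univ) fun i _ =>
    (gradGraph θ).smul_mem (ξ i) (hm (EuclideanSpace.single i 1))
  have e : ∑ i, ξ i • (regularizedCorrector θ A (EuclideanSpace.single i 1) T,
      stochGrad θ (regularizedCorrector θ A (EuclideanSpace.single i 1) T)) =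
      (∑ i, ξ i • regularizedCorrector θ A (EuclideanSpace.single i 1) T,
        ∑ i, ξ i • stochGrad θ (regularizedCorrector θ A (EuclideanSpace.single i 1) T)) :=
    Prod.ext (by simp only [Prod.fst_sum, Prod.smul_fst])
      (by simp only [Prod.snd_sum, Prod.smul_snd])
  rw [e] at hs
  refine (form_solution_unique (𝒢 := gradGraph θ) hα (coefficientOperator_coercive hA)
    (inv_pos.2 hT) (hm ξ) hs (h ξ).2 fun ψ Ψ hψ => ?_).2
  rw [constField_eq_sum ξ]
  simp only [map_sum, map_smul, inner_sum, inner_smul_right, inner_neg_right, Finset.mul_sum]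
  rw [← Finset.sum_add_distrib, ← Finset.sum_neg_distrib]
  refine Finset.sum_congr rfl fun i _ => ?_
  have := (h (EuclideanSpace.single i 1)).2 ψ Ψ hψ
  rw [inner_neg_right] at this
  linear_combination (ξ i) * this

theorem extrapolatedGradient_eq_sum (hα : 0 < α) (hA : IsSymmetricCoefficient μ α β A)
    (ξ : Euc d) {T : ℝ} (hT : 0 < T) (n : ℕ) :
    extrapolatedGradient θ A ξ T (n + 1) =
      ∑ i, ξ i • extrapolatedGradient θ A (EuclideanSpace.single i 1) T (n + 1) := by
  simp only [extrapolatedGradient_eq_richardson hα hA _ hT]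
  rw [← richardson_sum]
  exact richardson_congr (fun S hS => stochGrad_regularizedCorrector_eq_sum hα hA ξ hS) n hT

end Weak

/-! ### From the corrector equation on ℝ^d to an equation in L²(Ω). -/

section Corrector

variable {d : ℕ} {Ω : Type u} [MeasurableSpace Ω] {μ : Measure Ω} [IsProbabilityMeasure μ]
  {θ : ErgodicTranslationGroup d μ} {A : Ω → Matrix (Fin d) (Fin d) ℝ} {α β : ℝ}
  {ξ : Euc d} {φ : Euc d → Ω → ℝ} {Φ : Ω → Euc d}

theorem memLp_coordinate {q : Ω → Euc d} (hq : MemLp q 2 μ) (i : Fin d) :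
    MemLp (fun ω => q ω i) 2 μ :=
  (EuclideanSpace.proj i : Euc d →L[ℝ] ℝ).comp_memLp' hq

theorem component_toLp {q : Ω → Euc d} (hq : MemLp q 2 μ) (i : Fin d) :
    component i (hq.toLp q) = (memLp_coordinate hq i).toLp _ := by
  refine Lp.ext ?_
  filter_upwards [coeFn_component i (hq.toLp q), hq.coeFn_toLp,
    (memLp_coordinate hq i).coeFn_toLp] with ω h1 h2 h3
  rw [h1, h2, h3]

/-- Test the weak gradient identity with ∂_jη for component i and with ∂_iη for component j: the
integrals of φ against the mixed second derivative agree. -/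
theorem IsCorrector.isCurlFree (h : IsCorrector θ A ξ φ Φ) :
    IsCurlFree θ (h.gradient_memLp.toLp Φ) := by
  intro η hη hs i j
  have hη' := fun k : Fin d => contDiff_partialDeriv (i := k) hη
  have hs' := fun k : Fin d => hasCompactSupport_partialDeriv (i := k) hs
  rw [component_toLp, component_toLp]
  refine Lp.ext ?_
  filter_upwards [coeFn_smear (θ := θ) (hη' j).continuous (hs' j)
      (memLp_coordinate h.gradient_memLp i),
    coeFn_smear (θ := θ) (hη' i).continuous (hs' i) (memLp_coordinate h.gradient_memLp j),
    h.weak_gradient] with ω h1 h2 h3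
  have h4 := h3 _ (hη' j) (hs' j) i
  have h5 := h3 _ (hη' i) (hs' i) j
  simp only [gradient_apply] at h4 h5
  rw [partialDeriv_comm hη, h5, neg_inj] at h4
  rw [h1, h2]
  simp only [mul_comm (partialDeriv _ _ _)]
  exact h4.symm

theorem IsCorrector.mem_closure (h : IsCorrector θ A ξ φ Φ) :
    h.gradient_memLp.toLp Φ ∈ closure {Ψ | ∃ ψ, (ψ, Ψ) ∈ gradGraph θ} := by
  refine h.isCurlFree.mem_closure fun i => ?_
  have h1 : Integrable Φ μ := h.gradient_memLp.integrable (by norm_num)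
  rw [inner_oneLp, component_toLp, integral_congr_ae (memLp_coordinate h.gradient_memLp i).coeFn_toLp]
  have h2 := (EuclideanSpace.proj i : Euc d →L[ℝ] ℝ).integral_comp_comm h1
  rw [h.gradient_mean, map_zero] at h2
  exact h2

/-- Almost surely the distributional divergence tested against η is the pointwise value of the
smoothed divergence, so the equation along realizations becomes the smoothed equation in L²(Ω). -/
theorem inner_eq_zero_of_ae_divergence_free {q : Ω → Euc d} (hq : MemLp q 2 μ)
    (h : ∀ᵐ ω ∂μ, ∀ η : Euc d → ℝ, ContDiff ℝ (⊤ : ℕ∞) η → HasCompactSupport η →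
      ∫ x, (inner ℝ (gradient η x) (q (θ.shift x ω)) : ℝ) = 0)
    {ψ : Lp ℝ 2 μ} {Ψ : Lp (Euc d) 2 μ} (hψ : HasStochGrad θ ψ Ψ) :
    inner ℝ Ψ (hq.toLp q) = 0 := by
  refine inner_eq_zero_of_smear_divergence (θ := θ) (fun η hη hs => ?_) hψ
  have hη' := fun k : Fin d => (contDiff_partialDeriv (i := k) hη).continuous
  have hs' := fun k : Fin d => hasCompactSupport_partialDeriv (i := k) hs
  simp only [component_toLp]
  refine Lp.ext ?_
  have h1 : ∀ᵐ ω ∂μ, ∀ i, smear θ (partialDeriv i η) ((memLp_coordinate hq i).toLp _) ω =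
      ∫ x, partialDeriv i η x * q (θ.shift x ω) i :=
    ae_all_iff.2 fun i => coeFn_smear (hη' i) (hs' i) (memLp_coordinate hq i)
  have h2 : ∀ᵐ ω ∂μ, ∀ i, Integrable (fun x => partialDeriv i η x * q (θ.shift x ω) i)
      (volume : Measure (Euc d)) :=
    ae_all_iff.2 fun i => ae_integrable_shift (hη' i) (hs' i) (memLp_coordinate hq i)
  filter_upwards [Lp.coeFn_finsetSum Finset.univ
    (fun i => smear θ (partialDeriv i η) ((memLp_coordinate hq i).toLp _)), h1, h2, h,
    Lp.coeFn_zero ℝ 2 μ] with ω g1 g2 g3 g4 g5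
  rw [g1, g5, Finset.sum_apply, Pi.zero_apply]
  simp only [g2]
  rw [← integral_finsetSum _ fun i _ => g3 i, ← g4 η hη hs]
  refine integral_congr_ae (Eventually.of_forall fun x => ?_)
  simp only [PiLp.inner_apply, gradient_apply]
  refine Finset.sum_congr rfl fun i _ => ?_
  simp [mul_comm]

theorem IsCorrector.weak_formulation (hA : IsSymmetricCoefficient μ α β A)
    (h : IsCorrector θ A ξ φ Φ) (ψ : Lp ℝ 2 μ) (Ψ : Lp (Euc d) 2 μ) (hψ : (ψ, Ψ) ∈ gradGraph θ) :
    inner ℝ Ψ (coefficientOperator hA (constField μ ξ + h.gradient_memLp.toLp Φ)) = 0 := by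
  have hqm : MemLp (fun ω => act (A ω) (ξ + Φ ω)) 2 μ :=
    memLp_act hA ((memLp_const ξ).add h.gradient_memLp)
  have e : coefficientOperator hA (constField μ ξ + h.gradient_memLp.toLp Φ) = hqm.toLp _ := by
    refine Lp.ext ?_
    filter_upwards [coeFn_coefficientOperator hA (constField μ ξ + h.gradient_memLp.toLp Φ),
      Lp.coeFn_add (constField μ ξ) (h.gradient_memLp.toLp Φ), coeFn_constField (μ := μ) ξ,
      h.gradient_memLp.coeFn_toLp, hqm.coeFn_toLp] with ω h1 h2 h3 h4 h5
    rw [h1, h5, h2, Pi.add_apply, h3, h4]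
  rw [e]
  exact inner_eq_zero_of_ae_divergence_free hqm h.equation hψ

theorem inner_eq_zero_of_mem_closure {R : Set (Lp (Euc d) 2 μ)} {Q e : Lp (Euc d) 2 μ}
    (h : ∀ Ψ ∈ R, inner ℝ Ψ Q = 0) (he : e ∈ closure R) : inner ℝ e Q = 0 := by
  have h1 : IsClosed {e : Lp (Euc d) 2 μ | inner ℝ e Q = 0} :=
    isClosed_eq (continuous_id.inner continuous_const) continuous_const
  exact closure_minimal (fun Ψ hΨ => h Ψ hΨ) h1 he

/-- The limits of stochastic gradients form a closed subspace. -/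
theorem closure_gradient_eq :
    closure {Ψ | ∃ ψ, (ψ, Ψ) ∈ gradGraph θ} =
      (((gradGraph θ).map (LinearMap.snd ℝ _ _)).topologicalClosure : Set (Lp (Euc d) 2 μ)) := by
  rw [Submodule.topologicalClosure_coe]
  congr 1
  ext Ψ; simp

/-- The difference of two solutions is itself an admissible limit of test gradients; coercivity
concludes. -/
theorem corrector_unique (hα : 0 < α) (hA : IsSymmetricCoefficient μ α β A)
    {X F F' : Lp (Euc d) 2 μ} (hF : F ∈ closure {Ψ | ∃ ψ, (ψ, Ψ) ∈ gradGraph θ})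
    (hF' : F' ∈ closure {Ψ | ∃ ψ, (ψ, Ψ) ∈ gradGraph θ})
    (h : ∀ ψ Ψ, (ψ, Ψ) ∈ gradGraph θ → inner ℝ Ψ (coefficientOperator hA (X + F)) = 0)
    (h' : ∀ ψ Ψ, (ψ, Ψ) ∈ gradGraph θ → inner ℝ Ψ (coefficientOperator hA (X + F')) = 0) :
    F = F' := by
  have h1 : inner ℝ (F - F') (coefficientOperator hA (F - F')) = 0 := by
    refine inner_eq_zero_of_mem_closure (R := {Ψ | ∃ ψ, (ψ, Ψ) ∈ gradGraph θ}) ?_ ?_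
    · rintro Ψ ⟨ψ, hψ⟩
      have e : F - F' = (X + F) - (X + F') := by abel
      rw [e, map_sub, inner_sub_right, h ψ Ψ hψ, h' ψ Ψ hψ, sub_zero]
    · rw [closure_gradient_eq] at *
      exact Submodule.sub_mem _ hF hF'
  have h2 := coefficientOperator_coercive hA (F - F')
  rw [h1] at h2
  have h3 : ‖F - F'‖ ^ 2 = 0 := by nlinarith [sq_nonneg ‖F - F'‖]
  exact sub_eq_zero.1 (by simpa using h3)

end Corrector

end StochHom

namespace StochHom

/-! ### Effective matrices and the identity between matrix error and energy. -/

section Effective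

variable {d : ℕ} {Ω : Type u} [MeasurableSpace Ω] {μ : Measure Ω} [IsProbabilityMeasure μ]
  {θ : ErgodicTranslationGroup d μ} {A : Ω → Matrix (Fin d) (Fin d) ℝ} {α β : ℝ}
  {φ φ' : Euc d → Euc d → Ω → ℝ} {Φ Φ' : Euc d → Ω → Euc d}
  {G : ResolutionOfIdentity (Lp ℝ 2 μ)}

theorem driftIntegral_bounds (hα : 0 < α) (hA : IsSymmetricCoefficient μ α β A)
    (hG : G.IsSpectralResolutionOf (ellipticGraph θ A)) {ξ : Euc d} {F : Lp (Euc d) 2 μ}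
    (hFm : F ∈ closure {Ψ | ∃ ψ, (ψ, Ψ) ∈ gradGraph θ})
    (hF : ∀ ψ Ψ, (ψ, Ψ) ∈ gradGraph θ →
      inner ℝ Ψ (coefficientOperator hA (constField μ ξ + F)) = 0)
    {T : ℝ} (hT : 0 < T) {k : ℕ} (hk : 1 ≤ k) :
    ENNReal.ofReal (extrapolationConstant k) * driftIntegral θ A G ξ T k ≤
        ENNReal.ofReal (inner ℝ (F - extrapolatedGradient θ A ξ T k)
          (coefficientOperator hA (F - extrapolatedGradient θ A ξ T k))) ∧
      ENNReal.ofReal (inner ℝ (F - extrapolatedGradient θ A ξ T k)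
          (coefficientOperator hA (F - extrapolatedGradient θ A ξ T k))) ≤
        driftIntegral θ A G ξ T k := by
  have hw := Classical.epsilon_spec (exists_isResolventAtOne (θ := θ) hα hA ξ)
  unfold driftIntegral driftMeasure
  -- Only the equation satisfied by the selected w matters.
  generalize Classical.epsilon (IsResolventAtOne θ A (localDrift θ A ξ)) = w at hw ⊢
  obtain ⟨W, hW, hW'⟩ := hw.weak_formulation hA
  have hr := fun (S : ℝ) (hS : 0 < S) => (isRegularizedCorrector_iff hA).1
    (isRegularizedCorrector_regularizedCorrector (θ := θ) hα hA ξ hS)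
  have hm : ∀ S, 0 < S → (regularizedCorrector θ A ξ S,
      stochGrad θ (regularizedCorrector θ A ξ S)) ∈ gradGraph θ :=
    fun S hS => hasStochGrad_stochGrad (hr S hS).1
  have hF' : ∀ ψ Ψ, (ψ, Ψ) ∈ gradGraph θ →
      inner ℝ Ψ (coefficientOperator hA F) =
        inner ℝ Ψ (-coefficientOperator hA (constField μ ξ)) := fun ψ Ψ hψ => by
    have := hF ψ Ψ hψ
    rw [map_add, inner_add_right] at this
    rw [inner_neg_right]
    linarith
  have hG' : formGraph (gradGraph θ) (coefficientOperator hA) = G.integralGraph := by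
    rw [← ellipticGraph_eq_formGraph hA]; exact hG
  obtain ⟨n, rfl⟩ : ∃ n, k = n + 1 := ⟨k - 1, by omega⟩
  rw [extrapolatedGradient_eq_richardson hα hA ξ hT]
  exact extrapolation_energy_bounds (𝒢 := gradGraph θ) (a := coefficientOperator hA)
    (p := fun S => regularizedCorrector θ A ξ S)
    (P := fun S => stochGrad θ (regularizedCorrector θ A ξ S))
    (b := -coefficientOperator hA (constField μ ξ)) (F := F) isClosed_gradGraph hG' hα
    (coefficientOperator_coercive hA) (coefficientOperator_symm hA) hW hW' hm
    (fun S hS => (hr S hS).2) hFm hF' hk hT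

theorem effectiveMatrix_apply (hA : IsSymmetricCoefficient μ α β A) {Y Y' : Fin d → Lp (Euc d) 2 μ}
    (hY : ∀ i, Y i =ᵐ[μ] fun ω => EuclideanSpace.single i 1 + Φ (EuclideanSpace.single i 1) ω)
    (hY' : ∀ i, Y' i =ᵐ[μ] fun ω => EuclideanSpace.single i 1 + Φ' (EuclideanSpace.single i 1) ω)
    (i j : Fin d) :
    effectiveMatrix μ A Φ Φ' i j = inner ℝ (Y' i) (coefficientOperator hA (Y j)) := by
  rw [inner_coefficientOperator hA (hY' i) (hY j)]
  rfl

theorem constField_add_ae {ξ : Euc d} {F : Lp (Euc d) 2 μ} {f : Ω → Euc d} (h : F =ᵐ[μ] f) :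
    (constField μ ξ + F : Lp (Euc d) 2 μ) =ᵐ[μ] fun ω => ξ + f ω := by
  filter_upwards [Lp.coeFn_add (constField μ ξ) F, coeFn_constField (μ := μ) ξ, h] with ω h1 h2 h3
  rw [h1, Pi.add_apply, h2, h3]

theorem approxMatrix_apply (hA : IsSymmetricCoefficient μ α β A) (T : ℝ) (k : ℕ) (i j : Fin d) :
    approxMatrix θ A T k i j = inner ℝ
      (constField μ (EuclideanSpace.single i 1) +
        extrapolatedGradient θ A (EuclideanSpace.single i 1) T k)
      (coefficientOperator hA (constField μ (EuclideanSpace.single j 1) +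
        extrapolatedGradient θ A (EuclideanSpace.single j 1) T k)) := by
  refine effectiveMatrix_apply (Y := fun i => constField μ (EuclideanSpace.single i 1) +
        extrapolatedGradient θ A (EuclideanSpace.single i 1) T k)
      (Y' := fun i => constField μ (EuclideanSpace.single i 1) +
        extrapolatedGradient θ A (EuclideanSpace.single i 1) T k) hA (fun i => ?_) (fun i => ?_) i j
  · exact constField_add_ae EventuallyEq.rfl
  · rw [extrapolatedGradient_transposeField hA]
    exact constField_add_ae EventuallyEq.rfl

/-- By symmetry of the coefficients both gradients solve the same equation, and uniqueness
identifies them. -/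
theorem corrector_transposeField (hα : 0 < α) (hA : IsSymmetricCoefficient μ α β A) {ξ : Euc d}
    {φ φ' : Euc d → Ω → ℝ} {Φ Φ' : Ω → Euc d} (h : IsCorrector θ A ξ φ Φ)
    (h' : IsCorrector θ (transposeField A) ξ φ' Φ') :
    h'.gradient_memLp.toLp Φ' = h.gradient_memLp.toLp Φ := by
  refine corrector_unique hα hA h'.mem_closure h.mem_closure ?_ (h.weak_formulation hA)
  rw [← coefficientOperator_transposeField hA]
  exact h'.weak_formulation hA.transposeField

theorem homogenizedMatrix_apply (hα : 0 < α) (hA : IsSymmetricCoefficient μ α β A)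
    (h : ∀ ξ, IsCorrector θ A ξ (φ ξ) (Φ ξ))
    (h' : ∀ ξ, IsCorrector θ (transposeField A) ξ (φ' ξ) (Φ' ξ)) (i j : Fin d) :
    effectiveMatrix μ A Φ Φ' i j = inner ℝ
      (constField μ (EuclideanSpace.single i 1) +
        (h (EuclideanSpace.single i 1)).gradient_memLp.toLp _)
      (coefficientOperator hA (constField μ (EuclideanSpace.single j 1) +
        (h (EuclideanSpace.single j 1)).gradient_memLp.toLp _)) := by
  refine effectiveMatrix_apply (Y := fun i => constField μ (EuclideanSpace.single i 1) +
        (h (EuclideanSpace.single i 1)).gradient_memLp.toLp _)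
      (Y' := fun i => constField μ (EuclideanSpace.single i 1) +
        (h (EuclideanSpace.single i 1)).gradient_memLp.toLp _) hA (fun i => ?_) (fun i => ?_) i j
  · exact constField_add_ae (MemLp.coeFn_toLp _)
  · rw [← corrector_transposeField hα hA (h _) (h' _)]
    exact constField_add_ae (MemLp.coeFn_toLp _)

theorem corrector_eq_sum (hα : 0 < α) (hA : IsSymmetricCoefficient μ α β A)
    (h : ∀ ξ, IsCorrector θ A ξ (φ ξ) (Φ ξ)) (ξ : Euc d) :
    (h ξ).gradient_memLp.toLp _ =
      ∑ i, ξ i • (h (EuclideanSpace.single i 1)).gradient_memLp.toLp _ := by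
  refine corrector_unique hα hA (h ξ).mem_closure ?_ ((h ξ).weak_formulation hA) ?_
  · have hm := fun i : Fin d => (h (EuclideanSpace.single i 1)).mem_closure
    rw [closure_gradient_eq] at *
    exact Submodule.sum_mem _ fun i _ => Submodule.smul_mem _ _ (hm i)
  · intro ψ Ψ hψ
    rw [constField_eq_sum ξ, ← Finset.sum_add_distrib]
    simp only [← smul_add, map_sum, map_smul, inner_sum, inner_smul_right]
    refine Finset.sum_eq_zero fun i _ => ?_
    rw [(h (EuclideanSpace.single i 1)).weak_formulation hA ψ Ψ hψ, mul_zero]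

theorem sum_inner_coefficientOperator (hA : IsSymmetricCoefficient μ α β A) (c : Fin d → ℝ)
    (Y : Fin d → Lp (Euc d) 2 μ) :
    ∑ i, ∑ j, c i * c j * inner ℝ (Y i) (coefficientOperator hA (Y j)) =
      inner ℝ (∑ i, c i • Y i) (coefficientOperator hA (∑ i, c i • Y i)) := by
  simp only [map_sum, map_smul, sum_inner, inner_sum, inner_smul_left, inner_smul_right,
    conj_trivial, Finset.mul_sum]
  refine Finset.sum_congr rfl fun i _ => Finset.sum_congr rfl fun j _ => ?_
  rw [coefficientOperator_symm hA (Y i) (Y j)]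
  ring

/-- The error on the homogenized coefficients is the energy of the error on the correctors. -/
theorem inner_matrix_error (hα : 0 < α) (hA : IsSymmetricCoefficient μ α β A)
    (h : ∀ ξ, IsCorrector θ A ξ (φ ξ) (Φ ξ))
    (h' : ∀ ξ, IsCorrector θ (transposeField A) ξ (φ' ξ) (Φ' ξ)) {T : ℝ} (hT : 0 < T) {k : ℕ}
    (hk : 1 ≤ k) (ξ : Euc d) :
    let e := (h ξ).gradient_memLp.toLp _ - extrapolatedGradient θ A ξ T k
    inner ℝ ξ (act (approxMatrix θ A T k - effectiveMatrix μ A Φ Φ') ξ) =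
      inner ℝ e (coefficientOperator hA e) := by
  intro e
  obtain ⟨n, rfl⟩ : ∃ n, k = n + 1 := ⟨k - 1, by omega⟩
  rw [inner_act]
  simp only [Matrix.sub_apply, mul_sub, Finset.sum_sub_distrib, approxMatrix_apply hA,
    homogenizedMatrix_apply hα hA h h']
  rw [sum_inner_coefficientOperator hA ξ fun i => constField μ (EuclideanSpace.single i 1) +
      extrapolatedGradient θ A (EuclideanSpace.single i 1) T (n + 1),
    sum_inner_coefficientOperator hA ξ fun i => constField μ (EuclideanSpace.single i 1) +
      (h (EuclideanSpace.single i 1)).gradient_memLp.toLp _]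
  simp only [smul_add, Finset.sum_add_distrib]
  rw [← constField_eq_sum, ← corrector_eq_sum hα hA h, ← extrapolatedGradient_eq_sum hα hA ξ hT]
  set Y := constField μ ξ + (h ξ).gradient_memLp.toLp _ with hY
  have e1 : constField μ ξ + extrapolatedGradient θ A ξ T (n + 1) = Y - e := by
    rw [hY]; simp only [e]; abel
  have hem : e ∈ closure {Ψ | ∃ ψ, (ψ, Ψ) ∈ gradGraph θ} := by
    have h1 := (h ξ).mem_closure
    have h2 : extrapolatedGradient θ A ξ T (n + 1) ∈
        closure {Ψ | ∃ ψ, (ψ, Ψ) ∈ gradGraph θ} := by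
      rw [extrapolatedGradient_eq_richardson hα hA ξ hT]
      exact subset_closure ⟨_, richardson_pair_mem (fun S hS => hasStochGrad_stochGrad
        (isRegularizedCorrector_regularizedCorrector hα hA ξ hS).1) n hT⟩
    rw [closure_gradient_eq] at *
    exact Submodule.sub_mem _ h1 h2
  -- Orthogonality of the corrected field Y to limits of gradients removes the cross terms in ⟨Y -
  -- e, a(Y - e)⟩ - ⟨Y, aY⟩.
  have h0 : inner ℝ e (coefficientOperator hA Y) = 0 :=
    inner_eq_zero_of_mem_closure (R := {Ψ | ∃ ψ, (ψ, Ψ) ∈ gradGraph θ})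
      (by rintro Ψ ⟨ψ, hψ⟩; exact (h ξ).weak_formulation hA ψ Ψ hψ) hem
  have h0' : inner ℝ Y (coefficientOperator hA e) = 0 := by
    rw [coefficientOperator_symm hA, h0]
  rw [e1, map_sub, inner_sub_left, inner_sub_right, inner_sub_right, h0, h0']
  ring

theorem isSymm_matrix_error (hα : 0 < α) (hA : IsSymmetricCoefficient μ α β A)
    (h : ∀ ξ, IsCorrector θ A ξ (φ ξ) (Φ ξ))
    (h' : ∀ ξ, IsCorrector θ (transposeField A) ξ (φ' ξ) (Φ' ξ)) (T : ℝ) (k : ℕ) :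
    (approxMatrix θ A T k - effectiveMatrix μ A Φ Φ').IsSymm := by
  refine Matrix.IsSymm.ext fun i j => ?_
  simp only [Matrix.sub_apply, approxMatrix_apply hA, homogenizedMatrix_apply hα hA h h']
  rw [coefficientOperator_symm hA]
  congr 1
  exact coefficientOperator_symm hA _ _

theorem inner_le_opNorm (M : Matrix (Fin d) (Fin d) ℝ) {ξ : Euc d} (hξ : ‖ξ‖ = 1) :
    |inner ℝ ξ (act M ξ)| ≤ opNorm M := by
  refine (abs_real_inner_le_norm _ _).trans ?_
  rw [hξ, one_mul]
  refine (ContinuousLinearMap.le_opNorm (Matrix.toEuclideanCLM (𝕜 := ℝ) M) ξ).trans_eq ?_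
  rw [hξ, mul_one, opNorm]

/-- The norm of a symmetric nonnegative matrix is controlled by its quadratic form. -/
theorem opNorm_le_of_quadratic_form {M : Matrix (Fin d) (Fin d) ℝ} (hM : M.IsSymm)
    (h0 : ∀ ξ : Euc d, 0 ≤ inner ℝ ξ (act M ξ)) {S : ℝ} (hS : 0 ≤ S)
    (h : ∀ ξ : Euc d, ‖ξ‖ = 1 → inner ℝ ξ (act M ξ) ≤ S) : opNorm M ≤ S := by
  have hq : ∀ x : Euc d, inner ℝ x (act M x) ≤ S * ‖x‖ ^ 2 := fun x => by
    rcases eq_or_ne x 0 with rfl | hx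
    · simp
    · have hn : 0 < ‖x‖ := norm_pos_iff.2 hx
      have h1 := h (‖x‖⁻¹ • x) (by rw [norm_smul, norm_inv, norm_norm, inv_mul_cancel₀ hn.ne'])
      rw [act_smul, inner_smul_left, inner_smul_right, conj_trivial, ← mul_assoc, ← mul_inv,
        ← sq, inv_mul_le_iff₀ (by positivity)] at h1
      linarith
  -- Polarization: 4⟨x, My⟩ is the form at x + y minus the form at x - y. The latter is nonnegative
  -- and can be dropped.
  have hb : ∀ x y : Euc d, 2 * inner ℝ x (act M y) ≤ S * (‖x‖ ^ 2 + ‖y‖ ^ 2) := fun x y => by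
    have h1 := hq (x + y)
    have h2 := h0 (x - y)
    have h3 := hq (x - y)
    have h4 := parallelogram_law_with_norm ℝ x y
    have e1 : act M (x - y) = act M x - act M y :=
      map_sub (Matrix.toEuclideanCLM (𝕜 := ℝ) M) x y
    rw [act_add, inner_add_left, inner_add_right, inner_add_right, inner_act_comm hM y x] at h1
    rw [e1, inner_sub_left, inner_sub_right, inner_sub_right, inner_act_comm hM y x] at h2
    nlinarith [mul_nonneg hS (sq_nonneg ‖x - y‖)]
  refine ContinuousLinearMap.opNorm_le_bound _ hS fun y => ?_
  change ‖act M y‖ ≤ S * ‖y‖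
  rcases eq_or_ne y 0 with rfl | hy
  · simp
  · rcases eq_or_ne (act M y) 0 with hz | hz
    · rw [hz, norm_zero]; positivity
    · have hn : 0 < ‖y‖ := norm_pos_iff.2 hy
      have hn' : 0 < ‖act M y‖ := norm_pos_iff.2 hz
      -- The vector My is rescaled to the length of y, which makes the bound on the bilinear form
      -- optimal.
      have h1 := hb ((‖y‖ / ‖act M y‖) • act M y) y
      rw [inner_smul_left, real_inner_self_eq_norm_sq, norm_smul, norm_div, norm_norm, norm_norm,
        conj_trivial, div_mul_cancel₀ _ hn'.ne'] at h1
      have e2 : ‖y‖ / ‖act M y‖ * ‖act M y‖ ^ 2 = ‖y‖ * ‖act M y‖ := by field_simp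
      rw [e2] at h1
      have h2 : ‖y‖ * ‖act M y‖ ≤ ‖y‖ * (S * ‖y‖) := by linarith
      exact le_of_mul_le_mul_left h2 hn

end Effective

end StochHom

/-! ### The two-sided estimates. -/

theorem proposition2 (d : ℕ) (hd : 2 ≤ d) (α β : ℝ) (hα : 0 < α) (hαβ : α ≤ β) :
    ∃ C : ℝ, 0 < C ∧ ∃ c : ℕ → ℝ, (∀ k, 0 < c k) ∧
      ∀ (Ω : Type u) [MeasurableSpace Ω] (μ : Measure Ω) [IsProbabilityMeasure μ]
        (θ : ErgodicTranslationGroup d μ) (A : Ω → Matrix (Fin d) (Fin d) ℝ)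
        (_ : IsSymmetricCoefficient μ α β A)
        -- the primal and dual correctors in all directions, and their gradients
        (φ φ' : Euc d → Euc d → Ω → ℝ) (Φ Φ' : Euc d → Ω → Euc d)
        (_ : ∀ ξ, IsCorrector θ A ξ (φ ξ) (Φ ξ))
        (_ : ∀ ξ, IsCorrector θ (transposeField A) ξ (φ' ξ) (Φ' ξ))
        -- the spectral resolution of `-D · A D`
        (G : ResolutionOfIdentity (Lp ℝ 2 μ)) (_ : G.IsSpectralResolutionOf (ellipticGraph θ A))
        (T : ℝ) (_ : 0 < T) (k : ℕ) (_ : 1 ≤ k),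
        (∀ ξ : Euc d, ‖ξ‖ = 1 →
          ENNReal.ofReal (c k) * driftIntegral θ A G ξ T k
              ≤ ENNReal.ofReal (∫ ω, ‖extrapolatedGradient θ A ξ T k ω - Φ ξ ω‖ ^ 2 ∂μ) ∧
          ENNReal.ofReal (∫ ω, ‖extrapolatedGradient θ A ξ T k ω - Φ ξ ω‖ ^ 2 ∂μ)
              ≤ ENNReal.ofReal C * driftIntegral θ A G ξ T k ∧
          ENNReal.ofReal (c k) * driftIntegral θ A G ξ T k
              ≤ ENNReal.ofReal
                |inner ℝ ξ (act (approxMatrix θ A T k - effectiveMatrix μ A Φ Φ') ξ)| ∧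
          ENNReal.ofReal |inner ℝ ξ (act (approxMatrix θ A T k - effectiveMatrix μ A Φ Φ') ξ)|
              ≤ ENNReal.ofReal C * driftIntegral θ A G ξ T k) ∧
        ENNReal.ofReal (c k) * (⨆ (ξ : Euc d) (_ : ‖ξ‖ = 1), driftIntegral θ A G ξ T k)
            ≤ ENNReal.ofReal (opNorm (approxMatrix θ A T k - effectiveMatrix μ A Φ Φ')) ∧
        ENNReal.ofReal (opNorm (approxMatrix θ A T k - effectiveMatrix μ A Φ Φ'))
            ≤ ENNReal.ofReal C * (⨆ (ξ : Euc d) (_ : ‖ξ‖ = 1), driftIntegral θ A G ξ T k) := by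
  have hβ : 0 < β := hα.trans_le hαβ
  have hκ : 0 < min 1 β⁻¹ := lt_min one_pos (inv_pos.2 hβ)
  -- The entries 1 serve the matrix error, which equals the energy; α⁻¹ and β⁻¹ convert the energy
  -- into the squared norm of the gradient error.
  refine ⟨max 1 α⁻¹, by positivity, fun k => min 1 β⁻¹ * extrapolationConstant k,
    fun k => mul_pos hκ (extrapolationConstant_pos k), ?_⟩
  intro Ω _ μ _ θ A hA φ φ' Φ Φ' h h' G hG T hT k hk
  have hfirst : ∀ ξ : Euc d,
      ENNReal.ofReal (min 1 β⁻¹ * extrapolationConstant k) * driftIntegral θ A G ξ T k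
          ≤ ENNReal.ofReal (∫ ω, ‖extrapolatedGradient θ A ξ T k ω - Φ ξ ω‖ ^ 2 ∂μ) ∧
      ENNReal.ofReal (∫ ω, ‖extrapolatedGradient θ A ξ T k ω - Φ ξ ω‖ ^ 2 ∂μ)
          ≤ ENNReal.ofReal (max 1 α⁻¹) * driftIntegral θ A G ξ T k ∧
      ENNReal.ofReal (min 1 β⁻¹ * extrapolationConstant k) * driftIntegral θ A G ξ T k
          ≤ ENNReal.ofReal
            |inner ℝ ξ (act (approxMatrix θ A T k - effectiveMatrix μ A Φ Φ') ξ)| ∧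
      ENNReal.ofReal |inner ℝ ξ (act (approxMatrix θ A T k - effectiveMatrix μ A Φ Φ') ξ)|
          ≤ ENNReal.ofReal (max 1 α⁻¹) * driftIntegral θ A G ξ T k := by
    intro ξ
    obtain ⟨h1, h2⟩ := driftIntegral_bounds hα hA hG (h ξ).mem_closure
      ((h ξ).weak_formulation hA) hT hk
    rw [inner_matrix_error hα hA h h' hT hk ξ]
    set e := (h ξ).gradient_memLp.toLp _ - extrapolatedGradient θ A ξ T k with he
    have hnorm : ∫ ω, ‖extrapolatedGradient θ A ξ T k ω - Φ ξ ω‖ ^ 2 ∂μ = ‖e‖ ^ 2 := by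
      rw [norm_sq_eq_integral]
      refine integral_congr_ae ?_
      filter_upwards [Lp.coeFn_sub ((h ξ).gradient_memLp.toLp _) (extrapolatedGradient θ A ξ T k),
        (h ξ).gradient_memLp.coeFn_toLp] with ω g1 g2
      rw [he, g1, Pi.sub_apply, g2, norm_sub_rev]
    have hnn : 0 ≤ inner ℝ e (coefficientOperator hA e) :=
      inner_nonneg_of_coercive hα (coefficientOperator_coercive hA) e
    have hlow := coefficientOperator_coercive hA e
    have hup := inner_coefficientOperator_le hA e
    rw [hnorm, abs_of_nonneg hnn]
    have h3 : ENNReal.ofReal (min 1 β⁻¹ * extrapolationConstant k) * driftIntegral θ A G ξ T k ≤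
        ENNReal.ofReal (min 1 β⁻¹ * inner ℝ e (coefficientOperator hA e)) := by
      rw [ENNReal.ofReal_mul hκ.le, ENNReal.ofReal_mul hκ.le, mul_assoc]
      gcongr
    have h4 : inner ℝ e (coefficientOperator hA e) ≤ max 1 α⁻¹ *
        inner ℝ e (coefficientOperator hA e) :=
      le_mul_of_one_le_left hnn (le_max_left _ _)
    have h5 : ‖e‖ ^ 2 ≤ max 1 α⁻¹ * inner ℝ e (coefficientOperator hA e) := by
      calc ‖e‖ ^ 2 = α⁻¹ * (α * ‖e‖ ^ 2) := by field_simp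
        _ ≤ α⁻¹ * inner ℝ e (coefficientOperator hA e) := by gcongr
        _ ≤ _ := by gcongr; exact le_max_right _ _
    have h6 : ENNReal.ofReal (max 1 α⁻¹ * inner ℝ e (coefficientOperator hA e)) ≤
        ENNReal.ofReal (max 1 α⁻¹) * driftIntegral θ A G ξ T k := by
      rw [ENNReal.ofReal_mul (by positivity)]
      gcongr
    refine ⟨h3.trans (ENNReal.ofReal_le_ofReal ?_), (ENNReal.ofReal_le_ofReal h5).trans h6,
      h3.trans (ENNReal.ofReal_le_ofReal ?_), (ENNReal.ofReal_le_ofReal h4).trans h6⟩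
    · calc min 1 β⁻¹ * inner ℝ e (coefficientOperator hA e) ≤ β⁻¹ * (β * ‖e‖ ^ 2) := by
            gcongr; exact min_le_right _ _
        _ = ‖e‖ ^ 2 := by field_simp
    · exact mul_le_of_le_one_left hnn (min_le_left _ _)
  refine ⟨fun ξ _ => hfirst ξ, ?_, ?_⟩
  · simp only [ENNReal.mul_iSup]
    refine iSup₂_le fun ξ hξ => (hfirst ξ).2.2.1.trans (ENNReal.ofReal_le_ofReal ?_)
    exact inner_le_opNorm _ hξ
  · set I := ⨆ (ξ : Euc d) (_ : ‖ξ‖ = 1), driftIntegral θ A G ξ T k with hI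
    -- An infinite right side is trivial; otherwise it is a real number that can bound the quadratic
    -- form.
    by_cases htop : ENNReal.ofReal (max 1 α⁻¹) * I = ∞
    · rw [htop]; exact le_top
    · rw [← ENNReal.ofReal_toReal htop]
      refine ENNReal.ofReal_le_ofReal (opNorm_le_of_quadratic_form
        (isSymm_matrix_error hα hA h h' T k) (fun ξ => ?_) ENNReal.toReal_nonneg fun ξ hξ => ?_)
      · rw [inner_matrix_error hα hA h h' hT hk ξ]
        exact inner_nonneg_of_coercive hα (coefficientOperator_coercive hA) _
      · refine (le_abs_self _).trans ((ENNReal.ofReal_le_iff_le_toReal htop).1 ?_)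
        refine (hfirst ξ).2.2.2.trans ?_
        gcongr
        exact le_iSup₂ (f := fun (ξ : Euc d) (_ : ‖ξ‖ = 1) => driftIntegral θ A G ξ T k) ξ hξ
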